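/- Let $\Bbbk$ be a field. **Indexing sheaf.** For $d\ge 1$ let $\mathcal P_d$ be the group of finite sums $\sum_{q} c_q x^{-q}$ with $c_q\in\mathbb C$, $q\in\frac1d\mathbb Z$, $q>0$ (polar parts of convergent Laurent series in $x^{1/d}$), and let $\mathcal I_d$ be the local system on $S^1$ whose sections on an open set $U$ are the locally constant families of elements of $\mathcal P_d$ on the preimage of $U$ under $\mathbb R\to S^1$, $t\mapsto e^{it}$, such that the elements at $t$ and $t+2\pi$ define the same germ of function in the direction $e^{it}$ (at $t$, $x^{-q}$ means $r^{-q}e^{-iqt}$). Thus $\mathcal I_1$ is the constant sheaf with fibre $\mathcal P=\mathbb C\{x\}[x^{-1}]/\mathbb C\{x\}$. Put $\mathcal I=\bigcup_d\mathcal I_d$. For germs at $\theta=e^{it}$, one sets $\psi\le_\theta\varphi$ if $\psi=\varphi$ or if the dominant monomial $c\,x^{-q}$ of $\psi-\varphi$ satisfies $\operatorname{Re}(c\,e^{-iqt})<0$, and $\psi<_\theta\varphi$ if moreover $\psi\ne\varphi$. Below, $\mathcal J$ denotes either $\mathcal I$ or one of the $\mathcal I_d$ (Stokes filtrations ramified of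 order $\le d$); the case $\mathcal J=\mathcal I_1$ is called non-ramified. **Stokes filtrations.** A Stokes-prefiltered sheaf $(\mathcal L,\mathcal L_\bullet)$ is a sheaf $\mathcal L$ of $\Bbbk$-vector spaces on $S^1$ with subsheaves $\mathcal L_{\le\varphi}\subset\mathcal L|_U$, for all open $U$ and $\varphi\in\mathcal J(U)$, compatible with restriction and such that $\psi\le_\theta\varphi$ implies $\mathcal L_{\le\psi,\theta}\subset\mathcal L_{\le\varphi,\theta}$. A morphism is a morphism of sheaves $\lambda:\mathcal L\to\mathcal L'$ with $\lambda(\mathcal L_{\le\varphi})\subset\mathcal L'_{\le\varphi}$ for all $\varphi$; it is strict if $\lambda(\mathcal L_{\le\varphi})=\lambda(\mathcal L)\cap\mathcal L'_{\le\varphi}$ for all $\varphi$. A trivialization on an open set $U$ is an isomorphism $\mathcal L|_U\simeq\bigoplus_{\psi\in\Phi_U}G_\psi$, where $\Phi_U\subset\mathcal J(U)$ is finite and the $G_\psi$ are constant sheaves of finite rank, under which, for every $V\subset U$ and $\varphi\in\mathcal J(V)$, $\mathcal L_{\le\varphi}$ corresponds to the sheaf of those sections whose $\psi$-component has zero germ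 at each $\theta\in V$ where $\psi\le_\theta\varphi$ fails. A Stokes-filtered local system is a Stokes-prefiltered sheaf which has a trivialization in the neighbourhood of every point of $S^1$; these form a full subcategory. Put $\mathcal L_{<\varphi,\theta}=\sum_{\psi<_\theta\varphi}\mathcal L_{\le\psi,\theta}$ and $\operatorname{gr}_\varphi\mathcal L=\mathcal L_{\le\varphi}/\mathcal L_{<\varphi}$. In the non-ramified case, the set of exponential factors is $\Phi(\mathcal L)=\{\varphi\in\mathcal P\mid\operatorname{gr}_\varphi\mathcal L\ne0\}$. **Theorem.** (1) For $\mathcal J=\mathcal I$, as well as for $\mathcal J=\mathcal I_d$ with any $d\ge1$: (a) the category of $\Bbbk$-Stokes-filtered local systems on $S^1$, with its usual addition of morphisms, is abelian; (b) every morphism $\lambda:(\mathcal L,\mathcal L_\bullet)\to(\mathcal L',\mathcal L'_\bullet)$ of Stokes-filtered local systems is strict, and $\ker\lambda$ (with the filtration induced by $\mathcal L_\bullet$), $\operatorname{im}\lambda$ (with the filtration induced by $\mathcal L'_\bullet$ or, equivalently, the quotient filtration of $\mathcal L_\bullet$) and $\operatorname{coker}\lambda$ (with the quotient filtration of $\mathcal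 L'_\bullet$) are Stokes-filtered local systems; (c) this category is stable by extension in the category of Stokes-prefiltered sheaves: if $0\to\mathcal L'\to\mathcal L\to\mathcal L''\to0$ is an exact sequence of Stokes-prefiltered sheaves (i.e. it is exact and $0\to\mathcal L'_{\le\varphi}\to\mathcal L_{\le\varphi}\to\mathcal L''_{\le\varphi}\to0$ is exact for every local section $\varphi$ of $\mathcal J$) and $\mathcal L'$, $\mathcal L''$ are Stokes-filtered local systems, then so is $\mathcal L$. (2) Let $(\mathcal L,\mathcal L_\bullet)$ and $(\mathcal L',\mathcal L'_\bullet)$ be two non-ramified Stokes-filtered local systems. In the neighbourhood of any point of $S^1$ there exist trivializations of both such that every morphism $\lambda:(\mathcal L,\mathcal L_\bullet)\to(\mathcal L',\mathcal L'_\bullet)$ is diagonal with respect to them (its components $G_\psi\to G'_{\psi'}$ with $\psi\ne\psi'$ are zero). Moreover, for every such morphism $\lambda$, $$\Phi(\ker\lambda)\subset\Phi(\mathcal L),\qquad \Phi(\operatorname{coker}\lambda)\subset\Phi(\mathcal L'),\qquad \Phi(\operatorname{im}\lambda)\subset\Phi(\mathcal L)\cap\Phi(\mathcal L').$$ -/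

import Mathlib

open CategoryTheory TopologicalSpace Opposite

universe u

noncomputable section

namespace Stokes

/-! ## The sheaf of ordered abelian groups of (ramified) polar parts on the circle -/

/-- The preimage of an open set `U` of the circle in the universal covering
`ℝ → S¹`, `t ↦ exp (i t)`. -/
abbrev Lift (U : Opens Circle) : Type := {t : ℝ // Circle.exp t ∈ U}

/-- The restriction of lifts along `V ≤ U`. -/
def Lift.incl {V U : Opens Circle} (h : V ≤ U) (t : Lift V) : Lift U := ⟨t.1, h t.2⟩

/-- The group of exponents of the polar parts in `x ^ (1 / d)`, that is `(1 / d) ℤ`. -/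
def exponents (d : ℕ) : AddSubgroup ℚ := AddSubgroup.zmultiples (d : ℚ)⁻¹

/-- A finitely supported `c : ℚ →₀ ℂ` together with a real number `t` stands for the germ, in the
direction `exp (i t)`, of the polar part `∑ q, c q * x ^ (-q)`, with the branch of `x ^ (-q)`
given by `x = r * exp (i t)`, `x ^ (-q) = r ^ (-q) * exp (-i q t)`.

`LeAt t a b` is the order of the polar parts at this direction: either `a = b`, or the dominant
monomial `c * x ^ (-q)` of `a - b` has negative real part along the direction. -/
def LeAt (t : ℝ) (a b : ℚ →₀ ℂ) : Prop :=
  a = b ∨ ∃ q : ℚ, (a - b) q ≠ 0 ∧ (∀ p : ℚ, q < p → (a - b) p = 0) ∧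
    ((a - b) q * Complex.exp (-(Complex.I * (q : ℂ) * (t : ℂ)))).re < 0

/-- The strict order at a direction. -/
def LtAt (t : ℝ) (a b : ℚ →₀ ℂ) : Prop := LeAt t a b ∧ a ≠ b

/-- Sections over `U` of the sheaf of polar parts with exponents in `E`, as an additive group:
locally constant families of polar parts `c t` on the preimage of `U` in `ℝ` such that `c t` and
`c (t + 2 π)` represent the same germ of function, because
`c (t + 2 π) q = exp (2 π i q) * c t q`.

For `E = exponents d` this is the local system `𝓘_d` with fibre the polar parts in `x ^ (1 / d)`
(for `d = 1`, the constant sheaf of polar parts of Laurent series);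
for `E = ⊤` it is the union of all these. -/
def Index (E : AddSubgroup ℚ) (U : Opens Circle) : AddSubgroup (Lift U → (ℚ →₀ ℂ)) where
  carrier := {c | IsLocallyConstant c ∧ (∀ t q, c t q ≠ 0 → 0 < q ∧ q ∈ E) ∧
    ∀ s t : Lift U, (s : ℝ) = t + 2 * Real.pi →
      ∀ q, c s q = Complex.exp (2 * Real.pi * Complex.I * (q : ℂ)) * c t q}
  zero_mem' := ⟨IsLocallyConstant.const 0, by simp, by simp⟩
  add_mem' := by
    rintro a b ⟨ha, ha', ha''⟩ ⟨hb, hb', hb''⟩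
    refine ⟨ha.add hb, fun t q h => ?_, fun s t h q => ?_⟩
    · by_cases h0 : a t q = 0
      · exact hb' t q fun h1 => h (by simp [h0, h1])
      · exact ha' t q h0
    · simp [ha'' s t h q, hb'' s t h q, mul_add]
  neg_mem' := by
    rintro a ⟨ha, ha', ha''⟩
    exact ⟨ha.neg, fun t q h => ha' t q (by simpa using h), fun s t h q => by
      simp [ha'' s t h q]⟩

variable {E : AddSubgroup ℚ}

/-- Restriction of sections of the sheaf of polar parts. -/
def Index.res {U V : Opens Circle} (h : V ≤ U) (φ : Index E U) : Index E V :=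
  ⟨fun t => φ.1 (Lift.incl h t),
    φ.2.1.comp_continuous (Continuous.subtype_mk continuous_subtype_val _),
    fun t q => φ.2.2.1 (Lift.incl h t) q,
    fun s t hst q => φ.2.2.2 (Lift.incl h s) (Lift.incl h t) hst q⟩

lemma Index.res_res {U V W : Opens Circle} (h : V ≤ U) (h' : W ≤ V) (φ : Index E U) :
    Index.res h' (Index.res h φ) = Index.res (h'.trans h) φ := rfl

/-- The order on sections of the sheaf of polar parts: the order at all directions. -/
def Index.Le {U : Opens Circle} (φ ψ : Index E U) : Prop :=
  ∀ t : Lift U, LeAt t (φ.1 t) (ψ.1 t)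

/-- `φ < ψ` as germs at the point `y`. -/
def Index.LtGerm {U : Opens Circle} (y : Circle) (φ ψ : Index E U) : Prop :=
  ∀ t : Lift U, Circle.exp t = y → LtAt t (φ.1 t) (ψ.1 t)

/-! ## Sheaves of vector spaces on the circle -/

variable (k : Type u) [Field k]

/-- Sheaves of `k`-vector spaces on the circle. -/
abbrev Sh : Type (u + 1) := Sheaf (Opens.grothendieckTopology Circle) (ModuleCat.{u} k)

instance : HasSheafify (Opens.grothendieckTopology Circle) (ModuleCat.{u} k) := by
  have : Limits.PreservesFilteredColimitsOfSize.{u, u} (forget (ModuleCat.{u} k)) := inferInstance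
  have : Limits.PreservesFilteredColimitsOfSize.{0, 0} (forget (ModuleCat.{u} k)) :=
    Limits.preservesFilteredColimitsOfSize_shrink.{0, u, 0, u} _
  infer_instance

variable {k}

/-- Sections of a sheaf. -/
abbrev Sec (F : Sh k) (U : Opens Circle) : Type u := F.obj.obj (op U)

/-- Restriction of sections. -/
def res (F : Sh k) {U V : Opens Circle} (h : V ≤ U) : Sec F U →ₗ[k] Sec F V :=
  (F.obj.map (homOfLE h).op).hom

/-- The map induced by a morphism of sheaves on sections. -/
def onSec {F G : Sh k} (f : F ⟶ G) (U : Opens Circle) : Sec F U →ₗ[k] Sec G U :=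
  (f.hom.app (op U)).hom

lemma res_res (F : Sh k) {U V W : Opens Circle} (h : V ≤ U) (h' : W ≤ V) (s : Sec F U) :
    res F h' (res F h s) = res F (h'.trans h) s := by
  have : F.obj.map (homOfLE (h'.trans h)).op =
      F.obj.map (homOfLE h).op ≫ F.obj.map (homOfLE h').op := by
    rw [← F.obj.map_comp]; rfl
  simp only [res, this]
  rfl

lemma onSec_res {F G : Sh k} (f : F ⟶ G) {U V : Opens Circle} (h : V ≤ U) (s : Sec F U) :
    onSec f V (res F h s) = res G h (onSec f U s) :=
  congrArg (fun m => m.hom s) (f.hom.naturality (homOfLE h).op)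

/-! ## Stokes-prefiltered sheaves -/

/-- A sheaf `F` of `k`-vector spaces on the circle with a pre-`𝓘`-filtration, that is, a
subsheaf `F_≤` of the pull-back `μ⁻¹ F` to the étale space `μ : 𝓘ᵉᵗ → S¹` which is compatible
with the order. Such a subsheaf is given by its values on the open sets `φ(U)` of the étale space,
for `U` open in the circle and `φ` a section of `𝓘` on `U`. -/
structure PreStokes (k : Type u) [Field k] (E : AddSubgroup ℚ) where
  /-- the underlying sheaf -/
  sheaf : Sh k
  /-- the sections on `U` of the subsheaf `F_{≤ φ}` of `F` restricted to `U` -/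
  le : ∀ U : Opens Circle, Index E U → Submodule k (Sec sheaf U)
  le_res : ∀ {U V : Opens Circle} (h : V ≤ U) (φ : Index E U) (s : Sec sheaf U),
    s ∈ le U φ → res sheaf h s ∈ le V (Index.res h φ)
  le_local : ∀ (U : Opens Circle) (φ : Index E U) (s : Sec sheaf U),
    (∀ y ∈ U, ∃ (V : Opens Circle) (h : V ≤ U), y ∈ V ∧ res sheaf h s ∈ le V (Index.res h φ)) →
      s ∈ le U φ
  le_mono : ∀ (U : Opens Circle) (φ ψ : Index E U), Index.Le φ ψ → le U φ ≤ le U ψ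

namespace PreStokes

/-- Morphisms of sheaves `λ` such that `λ (F_{≤ φ}) ⊆ G_{≤ φ}` for all local sections `φ`. -/
def homs (F G : PreStokes k E) : AddSubgroup (F.sheaf ⟶ G.sheaf) where
  carrier := {f | ∀ U φ s, s ∈ F.le U φ → onSec f U s ∈ G.le U φ}
  zero_mem' := fun U φ _ _ => (G.le U φ).zero_mem
  add_mem' := fun ha hb U φ s hs => (G.le U φ).add_mem (ha U φ s hs) (hb U φ s hs)
  neg_mem' := fun ha U φ s hs => (G.le U φ).neg_mem (ha U φ s hs)

/-- A morphism of Stokes-prefiltered sheaves. -/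
@[ext]
structure Hom (F G : PreStokes k E) where
  /-- the underlying morphism of sheaves -/
  hom : F.sheaf ⟶ G.sheaf
  mem : hom ∈ homs F G

instance : Category (PreStokes k E) where
  Hom := Hom
  id F := ⟨𝟙 _, fun _ _ _ hs => hs⟩
  comp f g := ⟨f.hom ≫ g.hom, fun U φ s hs => g.mem U φ _ (f.mem U φ s hs)⟩

/-- Morphisms of Stokes-prefiltered sheaves are a subgroup of the morphisms of sheaves. -/
def homEquiv (F G : PreStokes k E) : (F ⟶ G) ≃ homs F G where
  toFun f := ⟨f.hom, f.mem⟩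
  invFun f := ⟨f.1, f.2⟩
  left_inv _ := rfl
  right_inv _ := rfl

instance (F G : PreStokes k E) : AddCommGroup (F ⟶ G) := (homEquiv F G).addCommGroup

instance : Preadditive (PreStokes k E) where
  add_comp _ _ _ f f' g := Hom.ext (Preadditive.add_comp _ _ _ f.hom f'.hom g.hom)
  comp_add _ _ _ f g g' := Hom.ext (Preadditive.comp_add _ _ _ f.hom g.hom g'.hom)

/-- `t` is a section of the subsheaf `f (F_{≤ φ})`, the image of `F_{≤ φ}` under the morphism of
sheaves `f : F ⟶ G`. -/
def MemMapLe (F : PreStokes k E) {G : Sh k} (f : F.sheaf ⟶ G) (U : Opens Circle) (φ : Index E U)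
    (t : Sec G U) : Prop :=
  ∀ y ∈ U, ∃ (V : Opens Circle) (h : V ≤ U), y ∈ V ∧
    ∃ s ∈ F.le V (Index.res h φ), onSec f V s = res G h t

/-- The filtration induced on `K` by a morphism of sheaves `i : K ⟶ F` (the inverse image of the
filtration of `F`; for `i` a monomorphism, the induced filtration on a subsheaf). -/
def comap (F : PreStokes k E) {K : Sh k} (i : K ⟶ F.sheaf) : PreStokes k E where
  sheaf := K
  le U φ := (F.le U φ).comap (onSec i U)
  le_res h φ s hs := by
    simp only [Submodule.mem_comap] at hs ⊢
    rw [onSec_res]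
    exact F.le_res h φ _ hs
  le_local U φ s hs := by
    refine F.le_local U φ _ fun y hy => ?_
    obtain ⟨V, h, hyV, hV⟩ := hs y hy
    exact ⟨V, h, hyV, by rwa [← onSec_res]⟩
  le_mono U φ ψ h := Submodule.comap_mono (F.le_mono U φ ψ h)

/-- The filtration induced on `Q` by a morphism of sheaves `p : F ⟶ Q` (the image of the
filtration of `F`; for `p` an epimorphism, the quotient filtration). -/
def map (F : PreStokes k E) {Q : Sh k} (p : F.sheaf ⟶ Q) : PreStokes k E where
  sheaf := Q
  le U φ :=
    { carrier := {t | F.MemMapLe p U φ t}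
      zero_mem' := fun y hy =>
        ⟨U, le_rfl, hy, 0, Submodule.zero_mem _, by simp⟩
      add_mem' := by
        intro a b ha hb y hy
        obtain ⟨V, h, hyV, s, hs, hsa⟩ := ha y hy
        obtain ⟨V', h', hyV', s', hs', hsb⟩ := hb y hy
        refine ⟨V ⊓ V', inf_le_left.trans h, ⟨hyV, hyV'⟩,
          res F.sheaf inf_le_left s + res F.sheaf inf_le_right s',
          Submodule.add_mem _ (F.le_res inf_le_left _ s hs) (F.le_res inf_le_right _ s' hs'), ?_⟩
        rw [map_add, map_add, onSec_res, onSec_res, hsa, hsb, res_res, res_res]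
      smul_mem' := by
        intro c a ha y hy
        obtain ⟨V, h, hyV, s, hs, hsa⟩ := ha y hy
        exact ⟨V, h, hyV, c • s, Submodule.smul_mem _ _ hs, by rw [map_smul, map_smul, hsa]⟩ }
  le_res := by
    intro U V h φ t ht y hy
    obtain ⟨W, hW, hyW, s, hs, hst⟩ := ht y (h hy)
    refine ⟨V ⊓ W, inf_le_left, ⟨hy, hyW⟩, res F.sheaf inf_le_right s,
      F.le_res inf_le_right _ s hs, ?_⟩
    rw [onSec_res, hst, res_res, res_res]
  le_local := by
    intro U φ t ht y hy
    obtain ⟨V, h, hyV, hV⟩ := ht y hy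
    obtain ⟨W, hW, hyW, s, hs, hst⟩ := hV y hyV
    exact ⟨W, hW.trans h, hyW, s, hs, by rw [hst, res_res]⟩
  le_mono := by
    intro U φ ψ h t ht y hy
    obtain ⟨V, hV, hyV, s, hs, hst⟩ := ht y hy
    exact ⟨V, hV, hyV, s, F.le_mono V (Index.res hV φ) (Index.res hV ψ) (fun t => h (Lift.incl hV t)) hs, hst⟩

/-- The kernel of a morphism, with the filtration induced by that of the source. -/
def ker {F G : PreStokes k E} (f : F ⟶ G) : PreStokes k E :=
  F.comap (Limits.kernel.ι f.hom)

/-- The cokernel of a morphism, with the quotient of the filtration of the target. -/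
def coker {F G : PreStokes k E} (f : F ⟶ G) : PreStokes k E :=
  G.map (Limits.cokernel.π f.hom)

/-- The image of a morphism, with the filtration induced by that of the target. -/
def im {F G : PreStokes k E} (f : F ⟶ G) : PreStokes k E :=
  G.comap (Abelian.image.ι f.hom)

/-- The image of a morphism, with the quotient of the filtration of the source. -/
def coim {F G : PreStokes k E} (f : F ⟶ G) : PreStokes k E :=
  F.map (Abelian.factorThruImage f.hom)

/-- A morphism `f : F ⟶ G` is strict if `f (F_{≤ φ}) = f (F) ∩ G_{≤ φ}` as subsheaves of `G`,
for any local section `φ` of `𝓘`. -/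
def IsStrict {F G : PreStokes k E} (f : F ⟶ G) : Prop :=
  ∀ (U : Opens Circle) (φ : Index E U) (t : Sec G.sheaf U),
    F.MemMapLe f.hom U φ t ↔
      t ∈ G.le U φ ∧ ∀ y ∈ U, ∃ (V : Opens Circle) (h : V ≤ U), y ∈ V ∧
        ∃ s : Sec F.sheaf V, onSec f.hom V s = res G.sheaf h t

/-- `0 → A → B → C → 0` is exact as a sequence of filtered sheaves: it is exact, and
`0 → A_{≤ φ} → B_{≤ φ} → C_{≤ φ} → 0` is exact for any local section `φ` of `𝓘`. -/
structure IsShortExact {A B C : PreStokes k E} (f : A ⟶ B) (g : B ⟶ C) : Prop where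
  injective : ∀ U, Function.Injective (onSec f.hom U)
  exact : ∀ U, Function.Exact (onSec f.hom U) (onSec g.hom U)
  surjective : ∀ (U : Opens Circle) (t : Sec C.sheaf U), ∀ y ∈ U,
    ∃ (V : Opens Circle) (h : V ≤ U), y ∈ V ∧ ∃ s, onSec g.hom V s = res C.sheaf h t
  exact_le : ∀ U (φ : Index E U) (s : Sec A.sheaf U), onSec f.hom U s ∈ B.le U φ → s ∈ A.le U φ
  surjective_le : ∀ U (φ : Index E U), ∀ t ∈ C.le U φ, B.MemMapLe g.hom U φ t

/-! ## Stokes-filtered local systems -/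

/-- A trivialization of a filtered sheaf on an open set `U`: a finite set `Φ` of sections of `𝓘`
on `U` and an isomorphism of `F` on `U` with the direct sum of constant sheaves `G_ψ` of finite
rank, for `ψ ∈ Φ`, such that `F_{≤ φ}` is the subsheaf `⨁ β_{ψ ≤ φ} G_ψ` (the components of the
germ of a section at a point at which `ψ ≤ φ` does not hold are zero). -/
structure Trivialization (F : PreStokes k E) (U : Opens Circle) where
  /-- the exponential factors on `U` -/
  Φ : Finset (Index E U)
  /-- the ranks of the graded pieces -/
  rank : Φ → ℕ
  /-- the isomorphism, on the sections over open subsets of `U` -/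
  iso : ∀ W : Opens Circle, W ≤ U →
    (Sec F.sheaf W ≃ₗ[k] ((ψ : Φ) → LocallyConstant W (Fin (rank ψ) → k)))
  iso_res : ∀ {V W : Opens Circle} (hW : W ≤ U) (hV : V ≤ W) (s : Sec F.sheaf W) (ψ : Φ) (y : V),
    iso V (hV.trans hW) (res F.sheaf hV s) ψ y = iso W hW s ψ ⟨y.1, hV y.2⟩
  mem_le_iff : ∀ {W : Opens Circle} (hW : W ≤ U) (φ : Index E W) (s : Sec F.sheaf W),
    s ∈ F.le W φ ↔ ∀ (ψ : Φ) (t : Lift W),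
      iso W hW s ψ ⟨Circle.exp t, t.2⟩ ≠ 0 → LeAt t ((ψ : Index E U).1 (Lift.incl hW t)) (φ.1 t)

/-- A filtered sheaf is a Stokes-filtered local system if it is, locally on the circle, isomorphic
to a graded one. -/
def IsStokes : ObjectProperty (PreStokes k E) := fun F =>
  ∀ y : Circle, ∃ U : Opens Circle, y ∈ U ∧ Nonempty (Trivialization F U)

open scoped Classical in
/-- A morphism is diagonal with respect to trivializations of its source and target if its
components between graded pieces with distinct exponential factors are zero. -/
def IsDiagonal {F G : PreStokes k E} {U : Opens Circle} (T : Trivialization F U)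
    (T' : Trivialization G U) (f : F ⟶ G) : Prop :=
  ∀ (W : Opens Circle) (hW : W ≤ U) (ψ : T.Φ) (ψ' : T'.Φ),
    (ψ : Index E U) ≠ (ψ' : Index E U) →
    ∀ v : LocallyConstant W (Fin (T.rank ψ) → k),
      T'.iso W hW (onSec f.hom W ((T.iso W hW).symm (Pi.single ψ v))) ψ' = 0

/-- `s` is a section of the subsheaf `F_{< φ}`, whose germ at `y` is the sum of the germs at `y`
of `F_{≤ ψ}`, for all germs `ψ` at `y` such that `ψ < φ` at `y`. -/
def MemLt (F : PreStokes k E) (U : Opens Circle) (φ : Index E U) (s : Sec F.sheaf U) : Prop :=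
  ∀ y ∈ U, ∃ (V : Opens Circle) (h : V ≤ U), y ∈ V ∧
    res F.sheaf h s ∈ ⨆ (ψ : Index E V) (_ : Index.LtGerm y ψ (Index.res h φ)), F.le V ψ

/-- The set of the exponential factors: the global sections `φ` of `𝓘` such that the sheaf
`gr_φ F = F_{≤ φ} / F_{< φ}` is not zero. (In the non-ramified case `E = exponents 1`, the
sheaf `𝓘` is constant and its global sections are the elements of its fibre.) -/
def expFactors (F : PreStokes k E) : Set (Index E ⊤) :=
  {φ | ∃ (U : Opens Circle) (s : Sec F.sheaf U),
    s ∈ F.le U (Index.res le_top φ) ∧ ¬ F.MemLt U (Index.res le_top φ) s}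

end PreStokes

/-- The category of Stokes-filtered local systems, a full subcategory of the category of
Stokes-prefiltered sheaves. -/
abbrev StokesLocSys (k : Type u) [Field k] (E : AddSubgroup ℚ) :=
  (PreStokes.IsStokes : ObjectProperty (PreStokes k E)).FullSubcategory

end Stokes

end

/-!
The whole theorem rests on one local fact, `exists_diagonal_frames`: near each point of the circle,
two Stokes-filtered local systems `F` and `G` have trivializations with respect to which *every*
morphism `F ⟶ G` is diagonal.

Trivializations are handled through frames (`Frame`): finite bases of sections, each labelled by a
section of the sheaf of polar parts. With respect to frames, a morphism is a locally constant matrix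
whose entry at `(i, j)` can be nonzero at a direction `t` only if `label i ≤ label j` at `t`
(`Frame.mat_le`). Since an invertible matrix which is triangular together with its inverse
preserves the multiplicities of labels, frames with given labels propagate along the universal
covering `ℝ` of the circle (`HasFrameAt.of_exists`), the ramification being absorbed there; on a
long interval, a Stokes filtration becomes a finite sequence of frames and of triangular transition matrices
(`exists_frames_along`).

The linear algebra is `exists_diagonalization`, by induction on the number of exponents that occur.
Let `q` be the largest one. On an arc of length `π / q`, the order between two given polar parts
changes at most once (`leAt_left_or_right`), so that a triangular matrix at a point of the arc is a
product of a matrix triangular on the left of the point and of one triangular on the right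
(`exists_factorization`). Hence the frames can be modified to agree on the whole arc. On the other
hand, polar parts with different coefficients of order `q` cannot be comparable in the same way on
the whole arc (`not_leAt_on_arc`), so that morphisms are block diagonal for the coefficients of
order `q`. Their diagonal blocks are morphisms between the graded pieces of level `q`, which are
given by the block diagonal parts of the transition matrices (`part_mul`) and have fewer exponents.

Once all morphisms are diagonal, a single morphism between `F` and `G` takes the normal form
`fromBlocks 1 0 0 0`, with equal labels in the block `1` (`exists_normalFrames`). Strictness, frames
for the kernel, the image, the coimage and the cokernel, and the inclusions between the sets of
exponential factors are then visible on the bases. In the category of Stokes-filtered local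
systems, the kernels and cokernels of sheaves serve as kernels and cokernels, and strictness says
that monomorphisms and epimorphisms are normal, whence an abelian category. Stability by extension
(`isStokes_of_isShortExact`) is independent of this: frames of the sub and adapted local lifts of a
frame of the quotient form a frame of the extension.
-/

noncomputable section

namespace Stokes

/-! ### The order on polar parts at a direction -/

/-- The exponential of the polar part `d` decays in the direction `exp (i t)`: the dominant monomial
of `d` has negative real part there. -/
def Neg (t : ℝ) (d : ℚ →₀ ℂ) : Prop :=
  ∃ q : ℚ, d q ≠ 0 ∧ (∀ p : ℚ, q < p → d p = 0) ∧
    (d q * Complex.exp (-(Complex.I * (q : ℂ) * (t : ℂ)))).re < 0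

lemma leAt_iff {t : ℝ} {a b : ℚ →₀ ℂ} : LeAt t a b ↔ a = b ∨ Neg t (a - b) := Iff.rfl

lemma Neg.ne_zero {t : ℝ} {d : ℚ →₀ ℂ} (h : Neg t d) : d ≠ 0 := by
  rintro rfl
  obtain ⟨q, hq, -⟩ := h
  exact hq rfl

/-- The dominant exponent of the sum is the larger of the two dominant exponents: dominant
coefficients with negative real part in the direction `exp (i t)` cannot cancel. -/
lemma Neg.add {t : ℝ} {d e : ℚ →₀ ℂ} (hd : Neg t d) (he : Neg t e) : Neg t (d + e) := by
  obtain ⟨q, hq, hq', hq''⟩ := hd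
  obtain ⟨p, hp, hp', hp''⟩ := he
  rcases lt_trichotomy q p with h | rfl | h
  · refine ⟨p, by simpa [hq' p h] using hp, fun r hr => by
      simp [hq' r (h.trans hr), hp' r hr], by simpa [hq' p h] using hp''⟩
  · have key : ((d + e) q * Complex.exp (-(Complex.I * (q : ℂ) * (t : ℂ)))).re < 0 := by
      rw [Finsupp.add_apply, add_mul, Complex.add_re]
      exact add_neg hq'' hp''
    refine ⟨q, fun h => ?_, fun r hr => by simp [hq' r hr, hp' r hr], key⟩
    rw [h] at key
    simp at key
  · refine ⟨q, by simpa [hp' q h] using hq, fun r hr => by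
      simp [hp' r (h.trans hr), hq' r hr], by simpa [hp' q h] using hq''⟩

@[refl] lemma LeAt.refl (t : ℝ) (a : ℚ →₀ ℂ) : LeAt t a a := Or.inl rfl

lemma LeAt.trans {t : ℝ} {a b c : ℚ →₀ ℂ} (h : LeAt t a b) (h' : LeAt t b c) : LeAt t a c := by
  rw [leAt_iff] at *
  rcases h with rfl | h
  · exact h'
  · rcases h' with rfl | h'
    · exact Or.inr h
    · exact Or.inr (by simpa using h.add h')

lemma LeAt.antisymm {t : ℝ} {a b : ℚ →₀ ℂ} (h : LeAt t a b) (h' : LeAt t b a) : a = b := by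
  rcases leAt_iff.1 h with rfl | h
  · rfl
  · rcases leAt_iff.1 h' with rfl | h'
    · rfl
    · exact absurd (by simp) (h.add h').ne_zero

lemma continuous_re_mul_exp (c : ℂ) (q : ℚ) :
    Continuous fun t : ℝ => (c * Complex.exp (-(Complex.I * (q : ℂ) * (t : ℂ)))).re := by
  fun_prop

lemma LeAt.eventually {t : ℝ} {a b : ℚ →₀ ℂ} (h : LeAt t a b) :
    ∀ᶠ s in nhds t, LeAt s a b := by
  rcases h with rfl | ⟨q, h1, h2, h3⟩
  · exact Filter.Eventually.of_forall fun s => LeAt.refl s a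
  · filter_upwards [(continuous_re_mul_exp ((a - b) q) q).continuousAt.eventually_lt_const h3]
      with s hs
    exact Or.inr ⟨q, h1, h2, hs⟩

/-- The order of sections of the sheaf of polar parts at a point of the circle does not depend on
the choice of a preimage of this point in `ℝ`, because of the monodromy condition. -/
lemma leAt_add_two_pi {s t : ℝ} (hst : s = t + 2 * Real.pi) {a b a' b' : ℚ →₀ ℂ}
    (ha : ∀ q, a' q = Complex.exp (2 * Real.pi * Complex.I * (q : ℂ)) * a q)
    (hb : ∀ q, b' q = Complex.exp (2 * Real.pi * Complex.I * (q : ℂ)) * b q) :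
    LeAt s a' b' ↔ LeAt t a b := by
  have h0 : ∀ q : ℚ, (a' - b') q = Complex.exp (2 * Real.pi * Complex.I * (q : ℂ)) * (a - b) q := by
    intro q
    simp [ha, hb, mul_sub]
  have h1 : ∀ q : ℚ, (a' - b') q = 0 ↔ (a - b) q = 0 := by
    intro q
    simp [h0, Complex.exp_ne_zero]
  have h2 : ∀ q : ℚ, (a' - b') q * Complex.exp (-(Complex.I * (q : ℂ) * (s : ℂ))) =
      (a - b) q * Complex.exp (-(Complex.I * (q : ℂ) * (t : ℂ))) := by
    intro q
    rw [h0, mul_assoc, mul_left_comm, ← Complex.exp_add, hst]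
    congr 2
    push_cast
    ring
  unfold LeAt
  refine or_congr ?_ (exists_congr fun q => ?_)
  · rw [← sub_eq_zero, ← sub_eq_zero (a := a), Finsupp.ext_iff, Finsupp.ext_iff]
    exact forall_congr' h1
  · rw [h2, ne_eq, ne_eq, h1]
    simp only [h1]

/-- The two polar parts have the same terms of exponent at least `Q`. -/
def Near (Q : ℚ) (a b : ℚ →₀ ℂ) : Prop := ∀ p, Q ≤ p → a p = b p

lemma Near.refl (Q : ℚ) (a : ℚ →₀ ℂ) : Near Q a a := fun _ _ => rfl

lemma Near.symm {Q : ℚ} {a b : ℚ →₀ ℂ} (h : Near Q a b) : Near Q b a := fun p hp => (h p hp).symm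

lemma Near.trans {Q : ℚ} {a b c : ℚ →₀ ℂ} (h : Near Q a b) (h' : Near Q b c) : Near Q a c :=
  fun p hp => (h p hp).trans (h' p hp)

lemma Near.mono {Q Q' : ℚ} (hQ : Q ≤ Q') {a b : ℚ →₀ ℂ} (h : Near Q a b) : Near Q' a b :=
  fun p hp => h p (hQ.trans hp)

/-- The classes of `Near Q` are convex for the order at a direction. -/
lemma Near.of_leAt {Q : ℚ} {t : ℝ} {a b c : ℚ →₀ ℂ} (hab : LeAt t a b) (hbc : LeAt t b c)
    (hac : Near Q a c) : Near Q a b := by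
  rcases leAt_iff.1 hab with rfl | hab
  · exact Near.refl _ _
  rcases leAt_iff.1 hbc with rfl | hbc
  · exact hac
  obtain ⟨q, hq, hq', hq''⟩ := hab
  obtain ⟨p, hp, hp', hp''⟩ := hbc
  have hsub : ∀ r, (a - c) r = (a - b) r + (b - c) r := fun r => by simp
  intro r hr
  by_contra hne
  have hrq : r ≤ q := by
    by_contra h
    exact hne (sub_eq_zero.1 (hq' r (not_le.1 h)))
  have hac' : ∀ r, Q ≤ r → (a - c) r = 0 := fun r hr => sub_eq_zero.2 (hac r hr)
  rcases lt_trichotomy q p with h | rfl | h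
  · have := hac' p (hr.trans (hrq.trans h.le))
    rw [hsub, hq' p h, zero_add] at this
    exact hp this
  · have := hac' q (hr.trans hrq)
    rw [hsub] at this
    have h2 := add_neg hq'' hp''
    rw [← Complex.add_re, ← add_mul, this] at h2
    simp at h2
  · have := hac' q (hr.trans hrq)
    rw [hsub, hp' q h, add_zero] at this
    exact hq this

/-! ### Stokes directions -/

lemma re_mul_exp_eq (c : ℂ) (q t : ℝ) :
    (c * Complex.exp (-(Complex.I * (q : ℂ) * (t : ℂ)))).re =
      c.re * Real.cos (q * t) + c.im * Real.sin (q * t) := by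
  have : -(Complex.I * (q : ℂ) * (t : ℂ)) = ((-(q * t) : ℝ) : ℂ) * Complex.I := by
    push_cast; ring
  rw [this, Complex.mul_re, Complex.exp_ofReal_mul_I_re, Complex.exp_ofReal_mul_I_im,
    Real.cos_neg, Real.sin_neg]
  ring

/-- On an interval of length less than `π / q`, the real part of `c * exp (-i q t)` is not
negative between two points at which it is nonnegative. -/
lemma pi_le_of_sign_changes (c : ℂ) {q a s b : ℝ} (hq : 0 < q) (has : a < s) (hsb : s < b)
    (ha : 0 ≤ (c * Complex.exp (-(Complex.I * (q : ℂ) * (a : ℂ)))).re)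
    (hb : 0 ≤ (c * Complex.exp (-(Complex.I * (q : ℂ) * (b : ℂ)))).re)
    (hs : (c * Complex.exp (-(Complex.I * (q : ℂ) * (s : ℂ)))).re < 0) :
    Real.pi / q ≤ b - a := by
  by_contra hlt
  rw [not_le, lt_div_iff₀ hq] at hlt
  rw [re_mul_exp_eq] at ha hb hs
  have h1 : 0 < Real.sin (q * b - q * s) :=
    Real.sin_pos_of_pos_of_lt_pi (by nlinarith) (by nlinarith)
  have h2 : 0 < Real.sin (q * s - q * a) :=
    Real.sin_pos_of_pos_of_lt_pi (by nlinarith) (by nlinarith)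
  have h3 : 0 < Real.sin (q * b - q * a) :=
    Real.sin_pos_of_pos_of_lt_pi (by nlinarith) (by nlinarith)
  have key : (c.re * Real.cos (q * s) + c.im * Real.sin (q * s)) * Real.sin (q * b - q * a) =
      (c.re * Real.cos (q * a) + c.im * Real.sin (q * a)) * Real.sin (q * b - q * s) +
      (c.re * Real.cos (q * b) + c.im * Real.sin (q * b)) * Real.sin (q * s - q * a) := by
    simp only [Real.sin_sub]
    ring
  nlinarith [mul_nonneg ha h1.le, mul_nonneg hb h2.le, mul_pos h3 (neg_pos.2 hs)]

lemma re_mul_exp_add_pi_div (c : ℂ) {q : ℝ} (hq : 0 < q) (t : ℝ) :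
    (c * Complex.exp (-(Complex.I * (q : ℂ) * ((t + Real.pi / q : ℝ) : ℂ)))).re =
      -(c * Complex.exp (-(Complex.I * (q : ℂ) * (t : ℂ)))).re := by
  rw [re_mul_exp_eq, re_mul_exp_eq, mul_add, mul_div_cancel₀ _ hq.ne', Real.cos_add_pi,
    Real.sin_add_pi]
  ring

/-- The interval of length `π / q` centered at `t`, open on the right, so that it contains exactly
one of the Stokes directions of each pair of polar parts whose difference has order `q`. -/
def arc (t : ℝ) (q : ℚ) : Set ℝ :=
  Set.Ico (t - Real.pi / (2 * q)) (t + Real.pi / (2 * q))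

lemma mem_arc (t : ℝ) {q : ℚ} (hq : 0 < q) : t ∈ arc t q := by
  have : (0 : ℝ) < q := by exact_mod_cast hq
  have : 0 < Real.pi / (2 * q) := by positivity
  exact ⟨by linarith, by linarith⟩

/-- On an arc of level `q`, a pair of polar parts whose difference has order at most `q` has at
most one Stokes direction. -/
lemma leAt_left_or_right {t : ℝ} {q : ℚ} (hq : 0 < q) {a b : ℚ →₀ ℂ}
    (hab : ∀ p, q < p → a p = b p) (hpos : ∀ p, a p ≠ b p → 0 < p) {s : ℝ}
    (h : LeAt s a b) :
    (∀ u ∈ arc t q, u ≤ s → LeAt u a b) ∨ (∀ u ∈ arc t q, s ≤ u → LeAt u a b) := by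
  by_contra hcon
  push Not at hcon
  obtain ⟨⟨x, hx, hxs, hnx⟩, y, hy, hsy, hny⟩ := hcon
  rcases leAt_iff.1 h with rfl | h'
  · exact hnx (LeAt.refl _ _)
  obtain ⟨p, hp, hp', hp''⟩ := h'
  have hpne : a p ≠ b p := fun h => hp (by simp [h])
  have hp0 : 0 < p := hpos p hpne
  have hpq : p ≤ q := by
    by_contra h
    exact hpne (hab p (not_le.1 h))
  have hnn : ∀ u, ¬ LeAt u a b →
      0 ≤ ((a - b) p * Complex.exp (-(Complex.I * (p : ℂ) * (u : ℂ)))).re := by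
    intro u hu
    by_contra hlt
    exact hu (Or.inr ⟨p, hp, hp', not_le.1 hlt⟩)
  have hxs' : x < s := lt_of_le_of_ne hxs (fun e => hnx (e ▸ h))
  have hsy' : s < y := lt_of_le_of_ne hsy (fun e => hny (e ▸ h))
  have hp0' : (0 : ℝ) < (p : ℝ) := by exact_mod_cast hp0
  have hq0' : (0 : ℝ) < (q : ℝ) := by exact_mod_cast hq
  have hpq' : (p : ℝ) ≤ q := by exact_mod_cast hpq
  have h1 := pi_le_of_sign_changes ((a - b) p) hp0' hxs' hsy'
    (by simpa using hnn x hnx) (by simpa using hnn y hny) (by simpa using hp'')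
  have h2 : Real.pi / q ≤ Real.pi / p :=
    div_le_div_of_nonneg_left Real.pi_pos.le hp0' hpq'
  have h3 : Real.pi / q = 2 * (Real.pi / (2 * q)) := by field_simp
  obtain ⟨hx1, hx2⟩ := hx
  obtain ⟨hy1, hy2⟩ := hy
  linarith

/-- Two polar parts whose difference has order exactly `q` are not comparable in a constant way
on an arc of level `q`. -/
lemma not_leAt_on_arc {t : ℝ} {q : ℚ} (hq : 0 < q) {a b : ℚ →₀ ℂ}
    (hab : ∀ p, q < p → a p = b p) (hne : a q ≠ b q) :
    ¬ ∀ s ∈ arc t q, LeAt s a b := by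
  intro H
  have hq' : (0 : ℝ) < q := by exact_mod_cast hq
  have hlt : ∀ s ∈ arc t q,
      ((a - b) q * Complex.exp (-(Complex.I * (q : ℂ) * (s : ℂ)))).re < 0 := by
    intro s hs
    rcases H s hs with rfl | ⟨p, hp, hp', hp''⟩
    · exact absurd rfl hne
    · have hpq : p = q := by
        rcases lt_trichotomy p q with h | h | h
        · exact absurd (sub_eq_zero.1 (hp' q h)) hne
        · exact h
        · exact absurd (sub_eq_zero.2 (hab p h)) hp
      rwa [hpq] at hp''
  have hpi : 0 < Real.pi / (2 * q) := by positivity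
  have hleft := hlt (t - Real.pi / (2 * q)) ⟨le_rfl, by linarith⟩
  -- the values at the two end points are opposite to each other
  have hright := re_mul_exp_add_pi_div ((a - b) q) hq' (t - Real.pi / (2 * q))
  have he : t - Real.pi / (2 * q) + Real.pi / q = t + Real.pi / (2 * q) := by
    field_simp; ring
  rw [he] at hright
  simp only [Complex.ofReal_ratCast] at hright
  have hpos : 0 < ((a - b) q * Complex.exp
      (-(Complex.I * (q : ℂ) * ((t + Real.pi / (2 * q) : ℝ) : ℂ)))).re := by
    rw [hright]; linarith
  have hev := (continuous_re_mul_exp ((a - b) q) q).continuousAt.eventually_const_lt hpos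
  have hev2 : ∀ᶠ s in nhdsWithin (t + Real.pi / (2 * q)) (Set.Iio (t + Real.pi / (2 * q))),
      s ∈ arc t q := by
    have : Set.Ioo (t - Real.pi / (2 * q)) (t + Real.pi / (2 * q)) ∈
        nhdsWithin (t + Real.pi / (2 * q)) (Set.Iio (t + Real.pi / (2 * q))) :=
      Ioo_mem_nhdsLT (by linarith)
    filter_upwards [this] with s hs
    exact ⟨hs.1.le, hs.2⟩
  obtain ⟨s, hs1, hs2⟩ := ((hev.filter_mono nhdsWithin_le_nhds).and hev2).exists
  exact absurd hs1 (not_lt.2 (hlt s hs2).le)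

/-! ### Matrices supported on a relation between labels -/

section Matrices

variable {k : Type u} [Field k] {P : Type*} {ι κ μ : Type*}

/-- The nonzero entries of the matrix `M` are at places whose labels satisfy the relation `r`. -/
def Supp (r : P → P → Prop) (v : ι → P) (w : κ → P) (M : Matrix ι κ k) : Prop :=
  ∀ i j, M i j ≠ 0 → r (v i) (w j)

variable {r r' : P → P → Prop} {v : ι → P} {w : κ → P} {x : μ → P}

lemma Supp.mono {M : Matrix ι κ k} (h : Supp r v w M)
    (hr : ∀ i j, r (v i) (w j) → r' (v i) (w j)) : Supp r' v w M :=
  fun i j hij => hr i j (h i j hij)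

lemma Supp.add {M N : Matrix ι κ k} (hM : Supp r v w M) (hN : Supp r v w N) :
    Supp r v w (M + N) := by
  intro i j h
  by_cases h0 : M i j = 0
  · exact hN i j fun h1 => h (by simp [h0, h1])
  · exact hM i j h0

lemma Supp.neg {M : Matrix ι κ k} (hM : Supp r v w M) : Supp r v w (-M) :=
  fun i j h => hM i j (by simpa using h)

lemma Supp.zero : Supp r v w (0 : Matrix ι κ k) := fun _ _ h => absurd rfl h

lemma Supp.sum {α : Type*} (s : Finset α) {M : α → Matrix ι κ k} (h : ∀ a, Supp r v w (M a)) :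
    Supp r v w (∑ a ∈ s, M a) := by
  classical
  induction s using Finset.induction_on with
  | empty => simpa using Supp.zero
  | insert a s ha ih => rw [Finset.sum_insert ha]; exact (h a).add ih

lemma exists_of_mul_ne_zero [Fintype κ] {M : Matrix ι κ k} {N : Matrix κ μ k} {i : ι} {j : μ}
    (h : (M * N) i j ≠ 0) : ∃ l, M i l ≠ 0 ∧ N l j ≠ 0 := by
  rw [Matrix.mul_apply] at h
  obtain ⟨l, -, hl⟩ := Finset.exists_ne_zero_of_sum_ne_zero h
  exact ⟨l, left_ne_zero_of_mul hl, right_ne_zero_of_mul hl⟩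

lemma Supp.mul [Fintype κ] (hr : ∀ a b c, r a b → r b c → r a c)
    {M : Matrix ι κ k} {N : Matrix κ μ k} (hM : Supp r v w M) (hN : Supp r w x N) :
    Supp r v x (M * N) := by
  intro i j h
  obtain ⟨l, h1, h2⟩ := exists_of_mul_ne_zero h
  exact hr _ _ _ (hM i l h1) (hN l j h2)

lemma Supp.one [DecidableEq ι] (hr : ∀ a, r a a) : Supp r v v (1 : Matrix ι ι k) := by
  intro i j h
  by_cases hij : i = j
  · exact hij ▸ hr _
  · simp [Matrix.one_apply_ne hij] at h

lemma Supp.pow [Fintype ι] [DecidableEq ι] (hr0 : ∀ a, r a a)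
    (hr : ∀ a b c, r a b → r b c → r a c) {M : Matrix ι ι k} (hM : Supp r v v M) (n : ℕ) :
    Supp r v v (M ^ n) := by
  induction n with
  | zero => simpa using Supp.one hr0
  | succ n ih => rw [pow_succ]; exact ih.mul hr hM

open scoped Classical in
/-- The part of a matrix on the places whose labels satisfy the relation `r`. For an equivalence
relation `r`, this is the block diagonal part. -/
def part (r : P → P → Prop) (v : ι → P) (w : κ → P) (M : Matrix ι κ k) : Matrix ι κ k :=
  Matrix.of fun i j => if r (v i) (w j) then M i j else 0

lemma part_apply_of {M : Matrix ι κ k} {i j} (h : r (v i) (w j)) : part r v w M i j = M i j := by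
  simp [part, h]

lemma part_apply_of_not {M : Matrix ι κ k} {i j} (h : ¬ r (v i) (w j)) :
    part r v w M i j = 0 := by
  simp [part, h]

lemma part_ne_zero {M : Matrix ι κ k} {i j} (h : part r v w M i j ≠ 0) :
    r (v i) (w j) ∧ M i j ≠ 0 := by
  by_cases hr : r (v i) (w j)
  · rw [part_apply_of hr] at h
    exact ⟨hr, h⟩
  · exact absurd (part_apply_of_not hr) h

lemma part_of_supp {M : Matrix ι κ k} (h : Supp r v w M) : part r v w M = M := by
  ext i j
  by_cases hr : r (v i) (w j)
  · exact part_apply_of hr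
  · rw [part_apply_of_not hr]
    by_contra hne
    exact hr (h i j (Ne.symm hne))

lemma supp_part (M : Matrix ι κ k) : Supp r v w (part r v w M) := fun _ _ h => (part_ne_zero h).1

lemma Supp.part {M : Matrix ι κ k} (h : Supp r' v w M) : Supp r' v w (part r v w M) :=
  fun i j hij => h i j (part_ne_zero hij).2

lemma part_one [DecidableEq ι] (hr : ∀ a, r a a) : part r v v (1 : Matrix ι ι k) = 1 :=
  part_of_supp (Supp.one hr)

/-- Taking block diagonal parts is multiplicative on matrices which are triangular for an order
with respect to which the blocks are convex. -/
lemma part_mul [Fintype κ] (hsymm : ∀ a b, r a b → r b a)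
    (htrans : ∀ a b c, r a b → r b c → r a c)
    (hconv : ∀ a b c, r' a b → r' b c → r a c → r a b)
    {M : Matrix ι κ k} {N : Matrix κ μ k} (hM : Supp r' v w M) (hN : Supp r' w x N) :
    part r v x (M * N) = part r v w M * part r w x N := by
  ext i j
  by_cases h : r (v i) (x j)
  · rw [part_apply_of h, Matrix.mul_apply, Matrix.mul_apply]
    refine Finset.sum_congr rfl fun l _ => ?_
    by_cases h0 : M i l * N l j = 0
    · rw [h0]
      by_contra hne
      have h1 := part_ne_zero (left_ne_zero_of_mul (Ne.symm hne))
      have h2 := part_ne_zero (right_ne_zero_of_mul (Ne.symm hne))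
      exact mul_ne_zero h1.2 h2.2 h0
    · have h1 := hconv _ _ _ (hM i l (left_ne_zero_of_mul h0)) (hN l j (right_ne_zero_of_mul h0)) h
      rw [part_apply_of h1, part_apply_of (htrans _ _ _ (hsymm _ _ h1) h)]
  · rw [part_apply_of_not h]
    by_contra hne
    obtain ⟨l, h1, h2⟩ := exists_of_mul_ne_zero (Ne.symm hne)
    exact h (htrans _ _ _ (part_ne_zero h1).1 (part_ne_zero h2).1)

/-- The nonzero entries of the matrix raise the height `ρ` by at least `n`. -/
def Raises (ρ : ι → ℕ) (n : ℕ) (M : Matrix ι ι k) : Prop := ∀ i j, M i j ≠ 0 → ρ i + n ≤ ρ j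

lemma Raises.mul [Fintype ι] {ρ : ι → ℕ} {m n : ℕ} {M N : Matrix ι ι k} (hM : Raises ρ m M)
    (hN : Raises ρ n N) : Raises ρ (m + n) (M * N) := by
  intro i j h
  obtain ⟨l, h1, h2⟩ := exists_of_mul_ne_zero h
  have := hM i l h1
  have := hN l j h2
  omega

lemma Raises.pow [Fintype ι] [DecidableEq ι] {ρ : ι → ℕ} {M : Matrix ι ι k} (hM : Raises ρ 1 M) (n : ℕ) :
    Raises ρ n (M ^ n) := by
  induction n with
  | zero =>
    intro i j h
    by_cases hij : i = j
    · simp [hij]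
    · simp [Matrix.one_apply_ne hij] at h
  | succ n ih => rw [pow_succ]; exact ih.mul hM

lemma Raises.eq_zero {ρ : ι → ℕ} {n : ℕ} (hn : ∀ i, ρ i < n) {M : Matrix ι ι k}
    (hM : Raises ρ n M) : M = 0 := by
  ext i j
  by_contra h
  have := hM i j h
  have := hn j
  omega

variable [Fintype ι] [DecidableEq ι]

/-- An invertible matrix which is, with its inverse, supported on the relation `r`. -/
def Adm (r : P → P → Prop) (v : ι → P) (g : GL ι k) : Prop :=
  Supp r v v (g : Matrix ι ι k) ∧ Supp r v v ((g⁻¹ : GL ι k) : Matrix ι ι k)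

lemma Adm.inv {g : GL ι k} (h : Adm r v g) : Adm r v g⁻¹ := ⟨h.2, by simpa using h.1⟩

lemma Adm.mul (hr : ∀ a b c, r a b → r b c → r a c) {g h : GL ι k} (hg : Adm r v g)
    (hh : Adm r v h) : Adm r v (g * h) :=
  ⟨by simpa using hg.1.mul hr hh.1, by
    rw [mul_inv_rev]; simpa using hh.2.mul hr hg.2⟩

lemma Adm.one (hr : ∀ a, r a a) : Adm r v (1 : GL ι k) :=
  ⟨by simpa using Supp.one hr, by simpa using Supp.one hr⟩

lemma Adm.mono {g : GL ι k} (h : Adm r v g) (hr : ∀ i j, r (v i) (v j) → r' (v i) (v j)) :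
    Adm r' v g := ⟨h.1.mono hr, h.2.mono hr⟩

/-- The block diagonal part of an invertible triangular matrix, see `part_mul`. -/
def partGL (r r' : P → P → Prop) (v : ι → P) (hrefl : ∀ a, r a a) (hsymm : ∀ a b, r a b → r b a)
    (htrans : ∀ a b c, r a b → r b c → r a c)
    (hconv : ∀ a b c, r' a b → r' b c → r a c → r a b) (g : GL ι k) (hg : Adm r' v g) :
    GL ι k where
  val := part r v v (g : Matrix ι ι k)
  inv := part r v v ((g⁻¹ : GL ι k) : Matrix ι ι k)
  val_inv := by
    rw [← part_mul hsymm htrans hconv hg.1 hg.2, ← Units.val_mul, mul_inv_cancel, Units.val_one,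
      part_one hrefl]
  inv_val := by
    rw [← part_mul hsymm htrans hconv hg.2 hg.1, ← Units.val_mul, inv_mul_cancel, Units.val_one,
      part_one hrefl]

/-- A unipotent triangular matrix is invertible, and its inverse is triangular. -/
lemma exists_one_add (hr0 : ∀ a, r a a) (hr : ∀ a b c, r a b → r b c → r a c) {ρ : ι → ℕ} {n : ℕ}
    (hn : ∀ i, ρ i < n) {M : Matrix ι ι k} (hM : Supp r v v M) (hM' : Raises ρ 1 M) :
    ∃ g : GL ι k, (g : Matrix ι ι k) = 1 + M ∧ Adm r v g := by
  have h0 : (-M) ^ n = 0 := by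
    rw [neg_pow, Raises.eq_zero hn (hM'.pow n), mul_zero]
  refine ⟨⟨1 + M, ∑ i ∈ Finset.range n, (-M) ^ i, ?_, ?_⟩, rfl, (Supp.one hr0).add hM, ?_⟩
  · have := mul_neg_geom_sum (-M) n
    rwa [h0, sub_zero, sub_neg_eq_add] at this
  · have := geom_sum_mul_neg (-M) n
    rwa [h0, sub_zero, sub_neg_eq_add] at this
  · change Supp r v v (∑ i ∈ Finset.range n, (-M) ^ i)
    exact Supp.sum _ fun i => hM.neg.pow hr0 hr i

/-- If each pair of labels comparable for `r` is comparable for `r₁` or for `r₂`, every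
invertible matrix triangular for `r` is the quotient of invertible matrices which are triangular
for `r₁` and for `r₂`. This allows to glue splittings of a Stokes filtration on two adjacent
intervals. -/
lemma exists_factorization {r r₁ r₂ : P → P → Prop}
    (refl : ∀ a, r a a) (antisymm : ∀ a b, r a b → r b a → a = b)
    (trans : ∀ a b c, r a b → r b c → r a c)
    (refl₁ : ∀ a, r₁ a a) (trans₁ : ∀ a b c, r₁ a b → r₁ b c → r₁ a c)
    (refl₂ : ∀ a, r₂ a a) (trans₂ : ∀ a b c, r₂ a b → r₂ b c → r₂ a c)
    (h₁ : ∀ a b, r₁ a b → r a b) (h₂ : ∀ a b, r₂ a b → r a b)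
    (hor : ∀ i j, r (v i) (v j) → r₁ (v i) (v j) ∨ r₂ (v i) (v j))
    (g : GL ι k) (hg : Adm r v g) :
    ∃ x y : GL ι k, Adm r₁ v x ∧ Adm r₂ v y ∧ g * y = x := by
  classical
  -- the height for the order induced by `r`
  let ρ : ι → ℕ := fun j => (Finset.univ.filter fun i => r (v i) (v j) ∧ v i ≠ v j).card
  have hρ : ∀ i j, r (v i) (v j) → v i ≠ v j → ρ i + 1 ≤ ρ j := by
    intro i j hij hne
    refine Finset.card_lt_card (Finset.ssubset_iff_of_subset ?_ |>.2 ⟨i, ?_, ?_⟩)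
    · intro l hl
      simp only [Finset.mem_filter, Finset.mem_univ, true_and] at hl ⊢
      refine ⟨trans _ _ _ hl.1 hij, fun h => hne (antisymm _ _ hij (h ▸ hl.1))⟩
    · simp [hij, hne]
    · simp
  have hρ0 : ∀ i j, v i = v j → ρ i = ρ j := by
    intro i j hij
    simp only [ρ, hij]
  have hρ' : ∀ i j, r (v i) (v j) → ρ i ≤ ρ j := by
    intro i j hij
    by_cases hne : v i = v j
    · exact (hρ0 i j hne).le
    · exact (Nat.le_succ _).trans (hρ i j hij hne)
  obtain ⟨N, hN⟩ : ∃ N, ∀ i, ρ i < N :=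
    ⟨Fintype.card ι + 1, fun i => Nat.lt_succ_of_le (Finset.card_le_univ _)⟩
  have hraise : ∀ {M : Matrix ι ι k}, Supp r v v M → Raises ρ 0 M := fun hM i j h =>
    hρ' i j (hM i j h)
  -- by induction, `g` can be made unipotent with entries raising the height by any given `n`
  have key : ∀ n : ℕ, 1 ≤ n → ∃ x y g' : GL ι k, Adm r₁ v x ∧ Adm r₂ v y ∧ g * y = x * g' ∧
      ∃ M : Matrix ι ι k, (g' : Matrix ι ι k) = 1 + M ∧ Supp r v v M ∧ Raises ρ n M := by
    intro n hn
    induction n, hn using Nat.le_induction with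
    | base =>
      have hconv : ∀ a b c, r a b → r b c → a = c → a = b := by
        rintro a b c hab hbc rfl
        exact antisymm _ _ hab hbc
      let d : GL ι k := partGL (· = ·) r v (fun _ => rfl) (fun _ _ => Eq.symm)
        (fun _ _ _ => Eq.trans) hconv g hg
      have hd : Adm (· = ·) v d := ⟨supp_part _, supp_part _⟩
      have hdr : Adm r v d := hd.mono fun i j h => h ▸ refl _
      refine ⟨d, 1, d⁻¹ * g, hd.mono fun i j h => h ▸ refl₁ _, Adm.one refl₂, by group,
        ((d⁻¹ * g : GL ι k) : Matrix ι ι k) - 1, by abel, ?_, ?_⟩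
      · rw [sub_eq_add_neg]
        exact (hdr.inv.mul trans hg).1.add (Supp.one refl).neg
      · intro i j hij
        have h1 : ((d⁻¹ * g : GL ι k) : Matrix ι ι k) - 1 =
            ((d⁻¹ : GL ι k) : Matrix ι ι k) * ((g : Matrix ι ι k) - d) := by
          rw [mul_sub, ← Units.val_mul, ← Units.val_mul, inv_mul_cancel, Units.val_one]
        rw [h1] at hij
        obtain ⟨l, h2, h3⟩ := exists_of_mul_ne_zero hij
        have h4 : v i = v l := hd.2 i l h2
        have h5 : v l ≠ v j := fun h => h3 (by
          have : (d : Matrix ι ι k) l j = (g : Matrix ι ι k) l j := part_apply_of h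
          simp [this])
        have h6 : (g : Matrix ι ι k) l j ≠ 0 := fun h => h3 (by
          have : (d : Matrix ι ι k) l j = 0 := part_apply_of_not h5
          simp [this, h])
        rw [hρ0 i l h4]
        exact hρ l j (hg.1 l j h6) h5
    | succ n hn ih =>
      obtain ⟨x, y, g', hx, hy, hxy, M, hM, hMr, hMn⟩ := ih
      -- split `M = M₁ + M₂` and divide by `1 + M₁` and `1 + M₂`; what remains is of order `M₁ * M₂`
      let M₁ := part r₁ v v M
      let M₂ := M - M₁
      have hM₁ : Supp r₁ v v M₁ := supp_part M
      have hM₂ : Supp r₂ v v M₂ := by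
        intro i j h
        have h1 : ¬ r₁ (v i) (v j) := fun h1 => h (by simp [M₂, M₁, part_apply_of h1])
        have h2 : M i j ≠ 0 := fun h2 => h (by simp [M₂, M₁, part_apply_of_not h1, h2])
        exact (hor i j (hMr i j h2)).resolve_left h1
      have hM₁n : Raises ρ n M₁ := fun i j h => hMn i j (part_ne_zero h).2
      have hM₂n : Raises ρ n M₂ := by
        intro i j h
        refine hMn i j fun h2 => h ?_
        by_cases h1 : r₁ (v i) (v j)
        · simp [M₂, M₁, part_apply_of h1]
        · simp [M₂, M₁, part_apply_of_not h1, h2]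
      have hle : ∀ {M : Matrix ι ι k}, Raises ρ n M → Raises ρ 1 M := fun h i j hij =>
        (Nat.add_le_add_left hn _).trans (h i j hij)
      obtain ⟨a, ha, ha'⟩ := exists_one_add refl₁ trans₁ hN hM₁ (hle hM₁n)
      obtain ⟨b, hb, hb'⟩ := exists_one_add refl₂ trans₂ hN hM₂ (hle hM₂n)
      refine ⟨x * a, y * b⁻¹, a⁻¹ * g' * b⁻¹, hx.mul trans₁ ha', hy.mul trans₂ hb'.inv, ?_,
        ((a⁻¹ : GL ι k) : Matrix ι ι k) * (-(M₁ * M₂)) * ((b⁻¹ : GL ι k) : Matrix ι ι k),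
        ?_, ?_, ?_⟩
      · rw [← mul_assoc, hxy]
        group
      · have e1 : (g' : Matrix ι ι k) = a * b - M₁ * M₂ := by
          rw [hM, ha, hb]
          simp only [M₂]
          noncomm_ring
        have e2 : ((a⁻¹ : GL ι k) : Matrix ι ι k) * a = 1 := by
          rw [← Units.val_mul, inv_mul_cancel, Units.val_one]
        have e3 : (b : Matrix ι ι k) * ((b⁻¹ : GL ι k) : Matrix ι ι k) = 1 := by
          rw [← Units.val_mul, mul_inv_cancel, Units.val_one]
        rw [Units.val_mul, Units.val_mul, e1, mul_sub, sub_mul, ← mul_assoc, e2, one_mul, e3,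
          mul_neg, neg_mul, sub_eq_add_neg]
      · have s1 := ha'.2.mono fun i j => h₁ (v i) (v j)
        have s2 := hb'.2.mono fun i j => h₂ (v i) (v j)
        have s3 := hM₁.mono fun i j => h₁ (v i) (v j)
        have s4 := hM₂.mono fun i j => h₂ (v i) (v j)
        exact (s1.mul trans (s3.mul trans s4).neg).mul trans s2
      · have s1 := hraise (ha'.2.mono fun i j => h₁ (v i) (v j))
        have s2 := hraise (hb'.2.mono fun i j => h₂ (v i) (v j))
        have s3 : Raises ρ (n + n) (-(M₁ * M₂)) := fun i j h =>
          (hM₁n.mul hM₂n) i j (by simpa using h)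
        have s4 := (s1.mul s3).mul s2
        intro i j h
        have := s4 i j h
        omega
  obtain ⟨x, y, g', hx, hy, hxy, M, hM, -, hMn⟩ := key (N + 1) (by omega)
  have hM0 : M = 0 := hMn.eq_zero fun i => (hN i).trans (Nat.lt_succ_self N)
  have hg' : g' = 1 := Units.ext (by rw [hM, hM0, add_zero]; rfl)
  exact ⟨x, y, hx, hy, by rw [hxy, hg', mul_one]⟩

end Matrices

/-! ### Functorial splittings of Stokes data on the line -/

section Core

variable {k : Type u} [Field k] {ι κ : Type*} [Fintype ι] [DecidableEq ι] [Fintype κ]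
  [DecidableEq κ]

/-- The order at a direction, restricted to the pairs of polar parts having the same terms of
exponents at least `Q`: the order governing the graded pieces of level `Q`. -/
def LeNear (Q : ℚ) (t : ℝ) (a b : ℚ →₀ ℂ) : Prop := LeAt t a b ∧ Near Q a b

lemma LeNear.refl (Q : ℚ) (t : ℝ) (a : ℚ →₀ ℂ) : LeNear Q t a a := ⟨LeAt.refl t a, Near.refl Q a⟩

lemma LeNear.trans {Q : ℚ} {t : ℝ} (a b c : ℚ →₀ ℂ) (h : LeNear Q t a b) (h' : LeNear Q t b c) :
    LeNear Q t a c := ⟨h.1.trans h'.1, h.2.trans h'.2⟩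

lemma LeNear.antisymm {Q : ℚ} {t : ℝ} (a b : ℚ →₀ ℂ) (h : LeNear Q t a b) (h' : LeNear Q t b a) :
    a = b := h.1.antisymm h'.1

lemma LeNear.near_of_le {Q q : ℚ} {t : ℝ} (a b c : ℚ →₀ ℂ) (h : LeNear Q t a b)
    (h' : LeNear Q t b c) (h'' : Near q a c) : Near q a b := Near.of_leAt h.1 h'.1 h''

/-- The part of an invertible triangular matrix which is block diagonal for the classes of
`Near q`. -/
def nearGL (q : ℚ) {Q : ℚ} {t : ℝ} {v : ι → ℚ →₀ ℂ} (g : GL ι k) (hg : Adm (LeNear Q t) v g) :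
    GL ι k :=
  partGL (Near q) (LeNear Q t) v (Near.refl q) (fun _ _ => Near.symm) (fun _ _ _ => Near.trans)
    (fun a b c => LeNear.near_of_le a b c) g hg

lemma adm_nearGL (q : ℚ) {Q : ℚ} {t : ℝ} {v : ι → ℚ →₀ ℂ} (g : GL ι k)
    (hg : Adm (LeNear Q t) v g) : Adm (LeNear Q t) v (nearGL q g hg) :=
  ⟨hg.1.part, hg.2.part⟩

lemma adm_nearGL' (q : ℚ) {Q : ℚ} {t : ℝ} {v : ι → ℚ →₀ ℂ} (g : GL ι k)
    (hg : Adm (LeNear Q t) v g) : Adm (LeNear q t) v (nearGL q g hg) :=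
  ⟨fun i j h => ⟨(hg.1 i j (part_ne_zero h).2).1, (part_ne_zero h).1⟩,
    fun i j h => ⟨(hg.2 i j (part_ne_zero h).2).1, (part_ne_zero h).1⟩⟩

/-- Let `h n` be the transition matrices at the points `τ (n + 1)` of a Stokes filtration on
the line which is split on each interval `[τ n, τ (n + 1)]`. If `q` is the largest level, the
splittings can be modified to agree on the arc of level `q` centered at `t₀`. -/
lemma exists_splitting_on_arc {v : ι → ℚ →₀ ℂ} {Q q : ℚ} (hq : 0 < q)
    (hpos : ∀ i p, v i p ≠ 0 → 0 < p)
    (hlev : ∀ i j, Near Q (v i) (v j) → ∀ p, q < p → v i p = v j p)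
    {τ : ℕ → ℝ} (hτ : Monotone τ) (t₀ : ℝ) (h : ℕ → GL ι k)
    (hh : ∀ n, Adm (LeNear Q (τ (n + 1))) v (h n)) (N : ℕ) :
    ∃ A : ℕ → GL ι k,
      (∀ n ≤ N, ∀ s ∈ arc t₀ q, s ∈ Set.Icc (τ n) (τ (n + 1)) → Adm (LeNear Q s) v (A n)) ∧
      ∀ n < N, τ (n + 1) ∈ arc t₀ q → A n = h n * A (n + 1) := by
  induction N with
  | zero =>
    exact ⟨fun _ => 1, fun n _ s _ _ => Adm.one (LeNear.refl Q s), fun n hn => absurd hn (by simp)⟩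
  | succ N ih =>
    obtain ⟨A, hA, hA'⟩ := ih
    by_cases hN : τ (N + 1) ∈ arc t₀ q
    · -- correct the splittings on the left and on the right of `τ (N + 1)` to make them agree
      have hτN : τ (N + 1) ∈ Set.Icc (τ N) (τ (N + 1)) := ⟨hτ (Nat.le_succ N), le_rfl⟩
      have hg : Adm (LeNear Q (τ (N + 1))) v ((A N)⁻¹ * h N) :=
        (hA N le_rfl _ hN hτN).inv.mul LeNear.trans (hh N)
      obtain ⟨x, y, hx, hy, hxy⟩ := exists_factorization
        (r := LeNear Q (τ (N + 1)))
        (r₁ := fun a b => ∀ u ∈ arc t₀ q, u ≤ τ (N + 1) → LeNear Q u a b)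
        (r₂ := fun a b => ∀ u ∈ arc t₀ q, τ (N + 1) ≤ u → LeNear Q u a b)
        (LeNear.refl Q _) LeNear.antisymm LeNear.trans
        (fun a u _ _ => LeNear.refl Q u a)
        (fun a b c h h' u hu hu' => LeNear.trans a b c (h u hu hu') (h' u hu hu'))
        (fun a u _ _ => LeNear.refl Q u a)
        (fun a b c h h' u hu hu' => LeNear.trans a b c (h u hu hu') (h' u hu hu'))
        (fun a b h => h _ hN le_rfl) (fun a b h => h _ hN le_rfl)
        (fun i j hij => by
          have hpos' : ∀ p, v i p ≠ v j p → 0 < p := by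
            intro p hp
            by_cases h0 : v i p = 0
            · exact hpos j p fun h1 => hp (by rw [h0, h1])
            · exact hpos i p h0
          exact (leAt_left_or_right hq (hlev i j hij.2) hpos' hij.1).imp
            (fun H u hu hu' => ⟨H u hu hu', hij.2⟩) (fun H u hu hu' => ⟨H u hu hu', hij.2⟩))
        _ hg
      refine ⟨fun n => if n ≤ N then A n * x else y, fun n hn s hs hsn => ?_, fun n hn hn' => ?_⟩
      · by_cases hnN : n ≤ N
        · simp only [hnN, if_true]
          have hsN : s ≤ τ (N + 1) := hsn.2.trans (hτ (by omega))
          exact (hA n hnN s hs hsn).mul LeNear.trans (hx.mono fun i j H => H s hs hsN)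
        · simp only [hnN, if_false]
          have hsN : τ (N + 1) ≤ s := (hτ (by omega)).trans hsn.1
          exact hy.mono fun i j H => H s hs hsN
      · have hnN : n ≤ N := by omega
        simp only [hnN, if_true]
        by_cases hnN' : n + 1 ≤ N
        · simp only [hnN', if_true]
          rw [hA' n (by omega) hn', mul_assoc]
        · obtain rfl : n = N := by omega
          simp only [hnN', if_false]
          rw [← hxy]
          group
    · -- `τ (N + 1)` is not on the arc: no condition there, and any splitting will do on the right
      refine ⟨fun n => if n ≤ N then A n else 1, fun n hn s hs hsn => ?_, fun n hn hn' => ?_⟩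
      · by_cases hnN : n ≤ N
        · simp only [hnN, if_true]
          exact hA n hnN s hs hsn
        · simp only [hnN, if_false]
          exact Adm.one (LeNear.refl Q s)
      · have hnN : n ≤ N := by omega
        by_cases hnN' : n + 1 ≤ N
        · simp only [hnN, hnN', if_true]
          exact hA' n (by omega) hn'
        · obtain rfl : n = N := by omega
          exact absurd hn' hN

/-- Two Stokes filtrations on the line, given by the transition matrices `h n`, `h' n` at the
points `τ (n + 1)` between splittings on the intervals `[τ n, τ (n + 1)]`, have splittings at `t₀`
for which all morphisms are diagonal.

The proof is by induction on the number of levels below `Q`. On the arc of the largest level `q`,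
there is a splitting for which all morphisms are block diagonal, because their components of
order `q` meet a Stokes direction. The blocks are morphisms between the graded pieces of level
`q`, which extend as Stokes filtrations to the whole line, and to which the induction hypothesis
applies. -/
theorem exists_diagonalization {v : ι → ℚ →₀ ℂ} {w : κ → ℚ →₀ ℂ} (S : Finset ℚ)
    (hS : ∀ q ∈ S, 0 < q) (hv : ∀ i q, v i q ≠ 0 → q ∈ S) (hw : ∀ i q, w i q ≠ 0 → q ∈ S)
    {τ : ℕ → ℝ} (hτ : Monotone τ) {N n₀ : ℕ} (hn₀ : n₀ ≤ N) {t₀ : ℝ}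
    (ht₀ : t₀ ∈ Set.Icc (τ n₀) (τ (n₀ + 1)))
    (hcov : ∀ q ∈ S, ∀ s ∈ arc t₀ q, ∃ n ≤ N, s ∈ Set.Icc (τ n) (τ (n + 1))) (Q : ℚ)
    (h : ℕ → GL ι k) (h' : ℕ → GL κ k) (hh : ∀ n, Adm (LeNear Q (τ (n + 1))) v (h n))
    (hh' : ∀ n, Adm (LeNear Q (τ (n + 1))) w (h' n)) :
    ∃ (m : GL ι k) (m' : GL κ k), Adm (LeNear Q t₀) v m ∧ Adm (LeNear Q t₀) w m' ∧
      ∀ l : ℕ → Matrix κ ι k,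
        (∀ n, ∀ s ∈ Set.Icc (τ n) (τ (n + 1)), Supp (LeNear Q s) w v (l n)) →
        (∀ n, (h' n : Matrix κ κ k) * l (n + 1) = l n * (h n : Matrix ι ι k)) →
        Supp (· = ·) w v (((m'⁻¹ : GL κ k) : Matrix κ κ k) * l n₀ * (m : Matrix ι ι k)) := by
  classical
  induction hc : (S.filter (· < Q)).card using Nat.strong_induction_on generalizing Q h h' with
  | _ c ih =>
  by_cases hne : (S.filter (· < Q)).Nonempty
  swap
  · -- there is no level left: the relation `LeNear Q` is equality
    refine ⟨1, 1, Adm.one (LeNear.refl Q _), Adm.one (LeNear.refl Q _), fun l hl _ i j hij => ?_⟩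
    simp only [inv_one, Units.val_one, Matrix.one_mul, Matrix.mul_one] at hij
    have h1 := (hl n₀ t₀ ht₀ i j hij).2
    ext p
    by_cases hp : Q ≤ p
    · exact h1 p hp
    · have hpS : p ∉ S := fun hpS => hne ⟨p, by simp [hpS, not_le.1 hp]⟩
      rw [not_not.1 (mt (hw i p) hpS), not_not.1 (mt (hv j p) hpS)]
  obtain ⟨q, hqm, hqmax⟩ : ∃ q ∈ S.filter (· < Q), ∀ p ∈ S.filter (· < Q), p ≤ q :=
    ⟨_, Finset.max'_mem _ hne, fun p hp => Finset.le_max' _ p hp⟩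
  obtain ⟨hqS, hqQ⟩ := Finset.mem_filter.1 hqm
  have hq := hS q hqS
  have hlev : ∀ a b : ℚ →₀ ℂ, (∀ p, a p ≠ 0 → p ∈ S) → (∀ p, b p ≠ 0 → p ∈ S) → Near Q a b →
      ∀ p, q < p → a p = b p := by
    intro a b ha hb hab p hp
    by_cases hpQ : Q ≤ p
    · exact hab p hpQ
    · have hpS : p ∉ S := fun hpS =>
        absurd (hqmax p (by simp [hpS, not_le.1 hpQ])) (not_le.2 hp)
      rw [not_not.1 (mt (ha p) hpS), not_not.1 (mt (hb p) hpS)]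
  have ht₀arc := mem_arc t₀ hq
  have hcard : (S.filter (· < q)).card < c := by
    rw [← hc]
    refine Finset.card_lt_card (Finset.ssubset_iff_of_subset ?_ |>.2 ⟨q, hqm, by simp⟩)
    exact Finset.monotone_filter_right _ fun p _ hp => lt_trans hp hqQ
  obtain ⟨A, hA, hA'⟩ := exists_splitting_on_arc hq (fun i p hp => hS p (hv i p hp))
    (fun i j => hlev _ _ (hv i) (hv j)) hτ t₀ h hh N
  obtain ⟨B, hB, hB'⟩ := exists_splitting_on_arc hq (fun i p hp => hS p (hw i p hp))
    (fun i j => hlev _ _ (hw i) (hw j)) hτ t₀ h' hh' N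
  have hA0 := hA n₀ hn₀ t₀ ht₀arc ht₀
  have hB0 := hB n₀ hn₀ t₀ ht₀arc ht₀
  obtain ⟨m, m', hm, hm', hmm⟩ := ih _ hcard q (fun n => nearGL q (h n) (hh n))
    (fun n => nearGL q (h' n) (hh' n)) (fun n => adm_nearGL' q _ _) (fun n => adm_nearGL' q _ _) rfl
  have hmono : ∀ a b, LeNear q t₀ a b → LeNear Q t₀ a b := fun a b H => ⟨H.1, H.2.mono hqQ.le⟩
  refine ⟨A n₀ * (nearGL q (A n₀) hA0)⁻¹ * m, B n₀ * (nearGL q (B n₀) hB0)⁻¹ * m',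
    (hA0.mul LeNear.trans (adm_nearGL q _ _).inv).mul LeNear.trans (hm.mono fun _ _ => hmono _ _),
    (hB0.mul LeNear.trans (adm_nearGL q _ _).inv).mul LeNear.trans (hm'.mono fun _ _ => hmono _ _),
    fun l hl hlh => ?_⟩
  -- the matrix of the morphism in the splittings on the arc is constant
  let C : ℕ → Matrix κ ι k := fun n =>
    (((B n)⁻¹ : GL κ k) : Matrix κ κ k) * l n * (A n : Matrix ι ι k)
  have hC : ∀ n < N, τ (n + 1) ∈ arc t₀ q → C n = C (n + 1) := by
    intro n hn hn'
    have e1 : (((h' n)⁻¹ : GL κ k) : Matrix κ κ k) * (l n * (h n : Matrix ι ι k)) = l (n + 1) := by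
      rw [← hlh, ← Matrix.mul_assoc, ← Units.val_mul, inv_mul_cancel, Units.val_one, Matrix.one_mul]
    simp only [C]
    rw [hA' n hn hn', hB' n hn hn', mul_inv_rev, Units.val_mul, Units.val_mul, ← e1]
    simp only [Matrix.mul_assoc]
  have hC' : ∀ a b, a ≤ b → b ≤ N → (∀ n, a ≤ n → n < b → τ (n + 1) ∈ arc t₀ q) → C a = C b := by
    intro a b hab
    induction b, hab using Nat.le_induction with
    | base => intros; rfl
    | succ b hab ihb =>
      intro hbN H
      rw [ihb (by omega) fun n h1 h2 => H n h1 (by omega), hC b (by omega) (H b hab (by omega))]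
  have hCconst : ∀ n ≤ N, ∀ s ∈ arc t₀ q, s ∈ Set.Icc (τ n) (τ (n + 1)) → C n₀ = C n := by
    intro n hn s hs hsn
    have hoc : (arc t₀ q).OrdConnected := Set.ordConnected_Ico
    rcases le_total n₀ n with hle | hle
    · refine hC' n₀ n hle hn fun j h1 h2 => hoc.out ht₀arc hs ⟨?_, ?_⟩
      · exact ht₀.2.trans (hτ (by omega))
      · exact (hτ (by omega)).trans hsn.1
    · refine (hC' n n₀ hle hn₀ fun j h1 h2 => hoc.out hs ht₀arc ⟨?_, ?_⟩).symm
      · exact hsn.2.trans (hτ (by omega))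
      · exact (hτ (by omega)).trans ht₀.1
  have hCsupp : ∀ s ∈ arc t₀ q, Supp (LeNear Q s) w v (C n₀) := by
    intro s hs
    obtain ⟨n, hn, hsn⟩ := hcov q hqS s hs
    rw [hCconst n hn s hs hsn]
    exact ((hB n hn s hs hsn).2.mul LeNear.trans (hl n s hsn)).mul LeNear.trans (hA n hn s hs hsn).1
  -- labels which differ in order `q` are not comparable in the same way on the whole arc
  have hCnear : Supp (Near q) w v (C n₀) := by
    intro i j hij p hp
    have h1 := hlev _ _ (hw i) (hv j) (hCsupp t₀ ht₀arc i j hij).2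
    rcases hp.eq_or_lt with rfl | hp
    · by_contra hne
      exact not_leAt_on_arc hq h1 hne fun s hs => (hCsupp s hs i j hij).1
    · exact h1 p hp
  have hsy : ∀ a b, Near q a b → Near q b a := fun _ _ => Near.symm
  have htr : ∀ a b c, Near q a b → Near q b c → Near q a c := fun _ _ _ => Near.trans
  have hcv : ∀ t a b c, LeNear Q t a b → LeNear Q t b c → Near q a c → Near q a b :=
    fun t a b c => LeNear.near_of_le a b c
  have hl0 := hl n₀ t₀ ht₀
  have hCpart : C n₀ = (((nearGL q (B n₀) hB0)⁻¹ : GL κ k) : Matrix κ κ k) *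
      part (Near q) w v (l n₀) * (nearGL q (A n₀) hA0 : Matrix ι ι k) := by
    rw [← part_of_supp hCnear]
    simp only [C]
    rw [part_mul hsy htr (hcv t₀) (hB0.2.mul LeNear.trans hl0) hA0.1,
      part_mul hsy htr (hcv t₀) hB0.2 hl0]
    rfl
  have hfin := hmm (fun n => part (Near q) w v (l n))
    (fun n s hs i j hij => ⟨(hl n s hs i j (part_ne_zero hij).2).1, (part_ne_zero hij).1⟩)
    (fun n => by
      have h1 := hl n (τ (n + 1)) ⟨hτ (Nat.le_succ n), le_rfl⟩
      have h2 := hl (n + 1) (τ (n + 1)) ⟨le_rfl, hτ (Nat.le_succ (n + 1))⟩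
      change part (Near q) w w (h' n : Matrix κ κ k) * _ = _ * part (Near q) v v (h n : Matrix ι ι k)
      rw [← part_mul hsy htr (hcv _) (hh' n).1 h2, ← part_mul hsy htr (hcv _) h1 (hh n).1, hlh])
  convert hfin using 1
  have e1 : ((nearGL q (B n₀) hB0 : GL κ k) : Matrix κ κ k) *
      (((nearGL q (B n₀) hB0)⁻¹ : GL κ k) : Matrix κ κ k) = 1 := by
    rw [← Units.val_mul, mul_inv_cancel, Units.val_one]
  have e2 : ((nearGL q (A n₀) hA0 : GL ι k) : Matrix ι ι k) *
      (((nearGL q (A n₀) hA0)⁻¹ : GL ι k) : Matrix ι ι k) = 1 := by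
    rw [← Units.val_mul, mul_inv_cancel, Units.val_one]
  calc _ = ((m'⁻¹ : GL κ k) : Matrix κ κ k) * ((nearGL q (B n₀) hB0 : GL κ k) : Matrix κ κ k) *
        C n₀ * (((nearGL q (A n₀) hA0)⁻¹ : GL ι k) : Matrix ι ι k) * (m : Matrix ι ι k) := by
        simp only [mul_inv_rev, inv_inv, Units.val_mul, C, Matrix.mul_assoc]
    _ = ((m'⁻¹ : GL κ k) : Matrix κ κ k) * (((nearGL q (B n₀) hB0 : GL κ k) : Matrix κ κ k) *
        (((nearGL q (B n₀) hB0)⁻¹ : GL κ k) : Matrix κ κ k)) * part (Near q) w v (l n₀) *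
        (((nearGL q (A n₀) hA0 : GL ι k) : Matrix ι ι k) *
        (((nearGL q (A n₀) hA0)⁻¹ : GL ι k) : Matrix ι ι k)) * (m : Matrix ι ι k) := by
        rw [hCpart]
        simp only [Matrix.mul_assoc]
    _ = _ := by rw [e1, e2, Matrix.mul_one, Matrix.mul_one]

end Core

variable {k : Type u} [Field k]

/-! ### Sections of sheaves on the circle -/

@[simp] lemma res_self (F : Sh k) {U : Opens Circle} (h : U ≤ U) (s : Sec F U) :
    res F h s = s := by
  have : (homOfLE h).op = 𝟙 (op U) := rfl
  simp only [res, this, F.obj.map_id]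
  rfl

/-- The category of open sets of the circle lives in the universe `0`, whence this version for
small diagrams. -/
lemma forget_preservesLimits_small :
    Limits.PreservesLimitsOfSize.{0, 0} (forget (ModuleCat.{u} k)) :=
  Limits.preservesLimitsOfSize_shrink.{0, u, 0, u} _

lemma moduleCat_hasLimits_small :
    Limits.HasLimitsOfSize.{0, 0} (ModuleCat.{u} k) :=
  Limits.hasLimitsOfSizeShrink.{0, 0, u, u} _

/-- A section of a sheaf is determined by its restrictions to small neighbourhoods. -/
lemma sec_ext (F : Sh k) {U : Opens Circle} {s s' : Sec F U}
    (H : ∀ y ∈ U, ∃ (V : Opens Circle) (h : V ≤ U), y ∈ V ∧ res F h s = res F h s') : s = s' := by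
  have := forget_preservesLimits_small (k := k)
  have := moduleCat_hasLimits_small (k := k)
  choose V hVU hyV hV using H
  exact TopCat.Sheaf.eq_of_locally_eq' (X := TopCat.of Circle) F (fun y : U => V y.1 y.2) U
    (fun y => homOfLE (hVU y.1 y.2))
    (fun y hy => Opens.mem_iSup.2 ⟨⟨y, hy⟩, hyV y hy⟩) s s' (fun y => hV y.1 y.2)

/-- Sections which agree on overlaps can be glued. -/
lemma sec_glue (F : Sh k) {I : Type*} {U : Opens Circle} (V : I → Opens Circle)
    (hV : ∀ i, V i ≤ U) (hU : ∀ y ∈ U, ∃ i, y ∈ V i) (s : ∀ i, Sec F (V i))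
    (hs : ∀ i j, res F (inf_le_left : V i ⊓ V j ≤ V i) (s i) =
      res F (inf_le_right : V i ⊓ V j ≤ V j) (s j)) :
    ∃ t : Sec F U, ∀ i, res F (hV i) t = s i := by
  have := forget_preservesLimits_small (k := k)
  have := moduleCat_hasLimits_small (k := k)
  obtain ⟨t, ht, -⟩ := TopCat.Sheaf.existsUnique_gluing' (X := TopCat.of Circle) F V U
    (fun i => homOfLE (hV i)) (fun y hy => Opens.mem_iSup.2 (hU y hy)) s hs
  exact ⟨t, ht⟩

@[simp] lemma onSec_id (F : Sh k) (U : Opens Circle) (s : Sec F U) : onSec (𝟙 F) U s = s := rfl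

@[simp] lemma onSec_comp {F G H : Sh k} (f : F ⟶ G) (g : G ⟶ H) (U : Opens Circle)
    (s : Sec F U) : onSec (f ≫ g) U s = onSec g U (onSec f U s) := rfl

@[simp] lemma onSec_zero {F G : Sh k} (U : Opens Circle) (s : Sec F U) :
    onSec (0 : F ⟶ G) U s = 0 := rfl

@[simp] lemma onSec_add {F G : Sh k} (f g : F ⟶ G) (U : Opens Circle) (s : Sec F U) :
    onSec (f + g) U s = onSec f U s + onSec g U s := rfl

lemma onSec_injective_of_mono {F G : Sh k} (f : F ⟶ G) [Mono f] (U : Opens Circle) :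
    Function.Injective (onSec f U) := by
  have : Mono (f.hom.app (op U)) := by
    have h1 : Mono ((sheafToPresheaf _ _).map f) := inferInstance
    exact inferInstanceAs (Mono (((sheafToPresheaf _ _).map f).app (op U)))
  exact (ModuleCat.mono_iff_injective _).1 this

lemma wEqualsLocallyBijective_circle :
    (Opens.grothendieckTopology Circle).WEqualsLocallyBijective (ModuleCat.{u} k) :=
  GrothendieckTopology.WEqualsLocallyBijective.ofEssentiallySmall.{0, u, 0, u + 1, u, u, u} _

/-- An epimorphism of sheaves is surjective on germs. -/
lemma exists_local_lift {F G : Sh k} (f : F ⟶ G) [Epi f] {U : Opens Circle} (t : Sec G U)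
    {y : Circle} (hy : y ∈ U) :
    ∃ (V : Opens Circle) (h : V ≤ U), y ∈ V ∧ ∃ s, onSec f V s = res G h t := by
  have := wEqualsLocallyBijective_circle (k := k)
  have : Sheaf.IsLocallySurjective f := (Sheaf.isLocallySurjective_iff_epi' (ModuleCat.{u} k) f).2 inferInstance
  obtain ⟨V, i, ⟨s, hs⟩, hyV⟩ := this.imageSieve_mem t y hy
  exact ⟨V, i.le, hyV, s, hs⟩

/-- Sections of the kernel of a morphism of sheaves. -/
lemma exists_kernel_lift {F G : Sh k} (f : F ⟶ G) {U : Opens Circle} (s : Sec F U)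
    (hs : onSec f U s = 0) : ∃ s', onSec (Limits.kernel.ι f) U s' = s := by
  let Φ : Sh k ⥤ ModuleCat.{u} k := sheafToPresheaf _ _ ⋙ (evaluation _ _).obj (op U)
  have : Limits.PreservesLimit (Limits.parallelPair f 0) Φ := inferInstance
  have : Φ.Additive := { map_add := rfl }
  have h := Limits.isLimitForkMapOfIsLimit' Φ (Limits.kernel.condition f) (Limits.kernelIsKernel f)
  -- the section, as a morphism from the free module of rank one
  let z : ModuleCat.of k k ⟶ Φ.obj F := ModuleCat.ofHom (LinearMap.toSpanSingleton k _ s)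
  have hz : z ≫ Φ.map f = 0 := by
    ext
    simpa [z] using! hs
  obtain ⟨l, hl⟩ := Limits.KernelFork.IsLimit.lift' h z hz
  refine ⟨l.hom (1 : k), ?_⟩
  have := congrArg (fun m => m.hom (1 : k)) hl
  simpa [z] using! this

/-! ### Sections of the sheaf of polar parts -/

section IndexLemmas

variable {E : AddSubgroup ℚ}

lemma exists_lift (y : Circle) : ∃ t : ℝ, Circle.exp t = y := ⟨_, Circle.exp_arg y⟩

lemma leAt_add_nat {U : Opens Circle} (φ ψ : Index E U) (n : ℕ) (s t : Lift U)
    (hst : (s : ℝ) = t + n * (2 * Real.pi)) :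
    LeAt s (φ.1 s) (ψ.1 s) ↔ LeAt t (φ.1 t) (ψ.1 t) := by
  induction n generalizing s with
  | zero =>
    obtain rfl : s = t := Subtype.ext (by simpa using hst)
    rfl
  | succ n ih =>
    have h1 : (s : ℝ) = (t + n * (2 * Real.pi)) + 2 * Real.pi := by
      rw [hst]; push_cast; ring
    let r : Lift U := ⟨t + n * (2 * Real.pi), by
      have h2 := s.2
      rw [h1, Circle.exp_add_two_pi] at h2
      exact h2⟩
    rw [← ih r rfl]
    exact leAt_add_two_pi h1 (φ.2.2.2 s r h1) (ψ.2.2.2 s r h1)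

/-- The order of two sections at a point of the circle can be checked on any preimage. -/
lemma leAt_of_exp_eq {U : Opens Circle} (φ ψ : Index E U) (s t : Lift U)
    (hst : Circle.exp s = Circle.exp t) :
    LeAt s (φ.1 s) (ψ.1 s) ↔ LeAt t (φ.1 t) (ψ.1 t) := by
  obtain ⟨m, hm⟩ := Circle.exp_eq_exp.1 hst
  obtain ⟨n, rfl | rfl⟩ := m.eq_nat_or_neg
  · exact leAt_add_nat φ ψ n s t (by rw [hm]; push_cast; ring)
  · exact (leAt_add_nat φ ψ n t s (by rw [hm]; push_cast; ring)).symm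

lemma eq_of_exp_eq {U : Opens Circle} (φ ψ : Index E U) (s t : Lift U)
    (hst : Circle.exp s = Circle.exp t) (h : φ.1 s = ψ.1 s) : φ.1 t = ψ.1 t :=
  ((leAt_of_exp_eq φ ψ s t hst).1 (Or.inl h)).antisymm
    ((leAt_of_exp_eq ψ φ s t hst).1 (Or.inl h.symm))

lemma isOpen_lift (U : Opens Circle) : IsOpen {t : ℝ | Circle.exp t ∈ U} :=
  U.isOpen.preimage Circle.exp.continuous

/-- A section of the sheaf of polar parts is constant near each point. -/
lemma Index.eventually_eq {U : Opens Circle} (φ : Index E U) (t : Lift U) :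
    ∀ᶠ s in nhds (t : ℝ), ∀ hs : Circle.exp s ∈ U, φ.1 ⟨s, hs⟩ = φ.1 t := by
  have h1 := φ.2.1.eventually_eq t
  rw [show nhds t = _ from nhds_subtype _ t, Filter.eventually_comap] at h1
  filter_upwards [h1] with s hs hsU
  exact hs ⟨s, hsU⟩ rfl

lemma Index.Le.refl {U : Opens Circle} (φ : Index E U) : Index.Le φ φ := fun _ => LeAt.refl _ _

/-- The arc of the circle which is the image of an interval around `t`. -/
def ball (t ε : ℝ) : Opens Circle :=
  ⟨Circle.exp '' Set.Ioo (t - ε) (t + ε), isLocalHomeomorph_circleExp.isOpenMap _ isOpen_Ioo⟩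

lemma mem_ball {t ε : ℝ} (hε : 0 < ε) : Circle.exp t ∈ ball t ε :=
  ⟨t, ⟨by linarith, by linarith⟩, rfl⟩

lemma isPreconnected_ball (t ε : ℝ) : IsPreconnected (ball t ε : Set Circle) :=
  isPreconnected_Ioo.image _ Circle.exp.continuous.continuousOn

lemma exists_ball_le {t : ℝ} {U : Opens Circle} (h : Circle.exp t ∈ U) {p : ℝ → Prop}
    (hp : ∀ᶠ s in nhds t, p s) :
    ∃ ε > 0, ball t ε ≤ U ∧ ∀ s ∈ Set.Ioo (t - ε) (t + ε), p s := by
  have h1 : ∀ᶠ s in nhds t, Circle.exp s ∈ U := (isOpen_lift U).mem_nhds h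
  obtain ⟨ε, hε, H⟩ := Metric.eventually_nhds_iff_ball.1 (h1.and hp)
  rw [Real.ball_eq_Ioo] at H
  refine ⟨ε, hε, ?_, fun s hs => (H s hs).2⟩
  rintro _ ⟨s, hs, rfl⟩
  exact (H s hs).1

/-- The order of two sections on an arc can be checked on an interval which maps onto this arc. -/
lemma Index.le_of_forall_Ioo {U : Opens Circle} (φ ψ : Index E U) {t ε : ℝ} (hU : ball t ε ≤ U)
    (h : ∀ s (hs : s ∈ Set.Ioo (t - ε) (t + ε)),
      LeAt s (φ.1 ⟨s, hU ⟨s, hs, rfl⟩⟩) (ψ.1 ⟨s, hU ⟨s, hs, rfl⟩⟩)) :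
    Index.Le (Index.res hU φ) (Index.res hU ψ) := by
  rintro ⟨r, s, hs, hsr⟩
  exact (leAt_of_exp_eq φ ψ ⟨s, hU ⟨s, hs, rfl⟩⟩ ⟨r, hU ⟨s, hs, hsr⟩⟩ hsr).1 (h s hs)

/-- Two sections of the sheaf of polar parts which agree at a direction agree near it. -/
lemma Index.exists_res_eq {U : Opens Circle} {φ ψ : Index E U} (t : Lift U)
    (h : φ.1 t = ψ.1 t) :
    ∃ (V : Opens Circle) (hV : V ≤ U), Circle.exp t ∈ V ∧ Index.res hV φ = Index.res hV ψ := by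
  obtain ⟨ε, hε, hU, H⟩ := exists_ball_le t.2 ((Index.eventually_eq φ t).and
    (Index.eventually_eq ψ t))
  have h1 : ∀ s (hs : s ∈ Set.Ioo (t.1 - ε) (t.1 + ε)),
      φ.1 ⟨s, hU ⟨s, hs, rfl⟩⟩ = ψ.1 ⟨s, hU ⟨s, hs, rfl⟩⟩ := fun s hs => by
    rw [(H s hs).1, (H s hs).2, h]
  refine ⟨ball t ε, hU, mem_ball hε, Subtype.ext (funext fun s => ?_)⟩
  exact (Index.le_of_forall_Ioo φ ψ hU (fun s hs => Or.inl (h1 s hs)) s).antisymm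
    (Index.le_of_forall_Ioo ψ φ hU (fun s hs => Or.inl (h1 s hs).symm) s)

end IndexLemmas

/-! ### Frames of filtered sheaves -/

namespace PreStokes

variable {k : Type u} [Field k] {E : AddSubgroup ℚ}

/-- A frame of a filtered sheaf on an open set `U`: a trivialization described by coordinates
with respect to a finite basis of sections `e i`, where `e i` generates a graded piece of exponential
factor `label i`. Distinct indices may have the same label. -/
structure Frame (F : PreStokes k E) (U : Opens Circle) (ι : Type) where
  /-- the exponential factors of the members of the basis -/
  label : ι → Index E U
  /-- the coordinates of sections over open subsets of `U` -/
  coord : ∀ W : Opens Circle, W ≤ U → (Sec F.sheaf W ≃ₗ[k] (ι → LocallyConstant W k))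
  coord_res : ∀ {V W : Opens Circle} (hW : W ≤ U) (hV : V ≤ W) (s : Sec F.sheaf W) (i : ι) (y : V),
    coord V (hV.trans hW) (res F.sheaf hV s) i y = coord W hW s i ⟨y.1, hV y.2⟩
  mem_le_iff : ∀ {W : Opens Circle} (hW : W ≤ U) (φ : Index E W) (s : Sec F.sheaf W),
    s ∈ F.le W φ ↔ ∀ (i : ι) (t : Lift W),
      coord W hW s i ⟨Circle.exp t, t.2⟩ ≠ 0 → LeAt t ((label i).1 (Lift.incl hW t)) (φ.1 t)

namespace Frame

variable {F G H : PreStokes k E} {U U' U'' : Opens Circle} {ι κ μ : Type}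

/-- The coordinates of the germ of a section at a point. -/
def germ (T : Frame F U ι) {W : Opens Circle} (hW : W ≤ U) {y : Circle} (hy : y ∈ W) :
    Sec F.sheaf W →ₗ[k] (ι → k) where
  toFun s i := T.coord W hW s i ⟨y, hy⟩
  map_add' s s' := by ext i; simp
  map_smul' c s := by ext i; simp

lemma germ_apply (T : Frame F U ι) {W : Opens Circle} (hW : W ≤ U) {y : Circle} (hy : y ∈ W)
    (s : Sec F.sheaf W) (i : ι) : T.germ hW hy s i = T.coord W hW s i ⟨y, hy⟩ := rfl

@[simp] lemma germ_res (T : Frame F U ι) {V W : Opens Circle} (hW : W ≤ U) (hV : V ≤ W)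
    {hVU : V ≤ U} {y : Circle} (hy : y ∈ V) (s : Sec F.sheaf W) :
    T.germ hVU hy (res F.sheaf hV s) = T.germ hW (hV hy) s := by
  ext i
  exact T.coord_res hW hV s i ⟨y, hy⟩

lemma ext_germ (T : Frame F U ι) {W : Opens Circle} (hW : W ≤ U) {s s' : Sec F.sheaf W}
    (h : ∀ y (hy : y ∈ W), T.germ hW hy s = T.germ hW hy s') : s = s' := by
  apply (T.coord W hW).injective
  ext i y
  exact congrFun (h y.1 y.2) i

lemma mem_le_iff_germ (T : Frame F U ι) {W : Opens Circle} (hW : W ≤ U) (φ : Index E W)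
    (s : Sec F.sheaf W) : s ∈ F.le W φ ↔ ∀ (i : ι) (t : Lift W),
      T.germ hW t.2 s i ≠ 0 → LeAt t ((T.label i).1 (Lift.incl hW t)) (φ.1 t) :=
  T.mem_le_iff hW φ s

/-- The coordinates of a section are constant near each point. -/
lemma exists_germ_eq (T : Frame F U ι) [Finite ι] {W : Opens Circle} (hW : W ≤ U) {y : Circle}
    (hy : y ∈ W) (s : Sec F.sheaf W) : ∃ (V : Opens Circle) (hV : V ≤ W), y ∈ V ∧
      ∀ z (hz : z ∈ V), T.germ hW (hV hz) s = T.germ hW hy s := by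
  have h1 : ∀ i, ∀ᶠ z in nhds y, ∀ hz : z ∈ W, T.germ hW hz s i = T.germ hW hy s i := by
    intro i
    have h2 := (T.coord W hW s i).isLocallyConstant.eventually_eq ⟨y, hy⟩
    rw [nhds_subtype, Filter.eventually_comap] at h2
    filter_upwards [h2] with z hz hzW
    exact hz ⟨z, hzW⟩ rfl
  obtain ⟨V, hV, hVo, hyV⟩ := eventually_nhds_iff.1 (Filter.eventually_all.2 h1)
  refine ⟨⟨V, hVo⟩ ⊓ W, inf_le_right, ⟨hyV, hy⟩, fun z hz => ?_⟩
  ext i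
  exact hV z hz.1 i hz.2

/-- The coordinates of a section over a connected open set are constant. -/
lemma germ_eq_of_isPreconnected (T : Frame F U ι) {W : Opens Circle} (hW : W ≤ U)
    (hc : IsPreconnected (W : Set Circle)) {y z : Circle} (hy : y ∈ W) (hz : z ∈ W)
    (s : Sec F.sheaf W) : T.germ hW hy s = T.germ hW hz s := by
  ext i
  have : PreconnectedSpace W := isPreconnected_iff_preconnectedSpace.1 hc
  exact (T.coord W hW s i).isLocallyConstant.apply_eq_of_preconnectedSpace ⟨y, hy⟩ ⟨z, hz⟩

section Basis

variable [DecidableEq ι]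

/-- The basis of sections of a frame. -/
def e (T : Frame F U ι) (i : ι) : Sec F.sheaf U :=
  (T.coord U le_rfl).symm fun j => LocallyConstant.const U (Pi.single (M := fun _ => k) i 1 j)

@[simp] lemma germ_e (T : Frame F U ι) (i : ι) {h : U ≤ U} {y : Circle} (hy : y ∈ U) :
    T.germ h hy (T.e i) = Pi.single i 1 := by
  ext j
  simp [germ_apply, e]

lemma e_mem (T : Frame F U ι) (i : ι) : T.e i ∈ F.le U (T.label i) := by
  rw [T.mem_le_iff_germ le_rfl]
  intro j t h
  by_cases hij : j = i
  · subst hij; exact LeAt.refl _ _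
  · simp [hij] at h

/-- The matrix at a point of a morphism of sheaves, with respect to two frames. -/
def mat (f : F.sheaf ⟶ G.sheaf) (T : Frame F U ι) (T' : Frame G U' κ) {y : Circle} (hy : y ∈ U)
    (hy' : y ∈ U') : Matrix κ ι k :=
  Matrix.of fun i j => T'.germ (inf_le_right : U ⊓ U' ≤ U') (Opens.mem_inf.2 ⟨hy, hy'⟩)
    (onSec f (U ⊓ U') (res F.sheaf inf_le_left (T.e j))) i

/-- The matrix of a morphism is constant along an interval. -/
lemma mat_eq_of_Icc (f : F.sheaf ⟶ G.sheaf) (T : Frame F U ι) (T' : Frame G U' κ) {a b : ℝ}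
    (hU : ∀ s ∈ Set.Icc a b, Circle.exp s ∈ U) (hU' : ∀ s ∈ Set.Icc a b, Circle.exp s ∈ U')
    {s t : ℝ} (hs : s ∈ Set.Icc a b) (ht : t ∈ Set.Icc a b) :
    mat f T T' (hU s hs) (hU' s hs) = mat f T T' (hU t ht) (hU' t ht) := by
  ext i j
  have : PreconnectedSpace (Set.Icc a b) :=
    isPreconnected_iff_preconnectedSpace.1 isPreconnected_Icc
  let x := onSec f (U ⊓ U') (res F.sheaf inf_le_left (T.e j))
  let c : Set.Icc a b → ↑(U ⊓ U') := fun s => ⟨Circle.exp s, hU s s.2, hU' s s.2⟩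
  have hc : Continuous c := by
    exact (Circle.exp.continuous.comp continuous_subtype_val).subtype_mk _
  have h1 := (T'.coord _ inf_le_right x i).isLocallyConstant.comp_continuous hc
  exact h1.apply_eq_of_preconnectedSpace ⟨s, hs⟩ ⟨t, ht⟩

lemma mat_id (T : Frame F U ι) {y : Circle} (hy : y ∈ U) : mat (𝟙 F.sheaf) T T hy hy = 1 := by
  ext i j
  rw [mat, Matrix.of_apply, onSec_id, T.germ_res le_rfl, germ_e, Matrix.one_apply, Pi.single_apply]

variable [Fintype ι]

/-- Each section is near each point a combination of the members of the basis. -/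
lemma exists_res_eq (T : Frame F U ι) {W : Opens Circle} (hW : W ≤ U) {y : Circle}
    (hy : y ∈ W) (s : Sec F.sheaf W) : ∃ (V : Opens Circle) (hV : V ≤ W), y ∈ V ∧
      res F.sheaf hV s = ∑ i, T.germ hW hy s i • res F.sheaf (hV.trans hW) (T.e i) := by
  obtain ⟨V, hV, hyV, h⟩ := T.exists_germ_eq hW hy s
  refine ⟨V, hV, hyV, T.ext_germ (hV.trans hW) fun z hz => ?_⟩
  rw [T.germ_res hW hV hz, h z hz]
  simp only [map_sum, map_smul, T.germ_res le_rfl, germ_e]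
  ext j
  simp [Pi.single_apply]

lemma germ_onSec (f : F.sheaf ⟶ G.sheaf) (T : Frame F U ι) (T' : Frame G U' κ) {W : Opens Circle}
    (hW : W ≤ U) (hW' : W ≤ U') {y : Circle} (hy : y ∈ W) (s : Sec F.sheaf W) :
    T'.germ hW' hy (onSec f W s) = (mat f T T' (hW hy) (hW' hy)).mulVec (T.germ hW hy s) := by
  obtain ⟨V, hV, hyV, h⟩ := T.exists_res_eq hW hy s
  have h1 := congrArg (fun x => T'.germ (hV.trans hW') hyV (onSec f V x)) h
  simp only [onSec_res, T'.germ_res hW' hV] at h1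
  rw [h1]
  ext i
  simp only [map_sum, map_smul, Finset.sum_apply, Pi.smul_apply, smul_eq_mul, Matrix.mulVec,
    dotProduct]
  refine Finset.sum_congr rfl fun j _ => ?_
  rw [mul_comm, mat, Matrix.of_apply, onSec_res, onSec_res,
    ← T'.germ_res (hVU := hV.trans hW') (inf_le_right : U ⊓ U' ≤ U')
      (le_inf (hV.trans hW) (hV.trans hW')) hyV, res_res]

lemma mat_mulVec_single (f : F.sheaf ⟶ G.sheaf) (T : Frame F U ι) (T' : Frame G U' κ)
    {y : Circle} (hy : y ∈ U) (hy' : y ∈ U') (j : ι) {W : Opens Circle} (hW : W ≤ U)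
    (hW' : W ≤ U') (hyW : y ∈ W) :
    T'.germ hW' hyW (onSec f W (res F.sheaf hW (T.e j))) = fun i => mat f T T' hy hy' i j := by
  rw [germ_onSec f T T' hW hW', T.germ_res le_rfl, germ_e]
  ext i
  simp

/-- The matrix of a morphism of filtered sheaves is triangular for the order of polar parts. -/
lemma mat_le (f : F ⟶ G) (T : Frame F U ι) (T' : Frame G U' κ) {W : Opens Circle}
    (hW : W ≤ U) (hW' : W ≤ U') (t : Lift W) (i : κ) (j : ι)
    (h : mat f.hom T T' (hW t.2) (hW' t.2) i j ≠ 0) :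
    LeAt t ((T'.label i).1 (Lift.incl hW' t)) ((T.label j).1 (Lift.incl hW t)) := by
  have h1 := f.mem W _ _ (F.le_res hW _ _ (T.e_mem j))
  rw [T'.mem_le_iff_germ hW'] at h1
  refine h1 i t ?_
  rwa [mat_mulVec_single f.hom T T' (hW t.2) (hW' t.2)]

lemma mat_eq_of_isPreconnected (f : F.sheaf ⟶ G.sheaf) (T : Frame F U ι) (T' : Frame G U' κ)
    {W : Opens Circle} (hW : W ≤ U) (hW' : W ≤ U') (hc : IsPreconnected (W : Set Circle))
    {y z : Circle} (hy : y ∈ W) (hz : z ∈ W) :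
    mat f T T' (hW hy) (hW' hy) = mat f T T' (hW hz) (hW' hz) := by
  ext i j
  have h1 := congrFun (mat_mulVec_single f T T' (hW hy) (hW' hy) j hW hW' hy) i
  have h2 := congrFun (mat_mulVec_single f T T' (hW hz) (hW' hz) j hW hW' hz) i
  rw [← h1, ← h2, T'.germ_eq_of_isPreconnected hW' hc hy hz]

variable [Fintype κ] [DecidableEq κ]

lemma mat_comp (f : F.sheaf ⟶ G.sheaf) (g : G.sheaf ⟶ H.sheaf) (T : Frame F U ι)
    (T' : Frame G U' κ) [DecidableEq μ] [Fintype μ] (T'' : Frame H U'' μ) {y : Circle}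
    (hy : y ∈ U) (hy' : y ∈ U') (hy'' : y ∈ U'') :
    mat (f ≫ g) T T'' hy hy'' = mat g T' T'' hy' hy'' * mat f T T' hy hy' := by
  ext i j
  let W := U ⊓ U' ⊓ U''
  have hW : W ≤ U := inf_le_left.trans inf_le_left
  have hW' : W ≤ U' := inf_le_left.trans inf_le_right
  have hW'' : W ≤ U'' := inf_le_right
  have hyW : y ∈ W := ⟨⟨hy, hy'⟩, hy''⟩
  have h1 := congrFun (mat_mulVec_single (f ≫ g) T T'' hy hy'' j hW hW'' hyW) i
  rw [← h1, onSec_comp, germ_onSec g T' T'' hW' hW'', mat_mulVec_single f T T' hy hy' j hW hW' hyW]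
  rfl

end Basis

end Frame

/-! ### Constructions of frames -/

namespace Frame

variable {F G : PreStokes k E} {U : Opens Circle} {ι κ : Type}

/-- The restriction of a frame to a smaller open set. -/
def restrict (T : Frame F U ι) {V : Opens Circle} (h : V ≤ U) : Frame F V ι where
  label i := Index.res h (T.label i)
  coord W hW := T.coord W (hW.trans h)
  coord_res hW hV s i y := T.coord_res (hW.trans h) hV s i y
  mem_le_iff hW φ s := T.mem_le_iff (hW.trans h) φ s

@[simp] lemma germ_restrict (T : Frame F U ι) {V W : Opens Circle} (h : V ≤ U) (hW : W ≤ V)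
    {y : Circle} (hy : y ∈ W) (s : Sec F.sheaf W) :
    (T.restrict h).germ hW hy s = T.germ (hW.trans h) hy s := rfl

lemma e_restrict [DecidableEq ι] (T : Frame F U ι) {V : Opens Circle} (h : V ≤ U) (i : ι) :
    (T.restrict h).e i = res F.sheaf h (T.e i) := by
  refine (T.restrict h).ext_germ le_rfl fun y hy => ?_
  rw [germ_e, germ_restrict, germ_res T le_rfl, germ_e]

lemma mat_restrict [DecidableEq ι] [DecidableEq κ] [Fintype ι] {U' V V' : Opens Circle}
    (f : F.sheaf ⟶ G.sheaf)
    (T : Frame F U ι) (T' : Frame G U' κ) (h : V ≤ U) (h' : V' ≤ U') {y : Circle} (hy : y ∈ V)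
    (hy' : y ∈ V') : mat f (T.restrict h) (T'.restrict h') hy hy' = mat f T T' (h hy) (h' hy') := by
  ext i j
  have hW : V ⊓ V' ≤ V := inf_le_left
  have hW' : V ⊓ V' ≤ V' := inf_le_right
  have h1 := mat_mulVec_single f (T.restrict h) (T'.restrict h') hy hy' j hW hW' (Opens.mem_inf.2 ⟨hy, hy'⟩)
  have h2 := mat_mulVec_single f T T' (h hy) (h' hy') j (hW.trans h) (hW'.trans h')
    (Opens.mem_inf.2 ⟨hy, hy'⟩)
  rw [e_restrict, res_res, germ_restrict, h2] at h1
  exact (congrFun h1 i).symm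

section ChangeBasis

variable [Fintype ι]

/-- Multiplication by a matrix, on vectors of locally constant functions. -/
def lcMul (X : Type*) [TopologicalSpace X] (m : Matrix κ ι k) :
    (ι → LocallyConstant X k) →ₗ[k] (κ → LocallyConstant X k) where
  toFun c j := ∑ i, m j i • c i
  map_add' c c' := by ext j x; simp [Finset.sum_add_distrib]
  map_smul' a c := by ext j x; simp [Finset.smul_sum, smul_comm a]

lemma lcMul_apply {X : Type*} [TopologicalSpace X] (m : Matrix κ ι k)
    (c : ι → LocallyConstant X k) (j : κ) (x : X) :
    lcMul X m c j x = m.mulVec (fun i => c i x) j := by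
  simp only [lcMul, LinearMap.coe_mk, AddHom.coe_mk, Matrix.mulVec, dotProduct]
  rw [← LocallyConstant.coeFnAddMonoidHom_apply, map_sum]
  simp

variable [Fintype κ] [DecidableEq κ]

lemma lcMul_lcMul {X : Type*} [TopologicalSpace X] (m : Matrix κ ι k) (m' : Matrix ι κ k)
    (h : m * m' = 1) (c : κ → LocallyConstant X k) : lcMul X m (lcMul X m' c) = c := by
  ext j x
  rw [lcMul_apply]
  simp only [lcMul_apply]
  have : (fun i => m'.mulVec (fun i => c i x) i) = m'.mulVec fun i => c i x := rfl
  rw [this, Matrix.mulVec_mulVec, h, Matrix.one_mulVec]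

variable [DecidableEq ι]

/-- The frame with the basis obtained from that of `T` by an invertible matrix `m` with inverse
`m'`, with possibly another index set and labels, where `m` and `m'` are triangular for the order of
the labels. -/
def changeBasis (T : Frame F U ι) (m : Matrix ι κ k) (m' : Matrix κ ι k) (h : m * m' = 1)
    (h' : m' * m = 1) (label : κ → Index E U)
    (hm : ∀ i j, m i j ≠ 0 → Index.Le (T.label i) (label j))
    (hm' : ∀ j i, m' j i ≠ 0 → Index.Le (label j) (T.label i)) : Frame F U κ where
  label := label
  coord W hW := (T.coord W hW).trans
    { lcMul W m' with
      invFun := lcMul W m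
      left_inv := lcMul_lcMul m m' h
      right_inv := lcMul_lcMul m' m h' }
  coord_res {V W} hW hV s i y := by
    change lcMul V m' _ i y = lcMul W m' _ i _
    rw [lcMul_apply, lcMul_apply]
    congr 1
    ext j
    exact T.coord_res hW hV s j y
  mem_le_iff {W} hW φ s := by
    have key : ∀ i (y : W), T.coord W hW s i y = m.mulVec
        (fun j => lcMul W m' (T.coord W hW s) j y) i := by
      intro i y
      rw [← lcMul_apply, lcMul_lcMul m m' h]
    change _ ↔ ∀ (i : κ) (t : Lift W), lcMul W m' (T.coord W hW s) i _ ≠ 0 → _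
    rw [T.mem_le_iff hW]
    constructor
    · intro H j t hj
      rw [lcMul_apply, Matrix.mulVec, dotProduct] at hj
      obtain ⟨i, -, hi⟩ := Finset.exists_ne_zero_of_sum_ne_zero hj
      exact (hm' j i (left_ne_zero_of_mul hi) _).trans (H i t (right_ne_zero_of_mul hi))
    · intro H i t hi
      rw [key, Matrix.mulVec, dotProduct] at hi
      obtain ⟨j, -, hj⟩ := Finset.exists_ne_zero_of_sum_ne_zero hi
      exact (hm i j (left_ne_zero_of_mul hj) _).trans (H j t (right_ne_zero_of_mul hj))

lemma germ_changeBasis (T : Frame F U ι) (m : Matrix ι κ k) (m' : Matrix κ ι k) (h : m * m' = 1)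
    (h' : m' * m = 1) (label : κ → Index E U)
    (hm : ∀ i j, m i j ≠ 0 → Index.Le (T.label i) (label j))
    (hm' : ∀ j i, m' j i ≠ 0 → Index.Le (label j) (T.label i)) {W : Opens Circle} (hW : W ≤ U)
    {y : Circle} (hy : y ∈ W) (s : Sec F.sheaf W) :
    (T.changeBasis m m' h h' label hm hm').germ hW hy s = m'.mulVec (T.germ hW hy s) := by
  ext j
  exact lcMul_apply _ _ _ _

lemma mat_id_changeBasis (T : Frame F U ι) (m : Matrix ι κ k) (m' : Matrix κ ι k)
    (h : m * m' = 1) (h' : m' * m = 1) (label : κ → Index E U)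
    (hm : ∀ i j, m i j ≠ 0 → Index.Le (T.label i) (label j))
    (hm' : ∀ j i, m' j i ≠ 0 → Index.Le (label j) (T.label i)) {y : Circle} (hy : y ∈ U) :
    mat (𝟙 F.sheaf) T (T.changeBasis m m' h h' label hm hm') hy hy = m' ∧
      mat (𝟙 F.sheaf) (T.changeBasis m m' h h' label hm hm') T hy hy = m := by
  have h1 : mat (𝟙 F.sheaf) T (T.changeBasis m m' h h' label hm hm') hy hy = m' := by
    ext j i
    have := mat_mulVec_single (𝟙 F.sheaf) T (T.changeBasis m m' h h' label hm hm') hy hy i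
      le_rfl le_rfl hy
    rw [onSec_id, germ_changeBasis, T.germ_res le_rfl, germ_e, Matrix.mulVec_single_one] at this
    exact (congrFun this j).symm
  refine ⟨h1, ?_⟩
  have h2 := mat_comp (𝟙 F.sheaf) (𝟙 F.sheaf) (T.changeBasis m m' h h' label hm hm') T
    (T.changeBasis m m' h h' label hm hm') hy hy hy
  rw [Category.comp_id, mat_id, h1] at h2
  rw [← Matrix.one_mul (mat _ _ T _ _), ← h, Matrix.mul_assoc, ← h2, Matrix.mul_one]

lemma mat_changeBasis {ι' κ' : Type} [Fintype ι'] [DecidableEq ι'] [Fintype κ'] [DecidableEq κ']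
    (f : F.sheaf ⟶ G.sheaf) (T : Frame F U ι) (m : Matrix ι κ k) (m' : Matrix κ ι k)
    (h : m * m' = 1) (h' : m' * m = 1) (label : κ → Index E U)
    (hm : ∀ i j, m i j ≠ 0 → Index.Le (T.label i) (label j))
    (hm' : ∀ j i, m' j i ≠ 0 → Index.Le (label j) (T.label i))
    {U' : Opens Circle} (T' : Frame G U' ι') (n : Matrix ι' κ' k) (n' : Matrix κ' ι' k)
    (hn : n * n' = 1) (hn' : n' * n = 1) (label' : κ' → Index E U')
    (hl : ∀ i j, n i j ≠ 0 → Index.Le (T'.label i) (label' j))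
    (hl' : ∀ j i, n' j i ≠ 0 → Index.Le (label' j) (T'.label i))
    {y : Circle} (hy : y ∈ U) (hy' : y ∈ U') :
    mat f (T.changeBasis m m' h h' label hm hm') (T'.changeBasis n n' hn hn' label' hl hl') hy hy' =
      n' * mat f T T' hy hy' * m := by
  have h1 : f = 𝟙 F.sheaf ≫ f ≫ 𝟙 G.sheaf := by simp
  conv_lhs => rw [h1]
  rw [mat_comp (𝟙 F.sheaf) (f ≫ 𝟙 G.sheaf) _ T _ hy hy hy',
    mat_comp f (𝟙 G.sheaf) T T' _ hy hy' hy', (mat_id_changeBasis T' _ _ _ _ _ _ _ hy').1,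
    (mat_id_changeBasis T _ _ _ _ _ _ _ hy).2]

end ChangeBasis

section OfSections

variable [Fintype ι]

/-- The combination with constant coefficients of a family of sections. -/
def comb (e : ι → Sec F.sheaf U) {V : Opens Circle} (hV : V ≤ U) :
    (ι → k) →ₗ[k] Sec F.sheaf V where
  toFun a := ∑ i, a i • res F.sheaf hV (e i)
  map_add' a b := by simp [add_smul, Finset.sum_add_distrib]
  map_smul' c a := by simp [mul_smul, Finset.smul_sum]

lemma comb_apply (e : ι → Sec F.sheaf U) {V : Opens Circle} (hV : V ≤ U) (a : ι → k) :
    comb e hV a = ∑ i, a i • res F.sheaf hV (e i) := rfl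

lemma res_comb (e : ι → Sec F.sheaf U) {V W : Opens Circle} (hW : W ≤ U) (hV : V ≤ W)
    (a : ι → k) : res F.sheaf hV (comb e hW a) = comb e (hV.trans hW) a := by
  simp [comb_apply, res_res]

lemma exists_comb [DecidableEq ι] (T : Frame F U ι) {W : Opens Circle} (hW : W ≤ U) {y : Circle}
    (hy : y ∈ W) (s : Sec F.sheaf W) : ∃ (V : Opens Circle) (hV : V ≤ W), y ∈ V ∧
      res F.sheaf hV s = comb T.e (hV.trans hW) (T.germ hW hy s) := T.exists_res_eq hW hy s

lemma germ_comb [DecidableEq ι] (T : Frame F U ι) {W : Opens Circle} (hW : W ≤ U) {y : Circle}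
    (hy : y ∈ W) (a : ι → k) : T.germ hW hy (comb T.e hW a) = a := by
  rw [comb_apply]
  simp only [map_sum, map_smul, T.germ_res le_rfl, germ_e]
  ext j
  simp [Pi.single_apply]

lemma coord_unique {e : ι → Sec F.sheaf U}
    (indep : ∀ (V : Opens Circle) (hV : V ≤ U) (y : Circle), y ∈ V → ∀ a : ι → k,
      comb e hV a = 0 → a = 0) {W V V' : Opens Circle} (hW : W ≤ U) (hV : V ≤ W)
    (hV' : V' ≤ W) {y : Circle} (hy : y ∈ V) (hy' : y ∈ V') (s : Sec F.sheaf W) {a a' : ι → k}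
    (h : res F.sheaf hV s = comb e (hV.trans hW) a)
    (h' : res F.sheaf hV' s = comb e (hV'.trans hW) a') : a = a' := by
  have h1 := congrArg (res F.sheaf (inf_le_left : V ⊓ V' ≤ V)) h
  have h2 := congrArg (res F.sheaf (inf_le_right : V ⊓ V' ≤ V')) h'
  rw [res_res, res_comb] at h1 h2
  rw [← sub_eq_zero]
  refine indep (V ⊓ V') ((inf_le_left.trans hV).trans hW) y ⟨hy, hy'⟩ _ ?_
  rw [map_sub, ← h1, ← h2, sub_self]

/-- A family of sections which is, near each point, a basis of the sections of `F`, and is adapted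
to the filtration, defines a frame. -/
theorem exists_of_sections (e : ι → Sec F.sheaf U) (label : ι → Index E U)
    (span : ∀ (W : Opens Circle) (hW : W ≤ U) (s : Sec F.sheaf W) (y : Circle), y ∈ W →
      ∃ (V : Opens Circle) (hV : V ≤ W), y ∈ V ∧ ∃ a : ι → k,
        res F.sheaf hV s = comb e (hV.trans hW) a)
    (indep : ∀ (V : Opens Circle) (hV : V ≤ U) (y : Circle), y ∈ V → ∀ a : ι → k,
      comb e hV a = 0 → a = 0)
    (mem : ∀ i, e i ∈ F.le U (label i))
    (le : ∀ (V : Opens Circle) (hV : V ≤ U) (φ : Index E V) (a : ι → k),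
      comb e hV a ∈ F.le V φ → ∀ i, a i ≠ 0 → Index.Le (Index.res hV (label i)) φ) :
    ∃ T : Frame F U ι, T.label = label ∧ ∀ (W : Opens Circle) (hW : W ≤ U) (y : Circle)
      (hy : y ∈ W) (a : ι → k), T.germ hW hy (comb e hW a) = a := by
  choose V hV hyV a ha using span
  have uniq : ∀ {W V' : Opens Circle} (hW : W ≤ U) (hV' : V' ≤ W) (s : Sec F.sheaf W) (y : Circle)
      (hy : y ∈ W) (hy' : y ∈ V') (a' : ι → k),
      res F.sheaf hV' s = comb e (hV'.trans hW) a' → a W hW s y hy = a' := by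
    intro W V' hW hV' s y hy hy' a' h
    exact coord_unique indep hW (hV W hW s y hy) hV' (hyV W hW s y hy) hy' s (ha W hW s y hy) h
  have hnear : ∀ {W : Opens Circle} (hW : W ≤ U) (s : Sec F.sheaf W) (y z : Circle)
      (hy : y ∈ W) (hz : z ∈ V W hW s y hy), a W hW s z (hV W hW s y hy hz) = a W hW s y hy := by
    intro W hW s y z hy hz
    exact uniq hW (hV W hW s y hy) s z _ hz _ (ha W hW s y hy)
  -- the coordinates as locally constant functions
  let c : ∀ (W : Opens Circle) (hW : W ≤ U), Sec F.sheaf W → ι → LocallyConstant W k :=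
    fun W hW s i =>
      { toFun := fun y => a W hW s y.1 y.2 i
        isLocallyConstant := by
          rw [IsLocallyConstant.iff_eventually_eq]
          intro y
          have : ∀ᶠ z : W in nhds y, z.1 ∈ V W hW s y.1 y.2 :=
            continuous_subtype_val.continuousAt.eventually
              ((V W hW s y.1 y.2).isOpen.mem_nhds (hyV W hW s y.1 y.2))
          filter_upwards [this] with z hz
          exact congrFun (hnear hW s y.1 z.1 y.2 hz) i }
  let cl : ∀ (W : Opens Circle) (hW : W ≤ U), Sec F.sheaf W →ₗ[k] (ι → LocallyConstant W k) :=
    fun W hW =>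
      { toFun := c W hW
        map_add' := by
          intro s s'
          ext i y
          refine congrFun (uniq hW (inf_le_left.trans (hV W hW s y.1 y.2)) (s + s') y.1 y.2
            (V' := V W hW s y.1 y.2 ⊓ V W hW s' y.1 y.2)
            ⟨hyV W hW s y.1 y.2, hyV W hW s' y.1 y.2⟩ (a W hW s y.1 y.2 + a W hW s' y.1 y.2) ?_) i
          rw [map_add, map_add, ← res_res F.sheaf (hV W hW s y.1 y.2) inf_le_left, ha,
            ← res_res F.sheaf (hV W hW s' y.1 y.2) inf_le_right, ha, res_comb, res_comb]
        map_smul' := by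
          intro b s
          ext i y
          refine congrFun (uniq hW (hV W hW s y.1 y.2) (b • s) y.1 y.2 (hyV W hW s y.1 y.2)
            (b • a W hW s y.1 y.2) ?_) i
          rw [map_smul, map_smul, ha] }
  have hinj : ∀ W hW, Function.Injective (cl W hW) := by
    intro W hW
    rw [injective_iff_map_eq_zero]
    intro s hs
    refine sec_ext _ fun y hy => ⟨V W hW s y hy, hV W hW s y hy, hyV W hW s y hy, ?_⟩
    have : a W hW s y hy = 0 := by
      ext i
      exact congrArg (fun f : LocallyConstant W k => f ⟨y, hy⟩) (congrFun hs i)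
    rw [ha, this, map_zero, map_zero]
  have hsurj : ∀ W hW, Function.Surjective (cl W hW) := by
    intro W hW f
    have h1 : ∀ y : W, ∃ V' : Opens Circle, V' ≤ W ∧ y.1 ∈ V' ∧
        ∀ z (hz : z ∈ W), z ∈ V' → ∀ i, f i ⟨z, hz⟩ = f i y := by
      intro y
      have h2 : ∀ i, ∀ᶠ z in nhds y.1, ∀ hz : z ∈ W, f i ⟨z, hz⟩ = f i y := by
        intro i
        have h3 := (f i).isLocallyConstant.eventually_eq y
        rw [show nhds y = _ from nhds_subtype _ y, Filter.eventually_comap] at h3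
        filter_upwards [h3] with z hz hzW
        exact hz ⟨z, hzW⟩ rfl
      obtain ⟨V', hV', hVo, hyV'⟩ := eventually_nhds_iff.1 (Filter.eventually_all.2 h2)
      exact ⟨⟨V', hVo⟩ ⊓ W, inf_le_right, ⟨hyV', y.2⟩, fun z hz hz' i => hV' z hz'.1 i hz⟩
    choose V' hV'W hyV' hV' using h1
    obtain ⟨s, hs⟩ := sec_glue F.sheaf V' hV'W (fun y hy => ⟨⟨y, hy⟩, hyV' ⟨y, hy⟩⟩)
      (fun y => comb e ((hV'W y).trans hW) fun i => f i y) (by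
        intro y z
        refine sec_ext _ fun x hx => ⟨_, le_rfl, hx, ?_⟩
        have hxW : x ∈ W := hV'W y hx.1
        have h4 : (fun i => f i y) = fun i => f i z := by
          ext i
          rw [← hV' y x hxW hx.1 i, ← hV' z x hxW hx.2 i]
        simp only [res_comb, h4])
    refine ⟨s, ?_⟩
    ext i y
    exact congrFun (uniq hW (hV'W y) s y.1 y.2 (hyV' y) _ (hs y)) i
  refine ⟨{ label := label
            coord := fun W hW => LinearEquiv.ofBijective (cl W hW) ⟨hinj W hW, hsurj W hW⟩
            coord_res := ?_
            mem_le_iff := ?_ }, rfl, ?_⟩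
  · intro V₁ W hW hV₁ s i y
    refine congrFun (uniq (hV₁.trans hW) (V' := V W hW s y.1 (hV₁ y.2) ⊓ V₁) inf_le_right
      (res F.sheaf hV₁ s) y.1 y.2 ⟨hyV W hW s y.1 (hV₁ y.2), y.2⟩ (a W hW s y.1 (hV₁ y.2)) ?_) i
    rw [res_res, ← res_res F.sheaf (hV W hW s y.1 (hV₁ y.2)) inf_le_left, ha, res_comb]
  · intro W hW φ s
    constructor
    · intro hs i t ht
      have h1 := F.le_res (hV W hW s _ t.2) φ s hs
      rw [ha] at h1
      exact le _ _ _ _ h1 i ht ⟨t.1, hyV W hW s _ t.2⟩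
    · intro H
      refine F.le_local W φ s fun y hy => ⟨V W hW s y hy, hV W hW s y hy, hyV W hW s y hy, ?_⟩
      rw [ha, comb_apply]
      refine Submodule.sum_mem _ fun i _ => ?_
      by_cases hi : a W hW s y hy i = 0
      · rw [hi, zero_smul]; exact Submodule.zero_mem _
      · refine Submodule.smul_mem _ _ (F.le_mono _ _ _ ?_ (F.le_res _ _ _ (mem i)))
        intro t
        refine H i (Lift.incl (hV W hW s y hy) t) ?_
        have := congrFun (hnear hW s y _ hy t.2) i
        exact fun h => hi (this.symm.trans h)
  · intro W hW y hy b
    exact uniq hW le_rfl _ y hy hy b (by rw [res_comb])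

end OfSections

end Frame

/-! ### Frames and trivializations -/

section Convert

variable {F G : PreStokes k E} {U : Opens Circle} {ι κ : Type}

/-- Grouping the components of a vector of locally constant functions. -/
def lcSigma (X : Type*) [TopologicalSpace X] {Ψ : Type*} {r : Ψ → ℕ}
    (σ : (Σ ψ, Fin (r ψ)) ≃ ι) :
    (ι → LocallyConstant X k) ≃ₗ[k] ((ψ : Ψ) → LocallyConstant X (Fin (r ψ) → k)) where
  toFun c ψ := LocallyConstant.unflip fun i => c (σ ⟨ψ, i⟩)
  map_add' c c' := by ext ψ x i; rfl
  map_smul' a c := by ext ψ x i; rfl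
  invFun f i := (f (σ.symm i).1).map fun v => v (σ.symm i).2
  left_inv c := by
    ext i x
    change c (σ (σ.symm i)) x = _
    rw [σ.apply_symm_apply]
  right_inv f := by
    ext ψ x i
    change f (σ.symm (σ ⟨ψ, i⟩)).1 x (σ.symm (σ ⟨ψ, i⟩)).2 = _
    rw [σ.symm_apply_apply]

/-- The frame given by the canonical bases of the graded pieces of a trivialization. -/
def Trivialization.toFrame (T : Trivialization F U) :
    Frame F U (Σ ψ : T.Φ, Fin (T.rank ψ)) where
  label i := i.1
  coord W hW := (T.iso W hW).trans (lcSigma W (Equiv.refl _)).symm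
  coord_res hW hV s i y := by
    exact congrFun (T.iso_res hW hV s i.1 y) i.2
  mem_le_iff {W} hW φ s := by
    rw [T.mem_le_iff hW]
    constructor
    · intro H i t h
      exact H i.1 t fun h0 => h (congrFun h0 i.2)
    · intro H ψ t h
      obtain ⟨i, hi⟩ := Function.ne_iff.1 h
      exact H ⟨ψ, i⟩ t hi

namespace Frame

variable [Fintype ι]

open scoped Classical in
/-- The label of an index, as an element of the set of labels. -/
def labelMem (T : Frame F U ι) (i : ι) : Finset.univ.image T.label :=
  ⟨T.label i, Finset.mem_image_of_mem _ (Finset.mem_univ i)⟩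

open scoped Classical in
/-- An enumeration of the indices by their labels. -/
def labelEquiv (T : Frame F U ι) : (Σ ψ : Finset.univ.image T.label,
    Fin (Fintype.card {i // T.labelMem i = ψ})) ≃ ι :=
  (Equiv.sigmaCongrRight fun ψ => (Fintype.equivFin {i // T.labelMem i = ψ}).symm).trans
    (Equiv.sigmaFiberEquiv T.labelMem)

open scoped Classical in
lemma label_labelEquiv (T : Frame F U ι) (x) : T.label (T.labelEquiv x) = x.1 :=
  congrArg Subtype.val (((Fintype.equivFin {i // T.labelMem i = x.1}).symm x.2).2)

open scoped Classical in
lemma label_eq_symm (T : Frame F U ι) (i : ι) :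
    ((T.labelEquiv.symm i).1 : Index E U) = T.label i := by
  rw [← T.label_labelEquiv, Equiv.apply_symm_apply]

open scoped Classical in
/-- The trivialization obtained by grouping the members of a frame by their labels. -/
def toTrivialization (T : Frame F U ι) : Trivialization F U where
  Φ := Finset.univ.image T.label
  rank ψ := Fintype.card {i // T.labelMem i = ψ}
  iso W hW := (T.coord W hW).trans (lcSigma W T.labelEquiv)
  iso_res hW hV s ψ y := by
    ext i
    exact T.coord_res hW hV s _ y
  mem_le_iff {W} hW φ s := by
    rw [T.mem_le_iff hW]
    simp only [LinearEquiv.trans_apply]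
    constructor
    · intro H ψ t h
      obtain ⟨i, hi⟩ := Function.ne_iff.1 h
      have := H (T.labelEquiv ⟨ψ, i⟩) t hi
      rwa [label_labelEquiv] at this
    · intro H i t h
      obtain ⟨x, rfl⟩ := T.labelEquiv.surjective i
      rw [label_labelEquiv]
      refine H x.1 t fun h0 => h ?_
      exact congrFun h0 x.2

lemma isDiagonal_of_mat [DecidableEq ι] [Fintype κ] [DecidableEq κ] (T : Frame F U ι)
    (T' : Frame G U κ) (f : F ⟶ G)
    (h : ∀ y (hy : y ∈ U) i j, mat f.hom T T' hy hy i j ≠ 0 → T'.label i = T.label j) :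
    IsDiagonal T.toTrivialization T'.toTrivialization f := by
  classical
  intro W hW ψ ψ' hne v
  ext y i
  let s := (T.toTrivialization.iso W hW).symm (Pi.single ψ v)
  change T'.germ hW y.2 (onSec f.hom W s) (T'.labelEquiv ⟨ψ', i⟩) = 0
  rw [germ_onSec f.hom T T' hW hW, Matrix.mulVec, dotProduct]
  refine Finset.sum_eq_zero fun j _ => ?_
  by_contra hj
  have h1 := h y.1 (hW y.2) _ _ (left_ne_zero_of_mul hj)
  rw [label_labelEquiv] at h1
  have h3 : (T.labelEquiv.symm j).1 ≠ ψ := by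
    intro h3
    apply hne
    rw [h1, ← h3, label_eq_symm]
  have h2 : (T.toTrivialization.iso W hW s) (T.labelEquiv.symm j).1 = 0 := by
    rw [LinearEquiv.apply_symm_apply]
    exact Pi.single_eq_of_ne
      (M := fun ψ => LocallyConstant W (Fin (T.toTrivialization.rank ψ) → k)) h3 v
  have h4 : T.germ hW y.2 s j = 0 := by
    have h5 := congrArg (fun c => c y (T.labelEquiv.symm j).2) h2
    rw [← T.labelEquiv.apply_symm_apply j]
    exact h5
  exact right_ne_zero_of_mul hj h4

end Frame

/-- A filtered sheaf is a Stokes-filtered local system if and only if it has frames locally. -/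
lemma isStokes_iff : F.IsStokes ↔ ∀ y : Circle, ∃ U : Opens Circle, y ∈ U ∧
    ∃ (ι : Type) (_ : Fintype ι), Nonempty (Frame F U ι) := by
  constructor
  · intro h y
    obtain ⟨U, hy, ⟨T⟩⟩ := h y
    exact ⟨U, hy, _, inferInstance, ⟨T.toFrame⟩⟩
  · intro h y
    obtain ⟨U, hy, ι, _, ⟨T⟩⟩ := h y
    exact ⟨U, hy, ⟨T.toTrivialization⟩⟩

end Convert

end PreStokes

/-! ### Multiplicities of labels -/

/-- A matrix and its inverse, both triangular for an order, have as many rows as columns of each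
label. -/
lemma exists_equiv_of_supp {k : Type u} [Field k] {P : Type*} {ι κ : Type} [Fintype ι]
    [DecidableEq ι] [Fintype κ] [DecidableEq κ] {r : P → P → Prop} {v : ι → P} {w : κ → P}
    (antisymm : ∀ a b, r a b → r b a → a = b) (A : Matrix κ ι k) (B : Matrix ι κ k)
    (hA : Supp r w v A) (hB : Supp r v w B) (hAB : A * B = 1) (hBA : B * A = 1) :
    ∃ σ : ι ≃ κ, ∀ i, w (σ i) = v i := by
  classical
  have hconv : ∀ a b c, r a b → r b c → a = c → a = b := by
    rintro a b c hab hbc rfl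
    exact antisymm _ _ hab hbc
  have hAB' : part (· = ·) w v A * part (· = ·) v w B = 1 := by
    rw [← part_mul (r := (· = ·)) (fun _ _ => Eq.symm) (fun _ _ _ => Eq.trans) hconv hA hB, hAB,
      part_one fun _ => rfl]
  have hBA' : part (· = ·) v w B * part (· = ·) w v A = 1 := by
    rw [← part_mul (r := (· = ·)) (fun _ _ => Eq.symm) (fun _ _ _ => Eq.trans) hconv hB hA, hBA,
      part_one fun _ => rfl]
  have hsub : ∀ (p : P) {ι κ : Type} [Fintype ι] [Fintype κ] [DecidableEq κ] {v : ι → P}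
      {w : κ → P} (A : Matrix κ ι k) (B : Matrix ι κ k),
      part (· = ·) w v A * part (· = ·) v w B = 1 →
      (A.submatrix (Subtype.val : {j // w j = p} → κ) (Subtype.val : {i // v i = p} → ι)) *
      (B.submatrix (Subtype.val : {i // v i = p} → ι) (Subtype.val : {j // w j = p} → κ)) = 1 := by
    intro p ι κ _ _ _ v w A B hAB
    ext i j
    have h1 : (part (· = ·) w v A * part (· = ·) v w B) i.1 j.1 = (1 : Matrix κ κ k) i.1 j.1 := by
      rw [hAB]
    rw [Matrix.mul_apply, ← Fintype.sum_subtype_add_sum_subtype (fun l => v l = p)] at h1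
    have h2 : ∑ l : {l // ¬ v l = p}, part (· = ·) w v A i.1 l.1 * part (· = ·) v w B l.1 j.1 = 0 :=
      Finset.sum_eq_zero fun l _ => by
        rw [part_apply_of_not (fun h => l.2 (by rw [← h, i.2])), zero_mul]
    rw [h2, add_zero] at h1
    rw [Matrix.mul_apply]
    have h3 : (1 : Matrix κ κ k) i.1 j.1 = (1 : Matrix {j // w j = p} {j // w j = p} k) i j := by
      simp only [Matrix.one_apply, Subtype.ext_iff]
    rw [← h3, ← h1]
    refine Finset.sum_congr rfl fun l _ => ?_
    rw [part_apply_of (by rw [i.2, l.2]), part_apply_of (by rw [j.2, l.2])]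
    rfl
  have hcard : ∀ p, Nonempty ({i // v i = p} ≃ {j // w j = p}) := by
    intro p
    have e : ({i // v i = p} → k) ≃ₗ[k] ({j // w j = p} → k) :=
      LinearEquiv.ofLinearMap (Matrix.toLin' (A.submatrix Subtype.val Subtype.val))
        (Matrix.toLin' (B.submatrix Subtype.val Subtype.val))
        (by rw [← Matrix.toLin'_mul, hsub p A B hAB', Matrix.toLin'_one])
        (by rw [← Matrix.toLin'_mul, hsub p B A hBA', Matrix.toLin'_one])
    have := e.finrank_eq
    rw [Module.finrank_fintype_fun_eq_card, Module.finrank_fintype_fun_eq_card] at this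
    exact ⟨Fintype.equivOfCardEq this⟩
  exact ⟨Equiv.ofFiberEquiv fun p => (hcard p).some, fun i => Equiv.ofFiberEquiv_map _ i⟩

namespace PreStokes

variable {k : Type u} [Field k] {E : AddSubgroup ℚ}

/-! ### Propagation of frames along the line -/

section Propagation

variable {F G : PreStokes k E} {ι κ : Type}

/-- Reindexing a frame. -/
def Frame.reindex {U : Opens Circle} (T : Frame F U κ) (σ : ι ≃ κ) : Frame F U ι where
  label i := T.label (σ i)
  coord W hW := (T.coord W hW).trans (LinearEquiv.funCongrLeft k (LocallyConstant W k) σ)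
  coord_res hW hV s i y := T.coord_res hW hV s (σ i) y
  mem_le_iff hW φ s := by
    rw [T.mem_le_iff hW, ← σ.forall_congr_right]
    rfl

/-- There is a frame near `exp (i t)` whose members have the labels `v i` at the direction `t`. -/
def HasFrameAt (F : PreStokes k E) (v : ι → ℚ →₀ ℂ) (t : ℝ) : Prop :=
  ∃ (U : Opens Circle) (h : Circle.exp t ∈ U) (T : Frame F U ι), ∀ i, (T.label i).1 ⟨t, h⟩ = v i

lemma Frame.eventually_label_eq [Finite ι] {U : Opens Circle} {t : ℝ} (h : Circle.exp t ∈ U)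
    (T : Frame F U ι) :
    ∀ᶠ s in nhds t, ∃ hs : Circle.exp s ∈ U, ∀ i, (T.label i).1 ⟨s, hs⟩ = (T.label i).1 ⟨t, h⟩ := by
  have h1 : ∀ᶠ s in nhds t, Circle.exp s ∈ U := (isOpen_lift U).mem_nhds h
  filter_upwards [h1, Filter.eventually_all.2 fun i => Index.eventually_eq (T.label i) ⟨t, h⟩] with s hs hi
  exact ⟨hs, fun i => hi i hs⟩

/-- Two frames have the same labels at each direction, with the same multiplicities. -/
lemma Frame.exists_equiv [Fintype ι] [Fintype κ] {U U' : Opens Circle} (T : Frame F U ι)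
    (T' : Frame F U' κ) {t : ℝ} (h : Circle.exp t ∈ U) (h' : Circle.exp t ∈ U') :
    ∃ σ : ι ≃ κ, ∀ i, (T'.label (σ i)).1 ⟨t, h'⟩ = (T.label i).1 ⟨t, h⟩ := by
  classical
  let W := U ⊓ U'
  let x : Lift W := ⟨t, h, h'⟩
  refine exists_equiv_of_supp (fun a b => LeAt.antisymm) (mat (𝟙 F.sheaf) T T' h h')
    (mat (𝟙 F.sheaf) T' T h' h)
    (fun i j hij => mat_le (𝟙 F) T T' (W := W) inf_le_left inf_le_right x i j hij)
    (fun i j hij => mat_le (𝟙 F) T' T (W := W) inf_le_right inf_le_left x i j hij) ?_ ?_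
  · rw [← mat_comp, Category.comp_id, mat_id]
  · rw [← mat_comp, Category.comp_id, mat_id]

/-- A frame at one direction gives a frame with the same labels at all directions: the set of the
directions at which there is one is open and closed. -/
lemma HasFrameAt.of_exists [Fintype ι] {v : ι → ℚ →₀ ℂ} (hF : F.IsStokes) {t₀ : ℝ}
    (h₀ : HasFrameAt F v t₀) (t : ℝ) : HasFrameAt F v t := by
  have hopen : IsOpen {t | HasFrameAt F v t} := by
    rw [isOpen_iff_eventually]
    rintro t ⟨U, h, T, hT⟩
    filter_upwards [T.eventually_label_eq h] with s ⟨hs, hi⟩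
    exact ⟨U, hs, T, fun i => (hi i).trans (hT i)⟩
  have hclosed : IsClosed {t | HasFrameAt F v t} := by
    rw [← isOpen_compl_iff, isOpen_iff_eventually]
    intro t ht
    obtain ⟨U, h, κ, _, ⟨T⟩⟩ := isStokes_iff.1 hF (Circle.exp t)
    filter_upwards [T.eventually_label_eq h] with s ⟨hs, hi⟩
    rintro ⟨U', h', T', hT'⟩
    obtain ⟨σ, hσ⟩ := T'.exists_equiv T h' hs
    exact ht ⟨U, h, T.reindex σ, fun i => by
      rw [← hT' i, ← hσ i, hi (σ i)]; rfl⟩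
  have := IsClopen.eq_univ ⟨hclosed, hopen⟩ ⟨t₀, h₀⟩
  exact (Set.ext_iff.1 this t).2 trivial

/-- Frames of two Stokes-filtered local systems on the intervals of a subdivision, with the same
labels on all intervals. -/
lemma exists_frames_along [Fintype ι] [Fintype κ] {v : ι → ℚ →₀ ℂ} {w : κ → ℚ →₀ ℂ}
    (hF : ∀ t, HasFrameAt F v t) (hG : ∀ t, HasFrameAt G w t) {a b : ℝ} (hab : a ≤ b) :
    ∃ τ : ℕ → ℝ, Monotone τ ∧ (∃ N, ∀ s ∈ Set.Icc a b, ∃ n ≤ N, s ∈ Set.Icc (τ n) (τ (n + 1))) ∧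
      ∀ n, ∃ (U : Opens Circle) (U' : Opens Circle) (T : Frame F U ι) (T' : Frame G U' κ),
        ∀ s ∈ Set.Icc (τ n) (τ (n + 1)), ∃ (hs : Circle.exp s ∈ U) (hs' : Circle.exp s ∈ U'),
          (∀ i, (T.label i).1 ⟨s, hs⟩ = v i) ∧ (∀ i, (T'.label i).1 ⟨s, hs'⟩ = w i) := by
  choose U hU T hT using hF
  choose U' hU' T' hT' using hG
  have hev : ∀ t, ∃ O : Set ℝ, IsOpen O ∧ t ∈ O ∧ ∀ s ∈ O,
      ∃ (hs : Circle.exp s ∈ U t) (hs' : Circle.exp s ∈ U' t),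
        (∀ i, ((T t).label i).1 ⟨s, hs⟩ = v i) ∧ (∀ i, ((T' t).label i).1 ⟨s, hs'⟩ = w i) := by
    intro t
    obtain ⟨O, hO, hOo, htO⟩ := eventually_nhds_iff.1
      (((T t).eventually_label_eq (hU t)).and ((T' t).eventually_label_eq (hU' t)))
    refine ⟨O, hOo, htO, fun s hs => ?_⟩
    obtain ⟨⟨h1, h2⟩, h3, h4⟩ := hO s hs
    exact ⟨h1, h3, fun i => (h2 i).trans (hT t i), fun i => (h4 i).trans (hT' t i)⟩
  choose O hOo htO hO using hev
  obtain ⟨τ, hτ0, hτ, ⟨N, hN⟩, hτO⟩ := exists_monotone_Icc_subset_open_cover_Icc hab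
    (c := fun t : ℝ => (Subtype.val ⁻¹' O t : Set (Set.Icc a b)))
    (fun t => (hOo t).preimage continuous_subtype_val)
    (fun s _ => Set.mem_iUnion.2 ⟨s.1, htO s.1⟩)
  refine ⟨fun n => τ n, fun _ _ h => hτ h, ⟨N, ?_⟩, fun n => ?_⟩
  · intro s hs
    -- the last index `n` with `τ n ≤ s`
    have key : ∀ M, s ≤ τ M → ∃ n ≤ M, s ∈ Set.Icc (τ n : ℝ) (τ (n + 1)) := by
      intro M
      induction M with
      | zero =>
        intro h
        refine ⟨0, le_rfl, ?_, h.trans (hτ (Nat.zero_le 1))⟩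
        rw [hτ0]
        exact hs.1
      | succ M ih =>
        intro h
        rcases le_total s (τ M) with h' | h'
        · obtain ⟨n, hn, hn'⟩ := ih h'
          exact ⟨n, hn.trans (Nat.le_succ M), hn'⟩
        · exact ⟨M, Nat.le_succ M, h', h⟩
    exact key N (by rw [hN N le_rfl]; exact hs.2)
  · obtain ⟨t, ht⟩ := hτO n
    refine ⟨U t, U' t, T t, T' t, fun s hs => hO t s ?_⟩
    have hsab : s ∈ Set.Icc a b := ⟨(τ n).2.1.trans hs.1, hs.2.trans (τ (n + 1)).2.2⟩
    exact ht (show (⟨s, hsab⟩ : Set.Icc a b) ∈ Set.Icc (τ n) (τ (n + 1)) from hs)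

end Propagation

/-! ### Local trivializations for which all morphisms are diagonal -/

section Diagonal

variable {F G : PreStokes k E}

/-- The invertible matrix comparing two frames of the same filtered sheaf. -/
def Frame.transition {ι : Type} [Fintype ι] [DecidableEq ι] {U U' : Opens Circle}
    (T : Frame F U ι) (T' : Frame F U' ι) {y : Circle} (hy : y ∈ U) (hy' : y ∈ U') : GL ι k where
  val := mat (𝟙 F.sheaf) T' T hy' hy
  inv := mat (𝟙 F.sheaf) T T' hy hy'
  val_inv := by rw [← mat_comp, Category.comp_id, mat_id]
  inv_val := by rw [← mat_comp, Category.comp_id, mat_id]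

/-- Labels near a direction are constant, and a matrix which is triangular for the order of the
labels at a direction is triangular near this direction. -/
lemma Frame.eventually_triangular {ι : Type} [Fintype ι] [DecidableEq ι] {U : Opens Circle}
    (T : Frame F U ι) {t : ℝ} (ht : Circle.exp t ∈ U) (m : GL ι k)
    (hm : ∀ i j, (m : Matrix ι ι k) i j ≠ 0 →
      LeAt t ((T.label i).1 ⟨t, ht⟩) ((T.label j).1 ⟨t, ht⟩))
    (hm' : ∀ i j, ((m⁻¹ : GL ι k) : Matrix ι ι k) i j ≠ 0 →
      LeAt t ((T.label i).1 ⟨t, ht⟩) ((T.label j).1 ⟨t, ht⟩)) :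
    ∀ᶠ s in nhds t, ∀ hs : Circle.exp s ∈ U,
      (∀ i, (T.label i).1 ⟨s, hs⟩ = (T.label i).1 ⟨t, ht⟩) ∧
      (∀ i j, (m : Matrix ι ι k) i j ≠ 0 →
        LeAt s ((T.label i).1 ⟨s, hs⟩) ((T.label j).1 ⟨s, hs⟩)) ∧
      (∀ i j, ((m⁻¹ : GL ι k) : Matrix ι ι k) i j ≠ 0 →
        LeAt s ((T.label i).1 ⟨s, hs⟩) ((T.label j).1 ⟨s, hs⟩)) := by
  have hle : ∀ M : Matrix ι ι k, (∀ i j, M i j ≠ 0 →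
      LeAt t ((T.label i).1 ⟨t, ht⟩) ((T.label j).1 ⟨t, ht⟩)) → ∀ᶠ s in nhds t,
      ∀ i j, M i j ≠ 0 → LeAt s ((T.label i).1 ⟨t, ht⟩) ((T.label j).1 ⟨t, ht⟩) := by
    intro M hM
    refine Filter.eventually_all.2 fun i => Filter.eventually_all.2 fun j => ?_
    by_cases hij : M i j = 0
    · exact Filter.Eventually.of_forall fun s h => absurd hij h
    · filter_upwards [(hM i j hij).eventually] with s hs _
      exact hs
  filter_upwards [T.eventually_label_eq ht, hle _ hm, hle _ hm'] with s ⟨hs, h1⟩ h2 h3 hs'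
  refine ⟨h1, fun i j hij => ?_, fun i j hij => ?_⟩
  · rw [h1, h1]; exact h2 i j hij
  · rw [h1, h1]; exact h3 i j hij

/-- In the neighbourhood of each point, two Stokes-filtered local systems have frames for which
all morphisms between them are diagonal. -/
theorem exists_diagonal_frames (hF : F.IsStokes) (hG : G.IsStokes) (y : Circle) :
    ∃ U : Opens Circle, y ∈ U ∧ IsPreconnected (U : Set Circle) ∧
      ∃ (ι κ : Type) (_ : Fintype ι) (_ : Fintype κ) (_ : DecidableEq ι) (_ : DecidableEq κ)
        (T : Frame F U ι) (T' : Frame G U κ), ∀ f : F ⟶ G, ∀ z (hz : z ∈ U) i j,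
          Frame.mat f.hom T T' hz hz i j ≠ 0 → T'.label i = T.label j := by
  classical
  obtain ⟨t₀, rfl⟩ := exists_lift y
  obtain ⟨U₀, hU₀, ι, _, ⟨T₀⟩⟩ := isStokes_iff.1 hF (Circle.exp t₀)
  obtain ⟨U₀', hU₀', κ, _, ⟨T₀'⟩⟩ := isStokes_iff.1 hG (Circle.exp t₀)
  let v : ι → ℚ →₀ ℂ := fun i => (T₀.label i).1 ⟨t₀, hU₀⟩
  let w : κ → ℚ →₀ ℂ := fun i => (T₀'.label i).1 ⟨t₀, hU₀'⟩
  -- the finite set of all exponents which occur, and an interval containing all arcs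
  let S : Finset ℚ := (Finset.univ.biUnion fun i => (v i).support) ∪
    Finset.univ.biUnion fun i => (w i).support
  have hv : ∀ i q, v i q ≠ 0 → q ∈ S := fun i q h => Finset.mem_union_left _
    (Finset.mem_biUnion.2 ⟨i, Finset.mem_univ i, Finsupp.mem_support_iff.2 h⟩)
  have hw : ∀ i q, w i q ≠ 0 → q ∈ S := fun i q h => Finset.mem_union_right _
    (Finset.mem_biUnion.2 ⟨i, Finset.mem_univ i, Finsupp.mem_support_iff.2 h⟩)
  have hS : ∀ q ∈ S, 0 < q := by
    intro q hq
    rcases Finset.mem_union.1 hq with h | h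
    · obtain ⟨i, -, hi⟩ := Finset.mem_biUnion.1 h
      exact ((T₀.label i).2.2.1 _ q (Finsupp.mem_support_iff.1 hi)).1
    · obtain ⟨i, -, hi⟩ := Finset.mem_biUnion.1 h
      exact ((T₀'.label i).2.2.1 _ q (Finsupp.mem_support_iff.1 hi)).1
  let R : ℝ := ∑ q ∈ S, Real.pi / (2 * q)
  have hSR : ∀ q ∈ S, (0 : ℝ) ≤ Real.pi / (2 * q) := by
    intro q hq
    have : (0 : ℝ) < q := by exact_mod_cast hS q hq
    have := Real.pi_pos
    positivity
  have hR : 0 ≤ R := Finset.sum_nonneg hSR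
  obtain ⟨Q, hQ⟩ : ∃ Q, ∀ q ∈ S, q < Q := by
    obtain ⟨M, hM⟩ := S.exists_le
    exact ⟨M + 1, fun q hq => lt_of_le_of_lt (hM q hq) (by linarith)⟩
  have hnear : ∀ a b : ℚ →₀ ℂ, (∀ q, a q ≠ 0 → q ∈ S) → (∀ q, b q ≠ 0 → q ∈ S) → Near Q a b := by
    intro a b ha hb p hp
    have hpS : p ∉ S := fun h => absurd (hQ p h) (not_lt.2 hp)
    rw [not_not.1 (mt (ha p) hpS), not_not.1 (mt (hb p) hpS)]
  obtain ⟨τ, hτ, ⟨N, hN⟩, hfr⟩ := exists_frames_along (v := v) (w := w)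
    (fun t => HasFrameAt.of_exists hF ⟨U₀, hU₀, T₀, fun _ => rfl⟩ t)
    (fun t => HasFrameAt.of_exists hG ⟨U₀', hU₀', T₀', fun _ => rfl⟩ t)
    (show t₀ - R ≤ t₀ + R by linarith)
  choose U U' T T' hs hs' hvT hwT' using hfr
  have hl : ∀ n, τ n ∈ Set.Icc (τ n) (τ (n + 1)) := fun n => ⟨le_rfl, hτ (Nat.le_succ n)⟩
  have hr : ∀ n, τ (n + 1) ∈ Set.Icc (τ n) (τ (n + 1)) := fun n => ⟨hτ (Nat.le_succ n), le_rfl⟩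
  obtain ⟨n₀, hn₀, ht₀⟩ := hN t₀ ⟨by linarith, by linarith⟩
  have hcov : ∀ q ∈ S, ∀ s ∈ arc t₀ q, ∃ n ≤ N, s ∈ Set.Icc (τ n) (τ (n + 1)) := by
    intro q hq s hs
    have h1 : Real.pi / (2 * q) ≤ R :=
      Finset.single_le_sum (f := fun q : ℚ => Real.pi / (2 * (q : ℝ))) hSR hq
    exact hN s ⟨by linarith [hs.1], by linarith [hs.2]⟩
  obtain ⟨m, m', hm, hm', hdiag⟩ := exists_diagonalization S hS hv hw hτ hn₀ ht₀ hcov Q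
    (fun n => (T n).transition (T (n + 1)) (hs n _ (hr n)) (hs (n + 1) _ (hl (n + 1))))
    (fun n => (T' n).transition (T' (n + 1)) (hs' n _ (hr n)) (hs' (n + 1) _ (hl (n + 1))))
    (fun n => by
      let x : Lift (U n ⊓ U (n + 1)) := ⟨τ (n + 1), hs n _ (hr n), hs (n + 1) _ (hl (n + 1))⟩
      refine ⟨fun i j hij => ⟨?_, hnear _ _ (hv i) (hv j)⟩,
        fun i j hij => ⟨?_, hnear _ _ (hv i) (hv j)⟩⟩
      · have := Frame.mat_le (𝟙 F) (T (n + 1)) (T n) inf_le_right inf_le_left x i j hij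
        rwa [← hvT n _ (hr n) i, ← hvT (n + 1) _ (hl (n + 1)) j]
      · have := Frame.mat_le (𝟙 F) (T n) (T (n + 1)) inf_le_left inf_le_right x i j hij
        rwa [← hvT (n + 1) _ (hl (n + 1)) i, ← hvT n _ (hr n) j])
    (fun n => by
      let x : Lift (U' n ⊓ U' (n + 1)) := ⟨τ (n + 1), hs' n _ (hr n), hs' (n + 1) _ (hl (n + 1))⟩
      refine ⟨fun i j hij => ⟨?_, hnear _ _ (hw i) (hw j)⟩,
        fun i j hij => ⟨?_, hnear _ _ (hw i) (hw j)⟩⟩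
      · have := Frame.mat_le (𝟙 G) (T' (n + 1)) (T' n) inf_le_right inf_le_left x i j hij
        rwa [← hwT' n _ (hr n) i, ← hwT' (n + 1) _ (hl (n + 1)) j]
      · have := Frame.mat_le (𝟙 G) (T' n) (T' (n + 1)) inf_le_left inf_le_right x i j hij
        rwa [← hwT' (n + 1) _ (hl (n + 1)) i, ← hwT' n _ (hr n) j])
  -- the new frames on a small arc
  have hy := hs n₀ t₀ ht₀
  have hy' := hs' n₀ t₀ ht₀
  have hvt := hvT n₀ t₀ ht₀
  have hwt := hwT' n₀ t₀ ht₀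
  obtain ⟨ε, hε, hball, harc⟩ := exists_ball_le (U := U n₀ ⊓ U' n₀) (t := t₀) ⟨hy, hy'⟩
    ((Frame.eventually_triangular (T n₀) hy m (fun i j h => by rw [hvt, hvt]; exact (hm.1 i j h).1)
      (fun i j h => by rw [hvt, hvt]; exact (hm.2 i j h).1)).and
    (Frame.eventually_triangular (T' n₀) hy' m' (fun i j h => by rw [hwt, hwt]; exact (hm'.1 i j h).1)
      (fun i j h => by rw [hwt, hwt]; exact (hm'.2 i j h).1)))
  have hbU : ball t₀ ε ≤ U n₀ := hball.trans inf_le_left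
  have hbU' : ball t₀ ε ≤ U' n₀ := hball.trans inf_le_right
  have hc : ∀ g : GL ι k, (g : Matrix ι ι k) * ((g⁻¹ : GL ι k) : Matrix ι ι k) = 1 := fun g => by
    rw [← Units.val_mul, mul_inv_cancel, Units.val_one]
  have hc' : ∀ g : GL κ k, (g : Matrix κ κ k) * ((g⁻¹ : GL κ k) : Matrix κ κ k) = 1 := fun g => by
    rw [← Units.val_mul, mul_inv_cancel, Units.val_one]
  let T₁ := ((T n₀).restrict hbU).changeBasis (m : Matrix ι ι k) ((m⁻¹ : GL ι k) : Matrix ι ι k)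
    (hc m) (by simp) ((T n₀).restrict hbU).label
    (fun i j hij => Index.le_of_forall_Ioo _ _ hbU fun s hs =>
      ((harc s hs).1 (hbU ⟨s, hs, rfl⟩)).2.1 i j hij)
    (fun i j hij => Index.le_of_forall_Ioo _ _ hbU fun s hs =>
      ((harc s hs).1 (hbU ⟨s, hs, rfl⟩)).2.2 i j hij)
  let T₁' := ((T' n₀).restrict hbU').changeBasis (m' : Matrix κ κ k)
    ((m'⁻¹ : GL κ k) : Matrix κ κ k)
    (hc' m') (by simp) ((T' n₀).restrict hbU').label
    (fun i j hij => Index.le_of_forall_Ioo _ _ hbU' fun s hs =>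
      ((harc s hs).2 (hbU' ⟨s, hs, rfl⟩)).2.1 i j hij)
    (fun i j hij => Index.le_of_forall_Ioo _ _ hbU' fun s hs =>
      ((harc s hs).2 (hbU' ⟨s, hs, rfl⟩)).2.2 i j hij)
  have hyb : Circle.exp t₀ ∈ ball t₀ ε := mem_ball hε
  refine ⟨ball t₀ ε, hyb, isPreconnected_ball t₀ ε, ι, κ, inferInstance, inferInstance,
    inferInstance, inferInstance, T₁, T₁', fun f z hz i j hij => ?_⟩
  rw [Frame.mat_eq_of_isPreconnected f.hom T₁ T₁' le_rfl le_rfl (isPreconnected_ball t₀ ε) hz hyb]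
    at hij
  have hmat : Frame.mat f.hom T₁ T₁' hyb hyb = ((m'⁻¹ : GL κ k) : Matrix κ κ k) *
      Frame.mat f.hom (T n₀) (T' n₀) hy hy' * (m : Matrix ι ι k) := by
    rw [← Frame.mat_restrict f.hom (T n₀) (T' n₀) hbU hbU' hyb hyb]
    exact Frame.mat_changeBasis _ _ _ _ _ _ _ _ _ _ _ _ _ _ _ _ _ _ _
  have hD := hdiag (fun n => Frame.mat f.hom (T n) (T' n) (hs n _ (hl n)) (hs' n _ (hl n)))
    (fun n s hsn i j hij => by
      refine ⟨?_, hnear _ _ (hw i) (hv j)⟩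
      rw [Frame.mat_eq_of_Icc f.hom (T n) (T' n) (hs n) (hs' n) (hl n) hsn] at hij
      have := Frame.mat_le f (T n) (T' n) (W := U n ⊓ U' n) inf_le_left inf_le_right
        ⟨s, hs n s hsn, hs' n s hsn⟩ i j hij
      rwa [← hvT n s hsn j, ← hwT' n s hsn i])
    (fun n => by
      rw [Frame.mat_eq_of_Icc f.hom (T n) (T' n) (hs n) (hs' n) (hl n) (hr n)]
      have h1 := Frame.mat_comp f.hom (𝟙 G.sheaf) (T (n + 1)) (T' (n + 1)) (T' n)
        (hs (n + 1) _ (hl (n + 1))) (hs' (n + 1) _ (hl (n + 1))) (hs' n _ (hr n))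
      have h2 := Frame.mat_comp (𝟙 F.sheaf) f.hom (T (n + 1)) (T n) (T' n)
        (hs (n + 1) _ (hl (n + 1))) (hs n _ (hr n)) (hs' n _ (hr n))
      rw [Category.comp_id] at h1
      rw [Category.id_comp] at h2
      exact h1.symm.trans h2)
  have h2 : w i = v j := by
    refine hD i j ?_
    rwa [Frame.mat_eq_of_Icc f.hom (T n₀) (T' n₀) (hs n₀) (hs' n₀) (hl n₀) ht₀, ← hmat]
  change Index.res hbU' ((T' n₀).label i) = Index.res hbU ((T n₀).label j)
  refine Subtype.ext (funext fun ⟨r, s, hsI, hsr⟩ => ?_)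
  have hsb : Circle.exp s ∈ ball t₀ ε := ⟨s, hsI, rfl⟩
  refine eq_of_exp_eq (Index.res hbU' ((T' n₀).label i)) (Index.res hbU ((T n₀).label j))
    ⟨s, hsb⟩ ⟨r, s, hsI, hsr⟩ hsr ?_
  have h3 := ((harc s hsI).2 (hbU' hsb)).1 i
  have h4 := ((harc s hsI).1 (hbU hsb)).1 j
  rw [hwt] at h3
  rw [hvt] at h4
  exact h3.trans (h2.trans h4.symm)

end Diagonal

end PreStokes

/-! ### Normal form of block diagonal matrices -/

section NormalForm

variable {k : Type u} [Field k] {L : Type*} {ι κ : Type}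

/-- The vector `x` has nonzero coordinates only at places of a single label. -/
def Homogeneous (v : ι → L) (x : ι → k) : Prop := ∃ p, ∀ i, x i ≠ 0 → v i = p

lemma homogeneous_single [DecidableEq ι] (v : ι → L) (i : ι) (a : k) : Homogeneous v (Pi.single i a) := by
  refine ⟨v i, fun j hj => ?_⟩
  by_cases hij : j = i
  · rw [hij]
  · simp [hij] at hj

lemma span_homogeneous [Fintype ι] (v : ι → L) :
    Submodule.span k {x : ι → k | Homogeneous v x} = ⊤ := by
  classical
  rw [eq_top_iff]
  intro x _
  rw [← Finset.univ_sum_single x]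
  exact Submodule.sum_mem _ fun i _ => Submodule.subset_span (homogeneous_single v i _)

/-- A linearly independent family of homogeneous vectors extends to a homogeneous basis. -/
lemma exists_homogeneous_basis [Fintype ι] (v : ι → L) {α : Type} [Finite α] {x : α → ι → k}
    (hx : LinearIndependent k x) (hx' : ∀ a, Homogeneous v (x a)) :
    ∃ (n : ℕ) (B : Module.Basis (α ⊕ Fin n) k (ι → k)),
      (∀ a, B (Sum.inl a) = x a) ∧ ∀ c, Homogeneous v (B c) := by
  classical
  obtain ⟨b, hb, hxb, hspan, hli⟩ := exists_linearIndepOn_id_extension (K := k)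
    (s := Set.range x) (t := {x : ι → k | Homogeneous v x}) hx.linearIndepOn_id
    (by rintro _ ⟨a, rfl⟩; exact hx' a)
  have hfin : Finite b := hli.finite
  obtain ⟨n, ⟨σ⟩⟩ := Finite.exists_equiv_fin (b \ Set.range x : Set (ι → k))
  let τ : α ⊕ Fin n ≃ b := ((Equiv.ofInjective x hx.injective).sumCongr σ.symm).trans
    (Equiv.Set.sumDiffSubset hxb)
  let B₀ : Module.Basis b k (ι → k) := Module.Basis.mk hli (by
    rw [show Set.range (fun x : b => id x.1) = b from Subtype.range_coe, ← span_homogeneous v, Submodule.span_le]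
    exact hspan)
  have hB₀ : ∀ c, B₀ c = c.1 := fun c => Module.Basis.mk_apply _ _ _
  refine ⟨n, B₀.reindex τ.symm, fun a => ?_, fun c => ?_⟩
  · rw [Module.Basis.reindex_apply, hB₀]
    rfl
  · rw [Module.Basis.reindex_apply, hB₀]
    exact hb (τ.symm.symm c).2

lemma Homogeneous.mulVec [Fintype ι] {v : ι → L} {w : κ → L} {A : Matrix κ ι k} (hA : Supp (· = ·) w v A)
    {x : ι → k} {p : L} (hx : ∀ i, x i ≠ 0 → v i = p) (j : κ) (hj : A.mulVec x j ≠ 0) :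
    w j = p := by
  obtain ⟨i, -, hi⟩ := Finset.exists_ne_zero_of_sum_ne_zero hj
  rw [hA j i (left_ne_zero_of_mul hi), hx i (right_ne_zero_of_mul hi)]

/-- The kernel of a block diagonal matrix has a basis of homogeneous vectors. -/
lemma exists_homogeneous_basis_ker [Fintype ι] {v : ι → L} {w : κ → L} (A : Matrix κ ι k)
    (hA : Supp (· = ·) w v A) :
    ∃ (n : ℕ) (x : Fin n → ι → k), LinearIndependent k x ∧ (∀ a, Homogeneous v (x a)) ∧
      Submodule.span k (Set.range x) = LinearMap.ker A.mulVecLin := by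
  classical
  obtain ⟨b, hb, -, hspan, hli⟩ := exists_linearIndepOn_id_extension (K := k) (s := ∅)
    (t := {x : ι → k | Homogeneous v x ∧ A.mulVec x = 0}) (linearIndepOn_empty k id)
    (Set.empty_subset _)
  have hfin : Finite b := hli.finite
  obtain ⟨n, ⟨σ⟩⟩ := Finite.exists_equiv_fin b
  refine ⟨n, fun a => (σ.symm a).1, hli.comp _ σ.symm.injective, fun a => (hb (σ.symm a).2).1, ?_⟩
  have hrange : Set.range (fun a => (σ.symm a).1) = b := by
    ext y
    constructor
    · rintro ⟨a, rfl⟩; exact (σ.symm a).2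
    · intro hy; exact ⟨σ ⟨y, hy⟩, by simp⟩
  rw [hrange]
  apply le_antisymm
  · rw [Submodule.span_le]
    intro y hy
    exact (hb hy).2
  · intro y hy
    have hy' : A.mulVec y = 0 := hy
    have hsum : y = ∑ p ∈ Finset.univ.image v, fun i => if v i = p then y i else 0 := by
      ext i
      rw [Finset.sum_apply, Finset.sum_ite_eq]
      simp
    rw [hsum]
    refine Submodule.sum_mem _ fun p _ => hspan ⟨⟨p, fun i hi => ?_⟩, ?_⟩
    · by_contra h
      simp [h] at hi
    · ext j
      have h1 : A.mulVec (fun i => if v i = p then y i else 0) j =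
          if w j = p then A.mulVec y j else 0 := by
        simp only [Matrix.mulVec, dotProduct]
        split_ifs with hj
        · refine Finset.sum_congr rfl fun i _ => ?_
          by_cases hji : A j i = 0
          · simp [hji]
          · simp [← hA j i hji, hj]
        · refine Finset.sum_eq_zero fun i _ => ?_
          by_cases hji : A j i = 0
          · simp [hji]
          · simp [← hA j i hji, hj]
      rw [h1, hy']
      simp

/-- A homogeneous basis gives a block diagonal invertible matrix. -/
lemma exists_inverse_of_basis [Fintype ι] [DecidableEq ι] {v : ι → L} {μ : Type} [Fintype μ] [DecidableEq μ]
    (B : Module.Basis μ k (ι → k)) {label : μ → L} (hB : ∀ c i, B c i ≠ 0 → v i = label c) :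
    ∃ (m : Matrix ι μ k) (m' : Matrix μ ι k), m * m' = 1 ∧ m' * m = 1 ∧
      Supp (· = ·) v label m ∧ Supp (· = ·) label v m' ∧ ∀ i c, m i c = B c i := by
  have h1 : ∀ i c, (Pi.basisFun k ι).toMatrix B i c = B c i := fun i c => by
    rw [Module.Basis.toMatrix_apply, Pi.basisFun_repr]
  have hm : Supp (· = ·) v label ((Pi.basisFun k ι).toMatrix B) := fun i c h =>
    hB c i (by rwa [h1] at h)
  have e1 : (Pi.basisFun k ι).toMatrix B * B.toMatrix (Pi.basisFun k ι) = 1 :=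
    Module.Basis.toMatrix_mul_toMatrix_flip _ _
  have e2 : B.toMatrix (Pi.basisFun k ι) * (Pi.basisFun k ι).toMatrix B = 1 :=
    Module.Basis.toMatrix_mul_toMatrix_flip _ _
  refine ⟨_, _, e1, e2, hm, ?_, h1⟩
  -- the block diagonal part of the inverse is another left inverse
  have e3 : part (· = ·) label v (B.toMatrix (Pi.basisFun k ι)) *
      (Pi.basisFun k ι).toMatrix B = 1 := by
    rw [← e2]
    ext c d
    rw [Matrix.mul_apply, Matrix.mul_apply]
    by_cases hcd : label c = label d
    · refine Finset.sum_congr rfl fun i _ => ?_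
      by_cases hi : (Pi.basisFun k ι).toMatrix B i d = 0
      · rw [hi, mul_zero, mul_zero]
      · rw [part_apply_of (hcd.trans (hm i d hi).symm)]
    · have h2 : (B.toMatrix (Pi.basisFun k ι) * (Pi.basisFun k ι).toMatrix B) c d = 0 := by
        rw [e2, Matrix.one_apply_ne fun h => hcd (by rw [h])]
      rw [Matrix.mul_apply] at h2
      rw [h2]
      refine Finset.sum_eq_zero fun i _ => ?_
      by_cases hi : (Pi.basisFun k ι).toMatrix B i d = 0
      · rw [hi, mul_zero]
      · rw [part_apply_of_not (fun h => hcd (h.trans (hm i d hi))), zero_mul]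
  have e4 : B.toMatrix (Pi.basisFun k ι) =
      part (· = ·) label v (B.toMatrix (Pi.basisFun k ι)) := by
    rw [← Matrix.mul_one (part _ _ _ _), ← e1, ← Matrix.mul_assoc, e3, Matrix.one_mul]
  rw [e4]
  exact supp_part _

/-- A block diagonal matrix becomes a partial identity matrix in homogeneous bases. -/
lemma exists_normal_form [Fintype ι] [DecidableEq ι] [Fintype κ] [DecidableEq κ] {v : ι → L} {w : κ → L} (A : Matrix κ ι k)
    (hA : Supp (· = ·) w v A) :
    ∃ (a b c : ℕ) (label : Fin a ⊕ Fin b → L) (label' : Fin a ⊕ Fin c → L)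
      (m : Matrix ι (Fin a ⊕ Fin b) k) (m' : Matrix (Fin a ⊕ Fin b) ι k)
      (n : Matrix κ (Fin a ⊕ Fin c) k) (n' : Matrix (Fin a ⊕ Fin c) κ k),
      m * m' = 1 ∧ m' * m = 1 ∧ Supp (· = ·) v label m ∧ Supp (· = ·) label v m' ∧
      n * n' = 1 ∧ n' * n = 1 ∧ Supp (· = ·) w label' n ∧ Supp (· = ·) label' w n' ∧
      (∀ i, label' (Sum.inl i) = label (Sum.inl i)) ∧
      n' * A * m = Matrix.fromBlocks 1 0 0 0 := by
  obtain ⟨b, x, hx, hx', hxker⟩ := exists_homogeneous_basis_ker A hA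
  obtain ⟨a, B₀, hB₀, hB₀'⟩ := exists_homogeneous_basis v hx hx'
  let B := B₀.reindex (Equiv.sumComm (Fin b) (Fin a))
  have hBinr : ∀ i, B (Sum.inr i) = x i := fun i => by
    rw [Module.Basis.reindex_apply]; exact hB₀ i
  have hBh : ∀ c, Homogeneous v (B c) := fun c => by
    rw [Module.Basis.reindex_apply]; exact hB₀' _
  have hABinr : ∀ i, A.mulVec (B (Sum.inr i)) = 0 := by
    intro i
    have : x i ∈ LinearMap.ker A.mulVecLin := by
      rw [← hxker]; exact Submodule.subset_span ⟨i, rfl⟩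
    rw [hBinr]
    exact this
  have hli : LinearIndependent k fun i => A.mulVec (B (Sum.inl i)) := by
    obtain ⟨h1, -, h3⟩ := linearIndependent_sum.1 B.linearIndependent
    refine h1.map (f := A.mulVecLin) ?_
    have h4 : (B ∘ Sum.inr) = x := funext hBinr
    rw [← hxker, ← h4]
    exact h3
  choose label hlabel using hBh
  obtain ⟨c, C, hC, hC'⟩ := exists_homogeneous_basis w hli fun i =>
    ⟨label (Sum.inl i), Homogeneous.mulVec hA (hlabel (Sum.inl i))⟩
  choose label₀ hlabel₀ using hC'
  obtain ⟨m, m', h1, h2, h3, h4, h5⟩ := exists_inverse_of_basis B hlabel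
  obtain ⟨n, n', h1', h2', h3', h4', h5'⟩ := exists_inverse_of_basis C
    (label := Sum.elim (fun i => label (Sum.inl i)) fun i => label₀ (Sum.inr i)) (by
      rintro (i | i) j hj
      · rw [hC] at hj
        exact Homogeneous.mulVec hA (hlabel (Sum.inl i)) j hj
      · exact hlabel₀ _ j hj)
  refine ⟨a, b, c, label, _, m, m', n, n', h1, h2, h3, h4, h1', h2', h3', h4', fun _ => rfl, ?_⟩
  have key : A * m =
      n * (Matrix.fromBlocks 1 0 0 0 : Matrix (Fin a ⊕ Fin c) (Fin a ⊕ Fin b) k) := by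
    ext j d
    have e1 : (A * m) j d = A.mulVec (B d) j := by
      rw [Matrix.mul_apply]
      simp only [h5]
      rfl
    rw [e1]
    rcases d with d | d
    · rw [Matrix.mul_apply, Fintype.sum_sum_type]
      simp [Matrix.one_apply, h5', hC]
    · rw [hABinr, Matrix.mul_apply, Fintype.sum_sum_type]
      simp
  rw [Matrix.mul_assoc, key, ← Matrix.mul_assoc, h2', Matrix.one_mul]

end NormalForm

namespace PreStokes

variable {k : Type u} [Field k] {E : AddSubgroup ℚ}

/-! ### Normal frames of a morphism, and strictness -/

/-- Frames of the source and the target of a morphism, near a point, in which it is the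
projection to the first part of the basis followed by an inclusion, with equal labels. -/
structure NormalFrames {F G : PreStokes k E} (f : F ⟶ G) (U : Opens Circle) where
  /-- the rank of the morphism -/
  a : ℕ
  /-- the rank of the kernel -/
  b : ℕ
  /-- the rank of the cokernel -/
  c : ℕ
  /-- the frame of the source -/
  src : Frame F U (Fin a ⊕ Fin b)
  /-- the frame of the target -/
  tgt : Frame G U (Fin a ⊕ Fin c)
  label_eq : ∀ i, tgt.label (Sum.inl i) = src.label (Sum.inl i)
  mat_eq : ∀ (y : Circle) (hy : y ∈ U),
    Frame.mat f.hom src tgt hy hy = Matrix.fromBlocks 1 0 0 0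

theorem exists_normalFrames {F G : PreStokes k E} (f : F ⟶ G) (hF : F.IsStokes)
    (hG : G.IsStokes) (y : Circle) :
    ∃ U : Opens Circle, y ∈ U ∧ Nonempty (NormalFrames f U) := by
  obtain ⟨U, hy, hU, ι, κ, _, _, _, _, T, T', hT⟩ := exists_diagonal_frames hF hG y
  obtain ⟨a, b, c, label, label', m, m', n, n', h1, h2, h3, h4, h1', h2', h3', h4', hl, hA⟩ :=
    exists_normal_form (v := T.label) (w := T'.label) (Frame.mat f.hom T T' hy hy)
      fun i j hij => hT f y hy i j hij
  have hle : ∀ {φ ψ : Index E U}, φ = ψ → Index.Le φ ψ := fun h => h ▸ Index.Le.refl _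
  refine ⟨U, hy, ⟨⟨a, b, c, T.changeBasis m m' h1 h2 label (fun i j h => hle (h3 i j h))
    (fun i j h => hle (h4 i j h)), T'.changeBasis n n' h1' h2' label'
    (fun i j h => hle (h3' i j h)) (fun i j h => hle (h4' i j h)), hl, fun z hz => ?_⟩⟩⟩
  rw [Frame.mat_changeBasis, Frame.mat_eq_of_isPreconnected f.hom T T' le_rfl le_rfl hU hz hy, hA]

namespace NormalFrames

variable {F G : PreStokes k E} {f : F ⟶ G} {U : Opens Circle} (N : NormalFrames f U)
include N

lemma germ_inl {W : Opens Circle} (hW : W ≤ U) {y : Circle} (hy : y ∈ W) (s : Sec F.sheaf W)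
    (i : Fin N.a) :
    N.tgt.germ hW hy (onSec f.hom W s) (Sum.inl i) = N.src.germ hW hy s (Sum.inl i) := by
  rw [Frame.germ_onSec f.hom N.src N.tgt hW hW hy, N.mat_eq, Matrix.fromBlocks_mulVec]
  simp

lemma germ_inr {W : Opens Circle} (hW : W ≤ U) {y : Circle} (hy : y ∈ W) (s : Sec F.sheaf W)
    (i : Fin N.c) : N.tgt.germ hW hy (onSec f.hom W s) (Sum.inr i) = 0 := by
  rw [Frame.germ_onSec f.hom N.src N.tgt hW hW hy, N.mat_eq, Matrix.fromBlocks_mulVec]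
  simp

lemma onSec_e_inl (i : Fin N.a) :
    onSec f.hom U (N.src.e (Sum.inl i)) = N.tgt.e (Sum.inl i) := by
  refine N.tgt.ext_germ le_rfl fun y hy => ?_
  ext (j | j)
  · rw [N.germ_inl, Frame.germ_e, Frame.germ_e]
    simp [Pi.single_apply]
  · rw [N.germ_inr, Frame.germ_e]
    simp

lemma onSec_e_inr (i : Fin N.b) : onSec f.hom U (N.src.e (Sum.inr i)) = 0 := by
  refine N.tgt.ext_germ le_rfl fun y hy => ?_
  ext (j | j)
  · rw [N.germ_inl, Frame.germ_e, map_zero]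
    simp
  · rw [N.germ_inr, map_zero]
    rfl

end NormalFrames

/-- Strictness of the morphisms of Stokes-filtered local systems: in normal frames, the
components of a section of the image with respect to the target frame define a preimage, which
has the same labels. -/
theorem isStrict {F G : PreStokes k E} (f : F ⟶ G) (hF : F.IsStokes) (hG : G.IsStokes) :
    IsStrict f := by
  intro U φ t
  constructor
  · intro h
    refine ⟨G.le_local U φ t fun y hy => ?_, fun y hy => ?_⟩
    · obtain ⟨V, hV, hyV, s, hs, hst⟩ := h y hy
      exact ⟨V, hV, hyV, hst ▸ f.mem V _ s hs⟩
    · obtain ⟨V, hV, hyV, s, -, hst⟩ := h y hy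
      exact ⟨V, hV, hyV, s, hst⟩
  · rintro ⟨ht, h⟩ y hy
    obtain ⟨V, hV, hyV, s, hst⟩ := h y hy
    obtain ⟨U', hyU', ⟨N⟩⟩ := exists_normalFrames f hF hG y
    obtain ⟨W, hW, hyW, hs⟩ := N.src.exists_comb (W := V ⊓ U') inf_le_right ⟨hyV, hyU'⟩
      (res F.sheaf inf_le_left s)
    let a : Fin N.a ⊕ Fin N.b → k := N.src.germ (W := V ⊓ U') inf_le_right ⟨hyV, hyU'⟩
      (res F.sheaf inf_le_left s)
    have hWU' : W ≤ U' := hW.trans inf_le_right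
    have hWU : W ≤ U := (hW.trans inf_le_left).trans hV
    -- the components in the first part of the basis
    let a' : Fin N.a ⊕ Fin N.b → k := Sum.elim (fun i => a (Sum.inl i)) fun _ => 0
    have hcomb : onSec f.hom W (Frame.comb N.src.e hWU' a') = res G.sheaf hWU t := by
      have h1 : onSec f.hom W (Frame.comb N.src.e hWU' a) = res G.sheaf hWU t := by
        rw [← hs, res_res, onSec_res, hst, res_res]
      rw [← h1]
      refine N.tgt.ext_germ hWU' fun z hz => ?_
      ext (i | i)
      · rw [N.germ_inl, N.germ_inl, Frame.germ_comb, Frame.germ_comb]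
        rfl
      · rw [N.germ_inr, N.germ_inr]
    refine ⟨W, hWU, hyW, _, ?_, hcomb⟩
    have ht' := G.le_res hWU φ t ht
    rw [← hcomb, N.tgt.mem_le_iff_germ hWU'] at ht'
    rw [N.src.mem_le_iff_germ hWU']
    rintro (i | i) x hx
    · have := ht' (Sum.inl i) x (by rwa [N.germ_inl])
      rwa [N.label_eq] at this
    · rw [Frame.germ_comb] at hx
      exact absurd rfl hx

/-! ### Subsheaves and quotients spanned by parts of a frame -/

section SubQuotient

variable {F : PreStokes k E} {U : Opens Circle} {ι β : Type}

lemma Frame.comb_comp [Fintype ι] [Fintype β] {σ : β → ι} (hσ : Function.Injective σ) (e : ι → Sec F.sheaf U)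
    {V : Opens Circle} (hV : V ≤ U) (a : β → k) :
    Frame.comb (fun b => e (σ b)) hV a = Frame.comb e hV (Function.extend σ a 0) := by
  rw [Frame.comb_apply, Frame.comb_apply]
  rw [← Finset.sum_subset (Finset.subset_univ (Finset.univ.map ⟨σ, hσ⟩))]
  · simp [hσ.extend_apply]
  · intro i _ hi
    rw [Function.extend_apply' _ _ _ fun ⟨b, hb⟩ => hi (by simp [← hb])]
    simp

variable [Fintype ι] [DecidableEq ι] [Fintype β]

/-- A subsheaf spanned by a part of a frame of a filtered sheaf has a frame, for the
induced filtration. -/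
lemma Frame.exists_sub (T : Frame F U ι) {K : PreStokes k E} (i : K.sheaf ⟶ F.sheaf)
    (hi : ∀ W, Function.Injective (onSec i W))
    (hle : ∀ W φ s, s ∈ K.le W φ ↔ onSec i W s ∈ F.le W φ) {σ : β → ι} (hσ : Function.Injective σ)
    (x : β → Sec K.sheaf U) (hx : ∀ b, onSec i U (x b) = T.e (σ b))
    (hs : ∀ (W : Opens Circle) (hW : W ≤ U) (s : Sec K.sheaf W) (y : Circle) (hy : y ∈ W) (j : ι),
      j ∉ Set.range σ → T.germ hW hy (onSec i W s) j = 0) :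
    ∃ T' : Frame K U β, T'.label = T.label ∘ σ := by
  have hcomb : ∀ (V : Opens Circle) (hV : V ≤ U) (a : β → k),
      onSec i V (Frame.comb x hV a) = Frame.comb T.e hV (Function.extend σ a 0) := by
    intro V hV a
    rw [← Frame.comb_comp hσ, Frame.comb_apply, Frame.comb_apply, map_sum]
    refine Finset.sum_congr rfl fun b _ => ?_
    rw [map_smul, ← hx, ← onSec_res]
  refine (Frame.exists_of_sections x (T.label ∘ σ) ?_ ?_ ?_ ?_).imp fun _ h => h.1
  · intro W hW s y hy
    obtain ⟨V, hV, hyV, h⟩ := T.exists_comb hW hy (onSec i W s)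
    refine ⟨V, hV, hyV, fun b => T.germ hW hy (onSec i W s) (σ b), hi V ?_⟩
    rw [onSec_res, h, hcomb]
    congr 1
    ext j
    by_cases hj : j ∈ Set.range σ
    · obtain ⟨b, rfl⟩ := hj
      rw [hσ.extend_apply]
    · rw [hs W hW s y hy j hj, Function.extend_apply' _ _ _ hj]
      rfl
  · intro V hV y hy a ha
    have h1 := hcomb V hV a
    rw [ha, map_zero] at h1
    have h2 := T.germ_comb hV hy (Function.extend σ a 0)
    rw [← h1, map_zero] at h2
    ext b
    rw [← hσ.extend_apply a 0 b, ← h2]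
    rfl
  · intro b
    rw [hle, hx]
    exact T.e_mem _
  · intro V hV φ a ha b hb t
    rw [hle, hcomb, T.mem_le_iff_germ hV] at ha
    refine ha (σ b) t ?_
    rwa [Frame.germ_comb, hσ.extend_apply]

/-- A quotient sheaf by the subsheaf spanned by a part of a frame of a filtered sheaf has a
frame, for the quotient filtration. -/
lemma Frame.exists_quotient (T : Frame F U ι) {Q : PreStokes k E} (p : F.sheaf ⟶ Q.sheaf)
    (hp : ∀ (W : Opens Circle) (t : Sec Q.sheaf W) (y : Circle), y ∈ W →
      ∃ (V : Opens Circle) (h : V ≤ W), y ∈ V ∧ ∃ s, onSec p V s = res Q.sheaf h t)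
    (hle : ∀ W φ t, t ∈ Q.le W φ ↔ F.MemMapLe p W φ t)
    {σ : β → ι} (hσ : Function.Injective σ)
    (he : ∀ j, j ∉ Set.range σ → onSec p U (T.e j) = 0)
    (hs : ∀ (W : Opens Circle) (hW : W ≤ U) (s : Sec F.sheaf W), onSec p W s = 0 →
      ∀ (y : Circle) (hy : y ∈ W) (b : β), T.germ hW hy s (σ b) = 0) :
    ∃ T' : Frame Q U β, T'.label = T.label ∘ σ := by
  have hcomb : ∀ (V : Opens Circle) (hV : V ≤ U) (a : ι → k),
      onSec p V (Frame.comb T.e hV a) =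
        Frame.comb (fun b => onSec p U (T.e (σ b))) hV (a ∘ σ) := by
    intro V hV a
    rw [Frame.comb_apply, Frame.comb_apply, map_sum,
      ← Finset.sum_subset (Finset.subset_univ (Finset.univ.map ⟨σ, hσ⟩))]
    · rw [Finset.sum_map]
      refine Finset.sum_congr rfl fun b _ => ?_
      rw [map_smul, onSec_res]
      rfl
    · intro i _ hi
      rw [map_smul, onSec_res, he i fun ⟨b, hb⟩ => hi (by simp [← hb]), map_zero, smul_zero]
  have hext : ∀ a : β → k, Function.extend σ a 0 ∘ σ = a := fun a =>
    funext fun b => hσ.extend_apply a 0 b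
  refine (Frame.exists_of_sections (F := Q)
    (fun b => onSec p U (T.e (σ b))) (T.label ∘ σ) ?_ ?_ ?_ ?_).imp fun _ h => h.1
  · intro W hW t y hy
    obtain ⟨V, hV, hyV, s, hst⟩ := hp W t y hy
    obtain ⟨V', hV', hyV', h⟩ := T.exists_comb (hV.trans hW) hyV s
    refine ⟨V', hV'.trans hV, hyV', T.germ (hV.trans hW) hyV s ∘ σ, ?_⟩
    rw [← hcomb, ← h, onSec_res, hst, res_res]
  · intro V hV y hy a ha
    have h1 := hcomb V hV (Function.extend σ a 0)
    rw [hext, ha] at h1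
    ext b
    have := hs V hV _ h1 y hy b
    rwa [Frame.germ_comb, hσ.extend_apply] at this
  · intro b
    rw [hle]
    intro y hy
    refine ⟨U, le_rfl, hy, T.e (σ b), T.e_mem _, ?_⟩
    rw [res_self]
  · intro V hV φ a ha b hb t
    obtain ⟨V', hV', hyV', s, hs', hst⟩ := (hle _ _ _).1 ha _ t.2
    have hV'U := hV'.trans hV
    have h1 : onSec p V' (s - Frame.comb T.e hV'U (Function.extend σ a 0)) = 0 := by
      rw [map_sub, hst, hcomb, hext, sub_eq_zero]
      exact Frame.res_comb _ hV hV' a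
    have h2 := hs V' hV'U _ h1 _ hyV' b
    rw [map_sub, Pi.sub_apply, sub_eq_zero, Frame.germ_comb, hσ.extend_apply] at h2
    rw [T.mem_le_iff_germ hV'U] at hs'
    exact hs' (σ b) ⟨t.1, hyV'⟩ (by rwa [h2])

end SubQuotient

namespace NormalFrames

variable {F G : PreStokes k E} {f : F ⟶ G} {U : Opens Circle} (N : NormalFrames f U)
include N

lemma germ_eq_zero_of_onSec_eq_zero {W : Opens Circle} (hW : W ≤ U) {y : Circle} (hy : y ∈ W)
    {s : Sec F.sheaf W} (hs : onSec f.hom W s = 0) (i : Fin N.a) :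
    N.src.germ hW hy s (Sum.inl i) = 0 := by
  rw [← N.germ_inl, hs, map_zero]
  rfl

/-- The coordinates in the complement of the image vanish on sections which are locally in the
image. -/
lemma germ_inr_of_image {W : Opens Circle} (hW : W ≤ U) {y : Circle} (hy : y ∈ W)
    (s : Sec (Abelian.image f.hom) W) (i : Fin N.c) :
    N.tgt.germ hW hy (onSec (Abelian.image.ι f.hom) W s) (Sum.inr i) = 0 := by
  obtain ⟨V, hV, hyV, s', hs'⟩ := exists_local_lift (Abelian.factorThruImage f.hom) s hy
  have h1 := congrArg (onSec (Abelian.image.ι f.hom) V) hs'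
  rw [← onSec_comp, Abelian.image.fac, onSec_res] at h1
  rw [← N.tgt.germ_res (hVU := hV.trans hW) hW hV hyV, ← h1, N.germ_inr]

lemma exists_frame_ker : ∃ T : Frame (ker f) U (Fin N.b), T.label = N.src.label ∘ Sum.inr := by
  choose x hx using fun b => exists_kernel_lift f.hom _ (N.onSec_e_inr b)
  have hι : ∀ W (s : Sec (Limits.kernel f.hom) W),
      onSec f.hom W (onSec (Limits.kernel.ι f.hom) W s) = 0 := fun W s => by
    rw [← onSec_comp, Limits.kernel.condition, onSec_zero]
  have hinj := fun W => onSec_injective_of_mono (Limits.kernel.ι f.hom) W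
  refine N.src.exists_sub (K := ker f) (Limits.kernel.ι f.hom) hinj
    (fun _ _ _ => Iff.rfl) Sum.inr_injective x hx ?_
  rintro W hW s y hy (j | j) hj
  · exact N.germ_eq_zero_of_onSec_eq_zero hW hy (hι W s) j
  · exact absurd ⟨j, rfl⟩ hj

lemma exists_frame_im : ∃ T : Frame (im f) U (Fin N.a), T.label = N.tgt.label ∘ Sum.inl := by
  have hinj := fun W => onSec_injective_of_mono (Abelian.image.ι f.hom) W
  have hfac : ∀ i, onSec (Abelian.image.ι f.hom) U
      (onSec (Abelian.factorThruImage f.hom) U (N.src.e (Sum.inl i))) = N.tgt.e (Sum.inl i) :=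
    fun i => by rw [← onSec_comp, Abelian.image.fac, N.onSec_e_inl]
  refine N.tgt.exists_sub (K := im f) (Abelian.image.ι f.hom) hinj
    (fun _ _ _ => Iff.rfl) Sum.inl_injective _ hfac ?_
  rintro W hW s y hy (j | j) hj
  · exact absurd ⟨j, rfl⟩ hj
  · exact N.germ_inr_of_image hW hy s j

lemma exists_frame_coim : ∃ T : Frame (coim f) U (Fin N.a), T.label = N.src.label ∘ Sum.inl := by
  have hfac : ∀ W s, onSec (Abelian.image.ι f.hom) W (onSec (Abelian.factorThruImage f.hom) W s) =
      onSec f.hom W s := fun W s => by rw [← onSec_comp, Abelian.image.fac]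
  have hzero : ∀ W s, onSec (Abelian.factorThruImage f.hom) W s = 0 ↔ onSec f.hom W s = 0 := by
    intro W s
    rw [← hfac, map_eq_zero_iff _ (onSec_injective_of_mono (Abelian.image.ι f.hom) W)]
  have hlift := fun W (t : Sec (Abelian.image f.hom) W) y (hy : y ∈ W) =>
    exists_local_lift (Abelian.factorThruImage f.hom) t hy
  refine N.src.exists_quotient (Q := coim f) (Abelian.factorThruImage f.hom) hlift
    (fun _ _ _ => Iff.rfl) Sum.inl_injective ?_ fun W hW s hs y hy b =>
      N.germ_eq_zero_of_onSec_eq_zero hW hy ((hzero W s).1 hs) b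
  rintro (j | j) hj
  · exact absurd ⟨j, rfl⟩ hj
  · exact (hzero _ _).2 (N.onSec_e_inr j)

lemma exists_frame_coker :
    ∃ T : Frame (coker f) U (Fin N.c), T.label = N.tgt.label ∘ Sum.inr := by
  have hlift := fun W (t : Sec (Limits.cokernel f.hom) W) y (hy : y ∈ W) =>
    exists_local_lift (Limits.cokernel.π f.hom) t hy
  have hzero : ∀ i, onSec (Limits.cokernel.π f.hom) U (N.tgt.e (Sum.inl i)) = 0 := fun i => by
    rw [← N.onSec_e_inl, ← onSec_comp, Limits.cokernel.condition, onSec_zero]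
  refine N.tgt.exists_quotient (Q := coker f) (Limits.cokernel.π f.hom) hlift
    (fun _ _ _ => Iff.rfl) Sum.inr_injective ?_ ?_
  · rintro (j | j) hj
    · exact hzero j
    · exact absurd ⟨j, rfl⟩ hj
  · intro W hW s hs y hy b
    obtain ⟨s', rfl⟩ := exists_kernel_lift (Limits.cokernel.π f.hom) s hs
    exact N.germ_inr_of_image hW hy s' b

end NormalFrames

section IsStokes

variable {F G : PreStokes k E} (f : F ⟶ G) (hF : F.IsStokes) (hG : G.IsStokes)
include hF hG

theorem isStokes_ker : (ker f).IsStokes := isStokes_iff.2 fun y => by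
  obtain ⟨U, hy, ⟨N⟩⟩ := exists_normalFrames f hF hG y
  exact ⟨U, hy, _, inferInstance, ⟨N.exists_frame_ker.choose⟩⟩

theorem isStokes_im : (im f).IsStokes := isStokes_iff.2 fun y => by
  obtain ⟨U, hy, ⟨N⟩⟩ := exists_normalFrames f hF hG y
  exact ⟨U, hy, _, inferInstance, ⟨N.exists_frame_im.choose⟩⟩

theorem isStokes_coim : (coim f).IsStokes := isStokes_iff.2 fun y => by
  obtain ⟨U, hy, ⟨N⟩⟩ := exists_normalFrames f hF hG y
  exact ⟨U, hy, _, inferInstance, ⟨N.exists_frame_coim.choose⟩⟩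

theorem isStokes_coker : (coker f).IsStokes := isStokes_iff.2 fun y => by
  obtain ⟨U, hy, ⟨N⟩⟩ := exists_normalFrames f hF hG y
  exact ⟨U, hy, _, inferInstance, ⟨N.exists_frame_coker.choose⟩⟩

end IsStokes

/-! ### Extensions -/

/-- Stokes-filtered local systems are stable by extension: the bases of the subobject and lifts of
the bases of the quotient, adapted to the filtration, give bases of the extension. -/
theorem isStokes_of_isShortExact {A B C : PreStokes k E} {f : A ⟶ B} {g : B ⟶ C}
    (S : IsShortExact f g) (hA : A.IsStokes) (hC : C.IsStokes) : B.IsStokes := by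
  classical
  refine isStokes_iff.2 fun y => ?_
  obtain ⟨U₁, hy₁, ι, _, ⟨T₁⟩⟩ := isStokes_iff.1 hA y
  obtain ⟨U₂, hy₂, κ, _, ⟨T₂⟩⟩ := isStokes_iff.1 hC y
  choose V hV hyV s hs hst using fun j => S.surjective_le U₂ _ _ (T₂.e_mem j) y hy₂
  let U : Opens Circle := U₁ ⊓ U₂ ⊓ Finset.univ.inf V
  have hU₁ : U ≤ U₁ := inf_le_left.trans inf_le_left
  have hU₂ : U ≤ U₂ := inf_le_left.trans inf_le_right
  have hUV : ∀ j, U ≤ V j := fun j => inf_le_right.trans (Finset.inf_le (Finset.mem_univ j))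
  have hyU : y ∈ U := by
    refine ⟨⟨hy₁, hy₂⟩, ?_⟩
    rw [Opens.coe_finset_inf, Finset.inf_set_eq_iInter]
    simpa using! hyV
  let T := T₁.restrict hU₁
  let T' := T₂.restrict hU₂
  let x : κ → Sec B.sheaf U := fun j => res B.sheaf (hUV j) (s j)
  have hx : ∀ j, x j ∈ B.le U (T'.label j) := fun j => B.le_res (hUV j) _ _ (hs j)
  have hgx : ∀ {W : Opens Circle} (hW : W ≤ U) (a : κ → k),
      onSec g.hom W (Frame.comb x hW a) = Frame.comb T'.e hW a := by
    intro W hW a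
    have h1 : ∀ j, onSec g.hom U (x j) = T'.e j := fun j => by
      rw [onSec_res, hst, res_res, Frame.e_restrict]
    rw [Frame.comb_apply, Frame.comb_apply, map_sum]
    refine Finset.sum_congr rfl fun j _ => ?_
    rw [map_smul, onSec_res, h1]
  let e : ι ⊕ κ → Sec B.sheaf U := Sum.elim (fun i => onSec f.hom U (T.e i)) x
  have he : ∀ {W : Opens Circle} (hW : W ≤ U) (a : ι ⊕ κ → k), Frame.comb e hW a =
      onSec f.hom W (Frame.comb T.e hW fun i => a (Sum.inl i)) +
        Frame.comb x hW fun j => a (Sum.inr j) := by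
    intro W hW a
    rw [Frame.comb_apply, Fintype.sum_sum_type, Frame.comb_apply, Frame.comb_apply, map_sum]
    congr 1
    refine Finset.sum_congr rfl fun i _ => ?_
    rw [map_smul, onSec_res]
    rfl
  have hgf : ∀ {W : Opens Circle} (z : Sec A.sheaf W), onSec g.hom W (onSec f.hom W z) = 0 :=
    fun {W} z => (S.exact W _).2 ⟨z, rfl⟩
  have hge : ∀ {W : Opens Circle} (hW : W ≤ U) (a : ι ⊕ κ → k),
      onSec g.hom W (Frame.comb e hW a) = Frame.comb T'.e hW fun j => a (Sum.inr j) := by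
    intro W hW a
    rw [he, map_add, hgf, zero_add, hgx]
  refine ⟨U, hyU, ι ⊕ κ, inferInstance, ⟨(Frame.exists_of_sections e
    (Sum.elim T.label T'.label) ?_ ?_ ?_ ?_).choose⟩⟩
  · intro W hW z p hp
    obtain ⟨W', hW', hp', h1⟩ := T'.exists_comb hW hp (onSec g.hom W z)
    set a'' := T'.germ hW hp (onSec g.hom W z)
    have h2 : onSec g.hom W' (res B.sheaf hW' z - Frame.comb x (hW'.trans hW) a'') = 0 := by
      rw [map_sub, onSec_res, h1, hgx, sub_self]
    obtain ⟨z', hz'⟩ := (S.exact W' _).1 h2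
    obtain ⟨W'', hW'', hp'', h3⟩ := T.exists_comb (hW'.trans hW) hp' z'
    refine ⟨W'', hW''.trans hW', hp'', Sum.elim (T.germ (hW'.trans hW) hp' z') a'', ?_⟩
    have h4 := congrArg (res B.sheaf hW'') hz'
    rw [← onSec_res, h3, map_sub, res_res, Frame.res_comb, eq_sub_iff_add_eq] at h4
    rw [he, ← h4]
    rfl
  · intro W hW p hp a ha
    have h1 := hge hW a
    rw [ha, map_zero] at h1
    have h2 := T'.germ_comb hW hp fun j => a (Sum.inr j)
    rw [← h1, map_zero] at h2
    have h3 := he hW a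
    rw [ha, ← h2, map_zero, add_zero] at h3
    have h4 := S.injective W (h3.symm.trans (map_zero _).symm)
    have h5 := T.germ_comb hW hp fun i => a (Sum.inl i)
    rw [h4, map_zero] at h5
    ext (i | j)
    · exact (congrFun h5 i).symm
    · exact (congrFun h2 j).symm
  · rintro (i | j)
    · exact f.mem _ _ _ (T.e_mem i)
    · exact hx j
  · intro W hW φ a ha
    have h1 := g.mem W φ _ ha
    rw [hge, T'.mem_le_iff_germ hW] at h1
    have h2 : ∀ j, a (Sum.inr j) ≠ 0 → Index.Le (Index.res hW (T'.label j)) φ := by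
      intro j hj t
      refine h1 j t ?_
      rwa [Frame.germ_comb]
    have h3 : Frame.comb x hW (fun j => a (Sum.inr j)) ∈ B.le W φ := by
      rw [Frame.comb_apply]
      refine Submodule.sum_mem _ fun j _ => ?_
      by_cases hj : a (Sum.inr j) = 0
      · rw [hj, zero_smul]
        exact Submodule.zero_mem _
      · exact Submodule.smul_mem _ _ (B.le_mono W _ _ (h2 j hj) (B.le_res hW _ _ (hx j)))
    rw [he] at ha
    have h4 := S.exact_le W φ _ ((Submodule.add_mem_iff_left _ h3).1 ha)
    rw [T.mem_le_iff_germ hW] at h4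
    rintro (i | j) hi
    · intro t
      refine h4 i t ?_
      rwa [Frame.germ_comb]
    · exact h2 j hi

/-! ### Exponential factors -/

section ExpFactors

variable {F G : PreStokes k E} {ι : Type}

/-- The members of a frame whose label is strictly less than `φ` generate a subsheaf of `F_{< φ}`,
so that an exponential factor is a label of each frame near some point. -/
lemma exists_label_of_mem_expFactors {φ : Index E ⊤} (h : φ ∈ F.expFactors) :
    ∃ t : ℝ, ∀ {U : Opens Circle} (ht : Circle.exp t ∈ U) {ι : Type} [Fintype ι]
      (T : Frame F U ι), ∃ i, (T.label i).1 ⟨t, ht⟩ = φ.1 ⟨t, trivial⟩ := by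
  classical
  obtain ⟨U₀, s, hs, hs'⟩ := h
  rw [MemLt] at hs'
  push Not at hs'
  obtain ⟨y, hy, hs'⟩ := hs'
  obtain ⟨t, rfl⟩ := exists_lift y
  refine ⟨t, fun {U} ht {ι} _ T => ?_⟩
  by_contra! hne
  have hyW : Circle.exp t ∈ U₀ ⊓ U := ⟨hy, ht⟩
  obtain ⟨V, hV, hyV, hcomb⟩ := T.exists_comb (inf_le_right : U₀ ⊓ U ≤ U) hyW
    (res F.sheaf inf_le_left s)
  refine hs' V (hV.trans inf_le_left) hyV ?_
  rw [res_res] at hcomb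
  rw [hcomb, Frame.comb_apply]
  refine Submodule.sum_mem _ fun i _ => ?_
  by_cases hi : T.germ (inf_le_right : U₀ ⊓ U ≤ U) hyW (res F.sheaf inf_le_left s) i = 0
  · rw [hi, zero_smul]
    exact Submodule.zero_mem _
  · refine Submodule.smul_mem _ _ ?_
    refine Submodule.mem_iSup_of_mem (Index.res (hV.trans inf_le_right) (T.label i))
      (Submodule.mem_iSup_of_mem ?_ (F.le_res _ _ _ (T.e_mem i)))
    intro r hr
    have h1 := F.le_res (inf_le_left : U₀ ⊓ U ≤ U₀) _ _ hs
    rw [T.mem_le_iff_germ inf_le_right] at h1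
    have hr' : Circle.exp r ∈ U₀ ⊓ U := hV r.2
    refine ⟨h1 i ⟨r, hr'⟩ ?_, fun heq => hne i ?_⟩
    · convert hi using 3
    · exact eq_of_exp_eq (Index.res (hV.trans inf_le_right) (T.label i))
        (Index.res le_top φ) r ⟨t, hyV⟩ hr heq

/-- The labels of the frames are exponential factors. -/
lemma mem_expFactors_of_label {φ : Index E ⊤} {U : Opens Circle} (T : Frame F U ι) (i : ι)
    (t : Lift U) (h : (T.label i).1 t = φ.1 ⟨t, trivial⟩) : φ ∈ F.expFactors := by
  classical
  obtain ⟨V, hV, htV, hVφ⟩ := Index.exists_res_eq (φ := T.label i) (ψ := Index.res le_top φ) t h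
  refine ⟨V, res F.sheaf hV (T.e i), ?_, fun hlt => ?_⟩
  · have := F.le_res hV _ _ (T.e_mem i)
    rwa [hVφ] at this
  · obtain ⟨V', hV', htV', hmem⟩ := hlt _ htV
    -- the coordinate `i` at the point vanishes on the subsheaf of smaller sections
    have hker : (⨆ (ψ : Index E V') (_ : Index.LtGerm (Circle.exp t) ψ
        (Index.res hV' (Index.res le_top φ))), F.le V' ψ) ≤
        LinearMap.ker (LinearMap.proj i ∘ₗ T.germ (hV'.trans hV) htV') := by
      refine iSup₂_le fun ψ hψ z hz => ?_
      by_contra hne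
      have h1 := (T.mem_le_iff_germ (hV'.trans hV) ψ z).1 hz i ⟨t, htV'⟩ hne
      obtain ⟨h2, h3⟩ := hψ ⟨t, htV'⟩ rfl
      refine h3 (h2.antisymm ?_)
      have h4 : (Index.res hV' (Index.res (le_top : V ≤ ⊤) φ)).1 ⟨t, htV'⟩ = (T.label i).1 t :=
        h.symm
      rw [h4]
      exact h1
    have h5 := hker hmem
    rw [LinearMap.mem_ker, LinearMap.comp_apply, res_res, T.germ_res le_rfl, Frame.germ_e] at h5
    simp at h5

variable (f : F ⟶ G) (hF : F.IsStokes) (hG : G.IsStokes)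
include hF hG

theorem expFactors_ker_subset : (ker f).expFactors ⊆ F.expFactors := by
  intro φ hφ
  obtain ⟨t, ht⟩ := exists_label_of_mem_expFactors hφ
  obtain ⟨U, hy, ⟨N⟩⟩ := exists_normalFrames f hF hG (Circle.exp t)
  obtain ⟨T, hT⟩ := N.exists_frame_ker
  obtain ⟨i, hi⟩ := ht hy T
  rw [hT] at hi
  exact mem_expFactors_of_label N.src _ ⟨t, hy⟩ hi

theorem expFactors_coker_subset : (coker f).expFactors ⊆ G.expFactors := by
  intro φ hφ
  obtain ⟨t, ht⟩ := exists_label_of_mem_expFactors hφ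
  obtain ⟨U, hy, ⟨N⟩⟩ := exists_normalFrames f hF hG (Circle.exp t)
  obtain ⟨T, hT⟩ := N.exists_frame_coker
  obtain ⟨i, hi⟩ := ht hy T
  rw [hT] at hi
  exact mem_expFactors_of_label N.tgt _ ⟨t, hy⟩ hi

theorem expFactors_im_subset : (im f).expFactors ⊆ F.expFactors ∩ G.expFactors := by
  intro φ hφ
  obtain ⟨t, ht⟩ := exists_label_of_mem_expFactors hφ
  obtain ⟨U, hy, ⟨N⟩⟩ := exists_normalFrames f hF hG (Circle.exp t)
  obtain ⟨T, hT⟩ := N.exists_frame_im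
  obtain ⟨i, hi⟩ := ht hy T
  rw [hT] at hi
  refine ⟨mem_expFactors_of_label N.src (Sum.inl i) ⟨t, hy⟩ ?_,
    mem_expFactors_of_label N.tgt _ ⟨t, hy⟩ hi⟩
  rw [← N.label_eq]
  exact hi

end ExpFactors

/-! ### The category of Stokes-filtered local systems is abelian -/

section Prefiltered

variable {F G X : PreStokes k E}

lemma hom_ext {f g : F ⟶ G} (h : f.hom = g.hom) : f = g := Hom.ext h

@[simp] lemma comp_hom (f : F ⟶ G) (g : G ⟶ X) : (f ≫ g).hom = f.hom ≫ g.hom := rfl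

@[simp] lemma add_hom (f g : F ⟶ G) : (f + g).hom = f.hom + g.hom := rfl

/-- Factorization through a morphism whose source has the induced filtration. -/
lemma exists_lift_of_comap (f : F ⟶ G)
    (hf : ∀ U φ s, onSec f.hom U s ∈ G.le U φ → s ∈ F.le U φ) (h : X ⟶ G)
    (l : X.sheaf ⟶ F.sheaf) (w : l ≫ f.hom = h.hom) : ∃ l' : X ⟶ F, l' ≫ f = h := by
  refine ⟨⟨l, fun U φ s hs => hf U φ _ ?_⟩, hom_ext w⟩
  rw [← onSec_comp, w]
  exact h.mem U φ s hs

/-- Factorization through a morphism whose target has the quotient filtration. -/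
lemma exists_desc_of_map (f : F ⟶ G)
    (hf : ∀ U φ t, t ∈ G.le U φ → F.MemMapLe f.hom U φ t) (h : F ⟶ X)
    (l : G.sheaf ⟶ X.sheaf) (w : f.hom ≫ l = h.hom) : ∃ l' : G ⟶ X, f ≫ l' = h := by
  refine ⟨⟨l, fun U φ t ht => X.le_local U φ _ fun y hy => ?_⟩, hom_ext w⟩
  obtain ⟨V, hV, hyV, s, hs, hst⟩ := hf U φ t ht y hy
  refine ⟨V, hV, hyV, ?_⟩
  rw [← onSec_res, ← hst, ← onSec_comp, w]
  exact h.mem V _ s hs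

/-- The inclusion of the kernel. -/
def kerι (f : F ⟶ G) : ker f ⟶ F := ⟨Limits.kernel.ι f.hom, fun _ _ _ hs => hs⟩

/-- The projection to the cokernel. -/
def cokerπ (f : F ⟶ G) : G ⟶ coker f :=
  ⟨Limits.cokernel.π f.hom, fun U _ s hs _ hy => ⟨U, le_rfl, hy, s, hs, (res_self _ _ _).symm⟩⟩

lemma kerι_comp (f : F ⟶ G) : kerι f ≫ f = 0 := hom_ext (Limits.kernel.condition f.hom)

lemma comp_cokerπ (f : F ⟶ G) : f ≫ cokerπ f = 0 := hom_ext (Limits.cokernel.condition f.hom)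

instance mono_kerι_hom (f : F ⟶ G) : Mono (kerι f).hom :=
  inferInstanceAs (Mono (Limits.kernel.ι f.hom))

instance epi_cokerπ_hom (f : F ⟶ G) : Epi (cokerπ f).hom :=
  inferInstanceAs (Epi (Limits.cokernel.π f.hom))

lemma exists_lift_kerι (f : F ⟶ G) (h : X ⟶ F) (w : h ≫ f = 0) :
    ∃ l : X ⟶ ker f, l ≫ kerι f = h :=
  exists_lift_of_comap (kerι f) (fun _ _ _ hs => hs) h
    (Limits.kernel.lift f.hom h.hom (congrArg Hom.hom w)) (Limits.kernel.lift_ι _ _ _)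

lemma exists_desc_cokerπ (f : F ⟶ G) (h : G ⟶ X) (w : f ≫ h = 0) :
    ∃ l : coker f ⟶ X, cokerπ f ≫ l = h :=
  exists_desc_of_map (cokerπ f) (fun _ _ _ ht => ht) h
    (Limits.cokernel.desc f.hom h.hom (congrArg Hom.hom w)) (Limits.cokernel.π_desc _ _ _)

/-- A strict monomorphism of sheaves is a kernel. -/
lemma exists_lift_of_isStrict (f : F ⟶ G) [Mono f.hom] (hf : IsStrict f) (h : X ⟶ G)
    (w : h ≫ cokerπ f = 0) : ∃ l : X ⟶ F, l ≫ f = h := by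
  refine exists_lift_of_comap f (fun U φ s hs => ?_) h
    (Abelian.monoLift f.hom h.hom (congrArg Hom.hom w)) (Abelian.monoLift_comp _ _ _)
  refine F.le_local U φ s fun y hy => ?_
  obtain ⟨V, hV, hyV, s', hs', h1⟩ := (hf U φ _).2
    ⟨hs, fun y hy => ⟨U, le_rfl, hy, s, by rw [res_self]⟩⟩ y hy
  rw [← onSec_res] at h1
  exact ⟨V, hV, hyV, onSec_injective_of_mono f.hom V h1 ▸ hs'⟩

/-- A strict epimorphism of sheaves is a cokernel. -/
lemma exists_desc_of_isStrict (f : F ⟶ G) [Epi f.hom] (hf : IsStrict f) (h : F ⟶ X)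
    (w : kerι f ≫ h = 0) : ∃ l : G ⟶ X, f ≫ l = h :=
  exists_desc_of_map f
    (fun U φ t ht => (hf U φ t).2 ⟨ht, fun _ hy => exists_local_lift f.hom t hy⟩) h
    (Abelian.epiDesc f.hom h.hom (congrArg Hom.hom w)) (Abelian.comp_epiDesc _ _ _)

open Limits in
/-- The direct sum of two filtered sheaves. -/
def sum (F G : PreStokes k E) : PreStokes k E where
  sheaf := F.sheaf ⊞ G.sheaf
  le U φ := (F.le U φ).comap (onSec biprod.fst U) ⊓ (G.le U φ).comap (onSec biprod.snd U)
  le_res h φ s hs := by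
    simp only [Submodule.mem_inf, Submodule.mem_comap] at hs ⊢
    rw [onSec_res, onSec_res]
    exact ⟨F.le_res h φ _ hs.1, G.le_res h φ _ hs.2⟩
  le_local U φ s hs := by
    refine ⟨F.le_local U φ _ fun y hy => ?_, G.le_local U φ _ fun y hy => ?_⟩ <;>
      obtain ⟨V, h, hyV, hV⟩ := hs y hy
    · exact ⟨V, h, hyV, by rw [← onSec_res]; exact hV.1⟩
    · exact ⟨V, h, hyV, by rw [← onSec_res]; exact hV.2⟩
  le_mono U φ ψ h := inf_le_inf (Submodule.comap_mono (F.le_mono U φ ψ h))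
    (Submodule.comap_mono (G.le_mono U φ ψ h))

open Limits in
/-- The direct sum, with its inclusions and projections. -/
def sumBicone (F G : PreStokes k E) : BinaryBicone F G where
  pt := sum F G
  fst := ⟨biprod.fst, fun _ _ _ hs => hs.1⟩
  snd := ⟨biprod.snd, fun _ _ _ hs => hs.2⟩
  inl := ⟨biprod.inl, fun U φ s hs =>
    ⟨(congrArg (fun f => onSec f U s ∈ F.le U φ) biprod.inl_fst).mpr hs,
      (congrArg (fun f => onSec f U s ∈ G.le U φ) biprod.inl_snd).mpr (Submodule.zero_mem _)⟩⟩
  inr := ⟨biprod.inr, fun U φ s hs =>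
    ⟨(congrArg (fun f => onSec f U s ∈ F.le U φ) biprod.inr_fst).mpr (Submodule.zero_mem _),
      (congrArg (fun f => onSec f U s ∈ G.le U φ) biprod.inr_snd).mpr hs⟩⟩
  inl_fst := hom_ext biprod.inl_fst
  inl_snd := hom_ext biprod.inl_snd
  inr_fst := hom_ext biprod.inr_fst
  inr_snd := hom_ext biprod.inr_snd

lemma sumBicone_total (F G : PreStokes k E) :
    (sumBicone F G).fst ≫ (sumBicone F G).inl + (sumBicone F G).snd ≫ (sumBicone F G).inr =
      𝟙 (sumBicone F G).pt := hom_ext Limits.biprod.total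

lemma isShortExact_sumBicone (F G : PreStokes k E) :
    IsShortExact (sumBicone F G).inl (sumBicone F G).snd where
  injective U s s' h := by
    have h1 := congrArg (onSec (sumBicone F G).fst.hom U) h
    rwa [← onSec_comp, ← onSec_comp, ← comp_hom, Limits.BinaryBicone.inl_fst] at h1
  exact U s := by
    constructor
    · intro h
      have h1 := congrArg (fun f => onSec (Hom.hom f) U s) (sumBicone_total F G)
      simp only [add_hom, comp_hom, onSec_add, onSec_comp, h, map_zero, add_zero] at h1
      exact ⟨_, h1⟩
    · rintro ⟨s', rfl⟩
      rw [← onSec_comp, ← comp_hom, Limits.BinaryBicone.inl_snd]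
      rfl
  surjective U t y hy := by
    refine ⟨U, le_rfl, hy, onSec (sumBicone F G).inr.hom U t, ?_⟩
    rw [← onSec_comp, ← comp_hom, Limits.BinaryBicone.inr_snd, res_self]
    rfl
  exact_le U φ s hs := by
    have h1 := (sumBicone F G).fst.mem U φ _ hs
    rwa [← onSec_comp, ← comp_hom, Limits.BinaryBicone.inl_fst] at h1
  surjective_le U φ t ht y hy := by
    refine ⟨U, le_rfl, hy, onSec (sumBicone F G).inr.hom U t,
      (sumBicone F G).inr.mem U _ _ ht, ?_⟩
    rw [← onSec_comp, ← comp_hom, Limits.BinaryBicone.inr_snd, res_self]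
    rfl

open scoped ZeroObject in
/-- The zero filtered sheaf. -/
def zero (k : Type u) [Field k] (E : AddSubgroup ℚ) : PreStokes k E where
  sheaf := 0
  le _ _ := ⊤
  le_res _ _ _ _ := trivial
  le_local _ _ _ _ := trivial
  le_mono _ _ _ _ := le_rfl

lemma id_zero : 𝟙 (zero k E) = 0 := hom_ext ((Limits.isZero_zero (Sh k)).eq_of_src _ _)

lemma isStokes_zero : (zero k E).IsStokes := by
  have h0 : ∀ (U : Opens Circle) (s : Sec (zero k E).sheaf U), s = 0 := fun U s =>
    congrArg (fun f => onSec (Hom.hom f) U s) (id_zero (k := k) (E := E))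
  refine isStokes_iff.2 fun y => ⟨⊤, trivial, Empty, inferInstance,
    ⟨(Frame.exists_of_sections (F := zero k E) (U := ⊤) Empty.elim Empty.elim ?_ ?_ ?_ ?_).choose⟩⟩
  · intro W hW s y hy
    exact ⟨W, le_rfl, hy, 0, (h0 _ _).trans (h0 _ _).symm⟩
  · exact fun _ _ _ _ _ _ => Subsingleton.elim _ _
  · exact fun i => i.elim
  · exact fun _ _ _ _ _ i => i.elim

end Prefiltered

end PreStokes

section Abelian

variable {k : Type u} [Field k] {E : AddSubgroup ℚ}

open PreStokes Limits

namespace StokesLocSys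

variable {X Y Z : StokesLocSys k E}

/-- The kernel of a morphism, as a Stokes-filtered local system. -/
def ker (f : X ⟶ Y) : StokesLocSys k E := ⟨PreStokes.ker f.hom, isStokes_ker f.hom X.2 Y.2⟩

/-- The cokernel of a morphism, as a Stokes-filtered local system. -/
def coker (f : X ⟶ Y) : StokesLocSys k E :=
  ⟨PreStokes.coker f.hom, isStokes_coker f.hom X.2 Y.2⟩

/-- The inclusion of the kernel. -/
def kerι (f : X ⟶ Y) : ker f ⟶ X := ⟨PreStokes.kerι f.hom⟩

/-- The projection to the cokernel. -/
def cokerπ (f : X ⟶ Y) : Y ⟶ coker f := ⟨PreStokes.cokerπ f.hom⟩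

lemma kerι_comp (f : X ⟶ Y) : kerι f ≫ f = 0 :=
  ObjectProperty.hom_ext _ (PreStokes.kerι_comp f.hom)

lemma comp_cokerπ (f : X ⟶ Y) : f ≫ cokerπ f = 0 :=
  ObjectProperty.hom_ext _ (PreStokes.comp_cokerπ f.hom)

lemma mono_of_mono_hom (f : X ⟶ Y) [Mono f.hom.hom] : Mono f where
  right_cancellation g h w := by
    refine ObjectProperty.hom_ext _ (PreStokes.hom_ext ?_)
    rw [← cancel_mono f.hom.hom]
    exact congrArg (fun l => l.hom.hom) w

lemma epi_of_epi_hom (f : X ⟶ Y) [Epi f.hom.hom] : Epi f where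
  left_cancellation g h w := by
    refine ObjectProperty.hom_ext _ (PreStokes.hom_ext ?_)
    rw [← cancel_epi f.hom.hom]
    exact congrArg (fun l => l.hom.hom) w

/-- A monomorphism of Stokes-filtered local systems is a monomorphism of sheaves, because its
kernel as a morphism of sheaves underlies a Stokes-filtered local system. -/
lemma mono_hom (f : X ⟶ Y) [Mono f] : Mono f.hom.hom := by
  have h : kerι f = 0 := by rw [← cancel_mono f, kerι_comp, zero_comp]
  exact Preadditive.mono_of_kernel_zero (congrArg (fun l => l.hom.hom) h)

lemma epi_hom (f : X ⟶ Y) [Epi f] : Epi f.hom.hom := by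
  have h : cokerπ f = 0 := by rw [← cancel_epi f, comp_cokerπ, comp_zero]
  exact Preadditive.epi_of_cokernel_zero (congrArg (fun l => l.hom.hom) h)

instance (f : X ⟶ Y) : Mono (kerι f) := by
  have : Mono (kerι f).hom.hom := mono_kerι_hom f.hom
  exact mono_of_mono_hom _

instance (f : X ⟶ Y) : Epi (cokerπ f) := by
  have : Epi (cokerπ f).hom.hom := epi_cokerπ_hom f.hom
  exact epi_of_epi_hom _

/-- A morphism which is a monomorphism is a kernel as soon as each morphism killed by `g` factors
through it. -/
def isLimitOfExists {i : Z ⟶ X} [Mono i] {g : X ⟶ Y} (w : i ≫ g = 0)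
    (h : ∀ {A : StokesLocSys k E} (l : A ⟶ X), l ≫ g = 0 →
      ∃ m : A.obj ⟶ Z.obj, m ≫ i.hom = l.hom) : IsLimit (KernelFork.ofι i w) :=
  KernelFork.IsLimit.ofι' i w fun l hl =>
    ⟨⟨(h l hl).choose⟩, ObjectProperty.hom_ext _ (h l hl).choose_spec⟩

/-- A morphism which is an epimorphism is a cokernel as soon as each morphism which kills `g`
factors through it. -/
def isColimitOfExists {p : Y ⟶ Z} [Epi p] {g : X ⟶ Y} (w : g ≫ p = 0)
    (h : ∀ {A : StokesLocSys k E} (l : Y ⟶ A), g ≫ l = 0 →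
      ∃ m : Z.obj ⟶ A.obj, p.hom ≫ m = l.hom) : IsColimit (CokernelCofork.ofπ p w) :=
  CokernelCofork.IsColimit.ofπ' p w fun l hl =>
    ⟨⟨(h l hl).choose⟩, ObjectProperty.hom_ext _ (h l hl).choose_spec⟩

instance hasKernels : HasKernels (StokesLocSys k E) where
  has_limit f := ⟨⟨⟨_, isLimitOfExists (kerι_comp f) fun l hl =>
    exists_lift_kerι f.hom l.hom (congrArg (fun l => l.hom) hl)⟩⟩⟩

instance hasCokernels : HasCokernels (StokesLocSys k E) where
  has_colimit f := ⟨⟨⟨_, isColimitOfExists (comp_cokerπ f) fun l hl =>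
    exists_desc_cokerπ f.hom l.hom (congrArg (fun l => l.hom) hl)⟩⟩⟩

lemma hasBinaryBiproduct (X Y : StokesLocSys k E) : HasBinaryBiproduct X Y :=
  let b : BinaryBicone X Y :=
    { pt := ⟨sum X.obj Y.obj, isStokes_of_isShortExact (isShortExact_sumBicone _ _) X.2 Y.2⟩
      fst := ⟨(sumBicone X.obj Y.obj).fst⟩
      snd := ⟨(sumBicone X.obj Y.obj).snd⟩
      inl := ⟨(sumBicone X.obj Y.obj).inl⟩
      inr := ⟨(sumBicone X.obj Y.obj).inr⟩
      inl_fst := ObjectProperty.hom_ext _ (sumBicone X.obj Y.obj).inl_fst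
      inl_snd := ObjectProperty.hom_ext _ (sumBicone X.obj Y.obj).inl_snd
      inr_fst := ObjectProperty.hom_ext _ (sumBicone X.obj Y.obj).inr_fst
      inr_snd := ObjectProperty.hom_ext _ (sumBicone X.obj Y.obj).inr_snd }
  hasBinaryBiproduct_of_total b (ObjectProperty.hom_ext _ (sumBicone_total X.obj Y.obj))

instance hasFiniteProducts : HasFiniteProducts (StokesLocSys k E) := by
  have : HasZeroObject (StokesLocSys k E) :=
    ⟨⟨zero k E, isStokes_zero⟩, (IsZero.iff_id_eq_zero _).2 (ObjectProperty.hom_ext _ id_zero)⟩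
  have : HasBinaryBiproducts (StokesLocSys k E) := ⟨hasBinaryBiproduct⟩
  exact hasFiniteProducts_of_has_binary_and_terminal

instance isNormalMonoCategory : IsNormalMonoCategory (StokesLocSys k E) where
  normalMonoOfMono {X Y} f _ := by
    have := mono_hom f
    exact ⟨⟨coker f, cokerπ f, comp_cokerπ f, isLimitOfExists (comp_cokerπ f) fun l hl =>
      exists_lift_of_isStrict f.hom (isStrict f.hom X.2 Y.2) l.hom
        (congrArg (fun l => l.hom) hl)⟩⟩

instance isNormalEpiCategory : IsNormalEpiCategory (StokesLocSys k E) where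
  normalEpiOfEpi {X Y} f _ := by
    have := epi_hom f
    exact ⟨⟨ker f, kerι f, kerι_comp f, isColimitOfExists (kerι_comp f) fun l hl =>
      exists_desc_of_isStrict f.hom (isStrict f.hom X.2 Y.2) l.hom
        (congrArg (fun l => l.hom) hl)⟩⟩

/-- The category of Stokes-filtered local systems is abelian. -/
abbrev abelian : Abelian (StokesLocSys k E) where

end StokesLocSys

end Abelian

end Stokes

end

theorem mainTheorem1 (k : Type u) [Field k] :
    -- Stokes filtrations of arbitrary ramification, or ramified of order at most `d`
    (∀ E : AddSubgroup ℚ, (E = ⊤ ∨ ∃ d : ℕ, 1 ≤ d ∧ E = Stokes.exponents d) →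
      (∃ A : Abelian (Stokes.StokesLocSys k E), A.toPreadditive = (inferInstance : Preadditive (Stokes.StokesLocSys k E))) ∧
      (∀ (L L' : Stokes.PreStokes k E), L.IsStokes → L'.IsStokes → ∀ f : L ⟶ L',
        Stokes.PreStokes.IsStrict f ∧ (Stokes.PreStokes.ker f).IsStokes ∧ (Stokes.PreStokes.im f).IsStokes ∧
          (Stokes.PreStokes.coim f).IsStokes ∧ (Stokes.PreStokes.coker f).IsStokes) ∧
      (∀ (L' L L'' : Stokes.PreStokes k E) (f : L' ⟶ L) (g : L ⟶ L''),
        Stokes.PreStokes.IsShortExact f g → L'.IsStokes → L''.IsStokes → L.IsStokes)) ∧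
    -- the non-ramified case
    (∀ (L L' : Stokes.PreStokes k (Stokes.exponents 1)), L.IsStokes → L'.IsStokes →
      (∀ y : Circle, ∃ U : Opens Circle, y ∈ U ∧
        ∃ (T : L.Trivialization U) (T' : L'.Trivialization U),
          ∀ f : L ⟶ L', Stokes.PreStokes.IsDiagonal T T' f) ∧
      (∀ f : L ⟶ L',
        (Stokes.PreStokes.ker f).expFactors ⊆ L.expFactors ∧
        (Stokes.PreStokes.coker f).expFactors ⊆ L'.expFactors ∧
        (Stokes.PreStokes.im f).expFactors ⊆ L.expFactors ∩ L'.expFactors)) := by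
  refine ⟨fun E _ => ⟨⟨Stokes.StokesLocSys.abelian, rfl⟩, ?_, ?_⟩, fun L L' hL hL' => ⟨?_, ?_⟩⟩
  · exact fun L L' hL hL' f => ⟨Stokes.PreStokes.isStrict f hL hL',
      Stokes.PreStokes.isStokes_ker f hL hL', Stokes.PreStokes.isStokes_im f hL hL',
      Stokes.PreStokes.isStokes_coim f hL hL', Stokes.PreStokes.isStokes_coker f hL hL'⟩
  · exact fun _ _ _ _ _ S hL' hL'' => Stokes.PreStokes.isStokes_of_isShortExact S hL' hL''
  · intro y
    obtain ⟨U, hy, -, ι, κ, _, _, _, _, T, T', h⟩ :=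
      Stokes.PreStokes.exists_diagonal_frames hL hL' y
    exact ⟨U, hy, T.toTrivialization, T'.toTrivialization, fun f =>
      Stokes.PreStokes.Frame.isDiagonal_of_mat T T' f (h f)⟩
  · exact fun f => ⟨Stokes.PreStokes.expFactors_ker_subset f hL hL',
      Stokes.PreStokes.expFactors_coker_subset f hL hL',
      Stokes.PreStokes.expFactors_im_subset f hL hL'⟩
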